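/- **Model (Amoebot).** Particles live on the infinite triangular grid. A particle is contracted (it occupies one vertex, its head) or expanded (it occupies two adjacent vertices, its head and its tail). In each stage an adversarial scheduler activates an arbitrary set of particles, subject only to the requirement that every particle is activated infinitely often. An active particle sees, for each of the six vertices adjacent to its head, whether it is empty or a head or a tail of a particle; it knows whether it is expanded and where its tail lies; it reads the messages that have arrived at its six ports. From this and its internal state a deterministic algorithm, the same for all particles, computes a new state, messages to neighbouring heads, and a move (stay, expand into an adjacent vertex, contract into the head). States and messages come from finite sets. Expansion into an occupied vertex fails, and if several particles try to enter the same empty vertex, exactly one, chosen by the adversary, succeeds. Each particle numbers its ports $0,\dots,5$ in rotational order; the position of port $0$ and the sense of rotation may differ between particles. A RAM has finitely many registers holding non-negative integers and a finite program of instructions $\mathrm{Inc}(r)$ (increment $r$, go to the next instruction) and $\mathrm{TestDec}(r,i)$ (if $r=0$ jump to instruction $i$, otherwise decrement $r$ and go to the next instruction); it stops when there is no instruction with the current index. Consider four particles: a pivot $P$, a marker $M_2$, a leader $L$ and a marker $M_1$. They *represent* $(r_1,r_2)$ at the vertex $o$ in the direction $d$ if all are contracted and lie in the order $P,M_2,L,M_1$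 on the ray from $o$ in direction $d$, with $P$ at $o$, exactly $r_2$ empty vertices between $P$ and $M_2$, and exactly $r_1$ empty vertices between $M_2$ and $M_1$. In the initial configurations below, $L$ is anywhere between $M_2$ and $M_1$, there are no messages, and the initial internal states of $P$, $M_2$, $M_1$ are fixed, while that of $L$ depends only on its port that leads towards $M_1$. The algorithm and the initial states depend only on the given program or Turing machine (with the assignment of operations), and everything holds for all $o$, $d$, all port numberings (except as stated in 3 and 4), all fair schedules and all choices of the adversary. **Theorem.** 1. *(RAM simulation)* For every RAM program with two registers there are an algorithm and initial states such that, started from any represented pair $(a_1,a_2)$, the four particles always remain on their line in the order $P,M_2,L,M_1$, $P$ never moves, and there are times $0=\tau_0<\tau_1<\cdots$ such that at time $\tau_k$ the particles represent the register values of the RAM, started with $(a_1,a_2)$ at its first instruction, after $k$ steps, and during $[\tau_k,\tau_{k+1})$ the internal state of $L$ determines the index of the instruction to be simulated. If the RAM stops, the particles represent its final register values from then on, and eventually no particle ever moves again. 2. *(Turing-completeness)* For every Turing machine with finitely many symbols and states that computes a partial function $f:\mathbb N\rightharpoonup\mathbb N$ (in unary notation) there are an algorithm, initial states and a set of halting states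 of $L$ such that, started from the represented pair $(2^n,0)$, the particles always remain on their line in their order with $P$ still; whenever $L$ is in a halting state, $f(n)$ is defined and the particles represent $(2^{f(n)},0)$; and if $f(n)$ is defined, then from some time on $L$ is in a halting state and no particle moves. 3. *(Mobile RAM)* Let $U$ be a RAM program with $c$ ordinary registers and $m$ flag registers, and let each flag be assigned one of the operations "move the whole system by one step in direction number $j$" ($0\le j<6$, where $0$ is the forward direction of the line and the others are numbered in the rotational order of the ports), "terminate", or "signal" (an action that merely enters the memory of $L$). If some flag is assigned a move, assume that all particles number their ports in the same sense of rotation. Then there are an algorithm and initial states such that the following holds when the flags are initially $0$, the ordinary registers are arbitrary, and the initial represented pair is $(g,0)$, where $g=\prod_i p_i^{a_i}$ ($p_i$ the $i$-th prime) is the Gödel number of the contents $a_i$ of the $c+m$ registers of $U$, flag registers last. There are times $0=\tau_0<\tau_1<\cdots$ such that at time $\tau_k$ the particles represent $(g_k,0)$ at the vertex $o_k$ in the direction $d$, where $g_k$ is the Gödel number of the register contents of $U$ after $k$ steps, and $o_k$ is $o$ displaced by the moves of all flags that were non-zero after steps $1,\dots,k$ (each such flag counted once for each such step). During $[\tau_k,\tau_{k+1})$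 the state of $L$ determines the instruction index of $U$ and the set of non-zero flags after $k$ steps. During $[\tau_k,\tau_{k+1}]$ the position of $P$ is always $o_k$ displaced by some of the moves that are due after step $k+1$; if none is due, the particles remain on the line in their order with $P$ still. When $U$ stops or a "terminate" flag is set, the pair, the position and the memory of $L$ are preserved from then on, and eventually no particle ever moves again. 4. *(Programmed movement)* Let a Turing machine with finitely many symbols and states be given that, in each step, outputs at most one of finitely many operations as in 3, as determined by its current state and the scanned symbol. If moves are among the operations, assume a common sense of rotation. Then there are an algorithm and initial states such that, for every $n$, the particles started from the represented pair $(2^n,0)$ perform, in order, exactly the operations that the machine outputs on the unary input $n$: with times $\tau_0<\tau_1<\cdots$, before $\tau_0$ the system computes on its line with $P$ still, and from then on everything in 3 holds with the steps and outputs of the machine in place of the steps and flags of $U$; here the value represented in the first register is not prescribed, and $L$'s state during $[\tau_k,\tau_{k+1})$ determines the output of the $k$-th step. -/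

import Mathlib

namespace Amoebot

/-! ## The triangular grid -/

/-- Vertices of the infinite regular triangular grid, in axial coordinates. -/
abbrev Grid : Type := ℤ × ℤ

/-- The six unit vectors of the grid in counterclockwise order; two vertices are adjacent
iff they differ by one of them. -/
def unitVec (k : ZMod 6) : Grid :=
  (![(1, 0), (0, 1), (-1, 1), (-1, 0), (0, -1), (1, -1)] : Fin 6 → Grid) k

/-- The port labelling of a particle: the direction of port `0`, and whether the ports are
numbered clockwise. -/
structure Handedness where
  offset : ZMod 6
  clockwise : Bool

/-- `1` for counterclockwise labellings and `-1` for clockwise ones. -/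
def Handedness.sign (h : Handedness) : ZMod 6 := if h.clockwise then -1 else 1

/-- The absolute direction of a port. -/
def Handedness.dir (h : Handedness) (port : ZMod 6) : ZMod 6 := h.offset + h.sign * port

/-- The port that lies in a given absolute direction (the inverse of `dir`). -/
def Handedness.port (h : Handedness) (d : ZMod 6) : ZMod 6 := h.sign * (d - h.offset)

/-! ## Particles and their algorithms -/

/-- What a particle sees at a vertex adjacent to its head. The only vertex of a contracted
particle is its head. -/
inductive Look
  | empty
  | head
  | tail

/-- What an active particle may do; `expand` is given a port of the particle. -/
inductive Move
  | stay
  | expand (port : ZMod 6)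
  | contract

/-- What an active particle decides: a new internal state, a message (or none) for each port,
and a move. -/
structure Decision (State Msg : Type) where
  state : State
  send : ZMod 6 → Option Msg
  move : Move

/-- A deterministic distributed algorithm for anonymous particles with finitely many internal
states and finitely many messages. The decision of an active particle depends on its internal
state, on what it sees at its six ports, on the port at which its own tail lies
(`none` if it is contracted), and on the messages that have come in at its ports. -/
structure Algorithm where
  State : Type
  Msg : Type
  finState : Finite State
  finMsg : Finite Msg
  decide : State → (ZMod 6 → Look) → Option (ZMod 6) → (ZMod 6 → Option Msg) → Decision State Msg

/-- A particle; it is contracted iff `head = tail`. `inbox` holds, for every port, the unread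
message that came in there. -/
structure Particle (A : Algorithm) where
  head : Grid
  tail : Grid
  state : A.State
  inbox : ZMod 6 → Option A.Msg

/-- A configuration of a system of particles indexed by `ι` (the particles do not know their
index). -/
abbrev Config (A : Algorithm) (ι : Type) : Type := ι → Particle A

section Dynamics

variable {A : Algorithm} {ι : Type}

/-- A vertex is occupied. -/
def Occupied (C : Config A ι) (v : Grid) : Prop := ∃ i, (C i).head = v ∨ (C i).tail = v

open Classical in
/-- What is to be seen at the vertex `v`. -/
noncomputable def lookAt (C : Config A ι) (v : Grid) : Look :=
  if ∃ i, (C i).head = v then Look.head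
  else if ∃ i, (C i).tail = v then Look.tail
  else Look.empty

open Classical in
/-- The port of particle `i` at which its own tail lies, if it is expanded. -/
noncomputable def tailPort (hand : ι → Handedness) (C : Config A ι) (i : ι) :
    Option (ZMod 6) :=
  if h : (C i).head ≠ (C i).tail ∧
      ∃ p, (C i).tail = (C i).head + unitVec ((hand i).dir p) then
    some h.2.choose
  else none

/-- The decision that particle `i` takes if it is active in the configuration `C`. -/
noncomputable def decision (hand : ι → Handedness) (C : Config A ι) (i : ι) :
    Decision A.State A.Msg :=
  A.decide (C i).state (fun p => lookAt C ((C i).head + unitVec ((hand i).dir p)))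
    (tailPort hand C i) (C i).inbox

/-- Particle `i`, if active in `C`, attempts to expand into the vertex `v`. -/
def Attempts (hand : ι → Handedness) (C : Config A ι) (i : ι) (v : Grid) : Prop :=
  (C i).head = (C i).tail ∧
    ∃ p, (decision hand C i).move = Move.expand p ∧ v = (C i).head + unitVec ((hand i).dir p)

/-- When the particles in `active` are active in `C`, one of them sends the message `m` so that it
arrives at port `p` of particle `i`; the heads of the two have to be adjacent. -/
def Receives (hand : ι → Handedness) (active : Set ι) (C : Config A ι) (i : ι) (p : ZMod 6)
    (m : A.Msg) : Prop :=
  ∃ j ∈ active, (C j).head = (C i).head + unitVec ((hand i).dir p) ∧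
    ∃ q, (C i).head = (C j).head + unitVec ((hand j).dir q) ∧
      (decision hand C j).send q = some m

/-- `C'` may be the configuration after a stage that starts in `C` and in which exactly the
particles in `active` are active. The adversary chooses the set `winners` of particles whose
attempts to expand succeed: no vertex that was occupied is entered, and of the particles that
attempt to enter one and the same unoccupied vertex, exactly one succeeds.

An active particle reads, and thereby clears, all its messages. A message sent to a particle that
has not read the previous message from the same port replaces that message. -/
def Stage (hand : ι → Handedness) (active : Set ι) (C C' : Config A ι) : Prop :=
  ∃ winners ⊆ active,
    (∀ i ∈ winners, ∃ v, Attempts hand C i v ∧ ¬ Occupied C v) ∧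
    (∀ i ∈ winners, ∀ j ∈ winners, ∀ v, Attempts hand C i v → Attempts hand C j v → i = j) ∧
    (∀ i ∈ active, ∀ v, Attempts hand C i v → ¬ Occupied C v →
      ∃ j ∈ winners, Attempts hand C j v) ∧
    (∀ i, i ∉ active → (C' i).head = (C i).head ∧ (C' i).tail = (C i).tail ∧
      (C' i).state = (C i).state) ∧
    (∀ i ∈ active, (C' i).state = (decision hand C i).state) ∧
    (∀ i ∈ winners, Attempts hand C i (C' i).head ∧ (C' i).tail = (C i).tail) ∧
    (∀ i ∈ active, i ∉ winners → (C' i).head = (C i).head ∧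
      ((decision hand C i).move = Move.contract → (C' i).tail = (C i).head) ∧
      ((decision hand C i).move ≠ Move.contract → (C' i).tail = (C i).tail)) ∧
    (∀ i p m, (C' i).inbox p = some m ↔
      Receives hand active C i p m ∨
        ((∀ m', ¬ Receives hand active C i p m') ∧ i ∉ active ∧ (C i).inbox p = some m))

/-- `C 0, C 1, …` is an execution under the scheduler `active`, and the scheduler is fair:
it activates every particle infinitely often. -/
def FairExecution (hand : ι → Handedness) (active : ℕ → Set ι) (C : ℕ → Config A ι) : Prop :=
  (∀ t, Stage hand (active t) (C t) (C (t + 1))) ∧ ∀ i t, ∃ t' ≥ t, i ∈ active t'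

end Dynamics

/-! ## Systems of four particles -/

/-- The pivot `P`, the marker `M₂` of the second register, the leader `L`, and the marker `M₁` of
the first register. -/
inductive Role
  | pivot
  | marker2
  | leader
  | marker1

/-- An algorithm together with the initial internal states of the four particles. The leader
initially knows the port that leads towards `M₁`; the other particles have no knowledge of the
orientation of the line. -/
structure Simulator where
  alg : Algorithm
  pivot : alg.State
  marker2 : alg.State
  leader : ZMod 6 → alg.State
  marker1 : alg.State

/-- The configurations of the four particles. -/
abbrev Simulator.Cfg (V : Simulator) : Type := Config V.alg Role

/-- The four particles are contracted and lie on the ray from `o` in direction `d` in the order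
`P`, `M₂`, `L`, `M₁`; the pivot is at `o`, there are `r₂` empty vertices between `P` and `M₂`, and
`r₁` empty vertices between `M₂` and `M₁`. -/
def Encodes {A : Algorithm} (o : Grid) (d : ZMod 6) (r₁ r₂ : ℕ) (C : Config A Role) : Prop :=
  (∀ i, (C i).head = (C i).tail) ∧
  (C Role.pivot).head = o ∧
  (C Role.marker2).head = o + (r₂ + 1) • unitVec d ∧
  (∃ j ≤ r₁, (C Role.leader).head = o + (r₂ + 1 + (j + 1)) • unitVec d) ∧
  (C Role.marker1).head = o + (r₂ + 1 + (r₁ + 2)) • unitVec d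

/-- The four particles, contracted or expanded, are on the line through `o` with direction `d`,
in the order `P`, `M₂`, `L`, `M₁`, and the pivot is contracted at `o`. -/
def Layout {A : Algorithm} (o : Grid) (d : ZMod 6) (C : Config A Role) : Prop :=
  ∃ h t : Role → ℤ,
    (∀ i, (C i).head = o + h i • unitVec d ∧ (C i).tail = o + t i • unitVec d) ∧
    h Role.pivot = 0 ∧ t Role.pivot = 0 ∧
    0 < min (h Role.marker2) (t Role.marker2) ∧
    max (h Role.marker2) (t Role.marker2) < min (h Role.leader) (t Role.leader) ∧
    max (h Role.leader) (t Role.leader) < min (h Role.marker1) (t Role.marker1)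

/-- The initial configurations: the register values are `r₁` and `r₂`, the leader is anywhere
between the two markers, and there are no messages yet. -/
def Simulator.Starts (V : Simulator) (hand : Role → Handedness) (o : Grid) (d : ZMod 6)
    (r₁ r₂ : ℕ) (C : V.Cfg) : Prop :=
  Encodes o d r₁ r₂ C ∧
  (C Role.pivot).state = V.pivot ∧
  (C Role.marker2).state = V.marker2 ∧
  (C Role.leader).state = V.leader ((hand Role.leader).port d) ∧
  (C Role.marker1).state = V.marker1 ∧
  ∀ i p, (C i).inbox p = none

/-- From time `T` on, no particle moves. -/
def StillFrom {A : Algorithm} (T : ℕ) (C : ℕ → Config A Role) : Prop :=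
  ∀ t ≥ T, ∀ i, (C t i).head = (C T i).head ∧ (C t i).tail = (C T i).tail

/-! ## Random-access machines -/

namespace RAM

/-- Instructions of a RAM whose registers are indexed by `R`. -/
inductive Instr (R : Type)
  | inc (r : R)
  | testDec (r : R) (i : ℕ)

/-- Programs; instructions are numbered from `0`. -/
abbrev Program (R : Type) : Type := List (Instr R)

/-- The index of the current instruction and the contents of the registers. -/
structure Cfg (R : Type) where
  pc : ℕ
  regs : R → ℕ

/-- One step of a RAM; the RAM stops when there is no instruction with the current index. -/
def step {R : Type} [DecidableEq R] (Q : Program R) (c : Cfg R) : Option (Cfg R) :=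
  match Q[c.pc]? with
  | none => none
  | some (Instr.inc r) => some ⟨c.pc + 1, Function.update c.regs r (c.regs r + 1)⟩
  | some (Instr.testDec r i) =>
      if c.regs r = 0 then some ⟨i, c.regs⟩
      else some ⟨c.pc + 1, Function.update c.regs r (c.regs r - 1)⟩

end RAM

/-- The Gödel number of the contents of `c` ordinary registers and `m` flag registers. -/
noncomputable def goedel {c m : ℕ} (regs : Fin c ⊕ Fin m → ℕ) : ℕ :=
  (∏ i : Fin c, Nat.nth Nat.Prime i ^ regs (Sum.inl i)) *
    ∏ j : Fin m, Nat.nth Nat.Prime (c + j) ^ regs (Sum.inr j)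

/-! ## Programmed operations -/

/-- The special operations. `move k` moves the whole system by one step in the direction that is
numbered `k` when the forward direction of the line (from `P` to `M₁`) is numbered `0` and the
others are numbered in the rotational order in which the particles number their ports.
`terminate` makes all particles stay where they are forever. `signal` stands for any other action:
it does nothing but enter the memory of the leader. -/
inductive Operation
  | move (k : ZMod 6)
  | terminate
  | signal

/-- The displacement of the system by an operation; `d` is the direction of the line and `s` the
sign of the common port numbering. -/
def Operation.disp (d s : ZMod 6) : Operation → Grid
  | move k => unitVec (d + s * k)
  | terminate => 0
  | signal => 0

/-- An abstract controller with states `S` and `m` flags, each of which is assigned a special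
operation. Whenever the controller has made a step, the operations whose flags are set in the
new state have to be performed. -/
structure Controller (S : Type) (m : ℕ) where
  next : S → Option S
  flags : S → Finset (Fin m)
  op : Fin m → Operation

namespace Controller

variable {S : Type} {m : ℕ} (K : Controller S m)

/-- The controller has stopped, either by itself or by an operation `terminate`. -/
def Halted (x : S) : Prop := K.next x = none ∨ ∃ f ∈ K.flags x, K.op f = Operation.terminate

/-- Total displacement by the operations of a set of flags. -/
def disp (d s : ZMod 6) (G : Finset (Fin m)) : Grid := ∑ f ∈ G, (K.op f).disp d s

open Classical in
/-- State of the controller and position of the pivot after `k` steps (a halted controller remains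
as it is). -/
noncomputable def run (d s : ZMod 6) (x₀ : S) (o : Grid) : ℕ → S × Grid
  | 0 => (x₀, o)
  | k + 1 =>
      let c := run d s x₀ o k
      if K.Halted c.1 then c
      else
        match K.next c.1 with
        | none => c
        | some x => (x, c.2 + K.disp d s (K.flags x))

/-- The execution `C` of four particles simulates the run of the controller from the state `x₀`,
starting with the pivot at `o`: at the time `τ k` exactly `k` steps of the controller, including
their special operations, have been simulated.

`code x r₁ r₂` tells that the register values `r₁`, `r₂` are admissible for the state `x` of the
controller, and `view x` is the part of the state `x` that the leader holds in its memory, from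
which it is retrieved by `read`. -/
def SimulatedBy (code : S → ℕ → ℕ → Prop) {ρ : Type} (view : S → ρ) {A : Algorithm}
    (read : A.State → ρ) (d s : ZMod 6) (x₀ : S) (o : Grid) (τ : ℕ → ℕ)
    (C : ℕ → Config A Role) : Prop :=
  StrictMono τ ∧
  ∀ k,
    let x := (K.run d s x₀ o k).1
    let p := (K.run d s x₀ o k).2
    let x' := (K.run d s x₀ o (k + 1)).1
    -- the state and the position are represented at time `τ k`
    (∃ r₁ r₂, code x r₁ r₂ ∧ Encodes p d r₁ r₂ (C (τ k))) ∧
    -- the leader remembers its part of the state during the simulation of the next step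
    (∀ t, τ k ≤ t → t < τ (k + 1) → read (C t Role.leader).state = view x) ∧
    -- until the next step is completed, the system makes no other displacements than those asked for
    (¬ K.Halted x → ∀ t, τ k ≤ t → t ≤ τ (k + 1) →
      ∃ G ⊆ K.flags x', (C t Role.pivot).head = p + K.disp d s G) ∧
    -- if none is asked for, the particles stay on the line in their order, and the pivot stays still
    (¬ K.Halted x → (∀ f ∈ K.flags x', ∀ j, K.op f ≠ Operation.move j) →
      ∀ t, τ k ≤ t → t ≤ τ (k + 1) → Layout p d (C t)) ∧
    -- after halting, the result is preserved, and the system eventually stays still forever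
    (K.Halted x →
      (∀ t ≥ τ k, (∃ r₁ r₂, code x r₁ r₂ ∧ Encodes p d r₁ r₂ (C t)) ∧
        read (C t Role.leader).state = view x) ∧
      ∃ T, StillFrom T C)

end Controller

/-- All particles number their ports in the same rotational order (they may still disagree on
port `0`). -/
def CommonRotation (hand : Role → Handedness) : Prop :=
  ∀ i j, (hand i).clockwise = (hand j).clockwise

/-- A plain RAM with two registers as a controller without flags. -/
def ramController (Q : RAM.Program (Fin 2)) : Controller (RAM.Cfg (Fin 2)) 0 where
  next := RAM.step Q
  flags := fun _ => ∅
  op := Fin.elim0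

/-- A mobile RAM: a RAM with `c` ordinary registers and `m` flag registers; a flag is set if its
register does not hold `0`. -/
def mobileRAM {c m : ℕ} (U : RAM.Program (Fin c ⊕ Fin m)) (op : Fin m → Operation) :
    Controller (RAM.Cfg (Fin c ⊕ Fin m)) m where
  next := RAM.step U
  flags := fun x => Finset.univ.filter fun f => x.regs (Sum.inr f) ≠ 0
  op := op

/-! ## Turing machines -/

section TM

variable {Γ Λ : Type} [Inhabited Γ] [Inhabited Λ]

/-- The Turing machine `M` computes the partial function `f`, numbers being written in unary as
blocks of the symbol `σ`, starting from the cell under the tape head. -/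
def TMComputes (M : Turing.TM0.Machine Γ Λ) (σ : Γ) (f : ℕ →. ℕ) : Prop :=
  ∀ n, Turing.TM0.eval M (List.replicate n σ) =
    (f n).map fun k => Turing.ListBlank.mk (List.replicate k σ)

/-- A Turing machine that outputs a sequence of special operations: when it makes a step from the
internal state `q` while reading the symbol `a`, it outputs the operation with index `plot q a`,
if any. A state of this controller consists of the configuration of the machine and the output
of its last step. -/
def plottingTM {m : ℕ} (M : Turing.TM0.Machine Γ Λ) (plot : Λ → Γ → Option (Fin m))
    (op : Fin m → Operation) : Controller (Turing.TM0.Cfg Γ Λ × Option (Fin m)) m where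
  next := fun x => (Turing.TM0.step M x.1).map fun y => (y, plot x.1.q x.1.Tape.head)
  flags := fun x => x.2.toFinset
  op := op

end TM

end Amoebot

/-!
The theorem holds because four particles can be programmed so that only one of them can do anything
at any time. If all particles but one are passive, that is, would neither move, nor send, nor change
their state, then neither the scheduler nor the adversary has a choice: the configuration remains as
it is until the remaining particle becomes active, and then changes in a determined way
(`Amoebot.next_of_effect`). So every fair execution passes through the same sequence of
configurations, up to repetitions (`Amoebot.FairExecution.of_transGen`), and the rest is programming.

The leader executes a program of tasks: looking whether a vertex is empty, making a step, asking a
neighbour to move away, and drawing a neighbour behind it (`Amoebot.taskAlg`, `Amoebot.adv_look`,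
`Amoebot.adv_step`, `Amoebot.adv_send_shift`, `Amoebot.adv_pull` and their variants, in which `M₂`
passes the request on to the pivot). The markers and the pivot only react, and identify the port of
the sender by the message itself, so that the port numberings are immaterial as long as everything
takes place on the line. Walking between the markers, the leader can increment, decrement and test
both registers (`Amoebot.steps_inc_zero` and the lemmas that follow it). When the second register is
zero, `M₂` is next to the pivot, and the whole system can be moved by one step. Thus every counter
machine with two registers is realized by the four particles, the control state being stored by the
leader (`Amoebot.realizes_regSim`).

Richer machines are reduced to these. Multiplication and division by constants are carried out by
loops with a scratch register (`Amoebot.expandLoops_run`). With these two commands, the contents of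
any number of registers can be kept as a Gödel number in the first register
(`Amoebot.goedelize_run`), the second one serving as the scratch register; it is zero between the
commands, hence does not prevent moves. So every counter machine is realized
(`Amoebot.exists_realizes_goedelNum`), even one with arithmetical commands
(`Amoebot.exists_realizes_avoids`). A mobile random-access machine becomes such a machine, which after
each instruction tests the flags and makes the moves (`Amoebot.flagCmd_step`); a Turing machine
becomes one by coding the two halves of its tape as numbers to a base that is at least the number of
symbols, and keeping the scanned symbol in the control state (`Amoebot.tmCmd_step`). Finally, an
invariant that is preserved by the simulation of every single step yields the times at which the
particles represent the successive configurations (`Amoebot.Controller.exists_simulatedBy`).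
-/


namespace Amoebot

/-! ### Counter machines -/

/-- Commands of a counter machine with registers `R` and control states `Q`. Besides increments,
decrements with a test for zero, and operations (a move of the whole system, or nothing), there are
the arithmetical commands `r := b * r + a` and `r := r / b` with a branch on the remainder. -/
inductive Cmd (R Q : Type)
  | inc (r : R) (q : Q)
  | dec (r : R) (q₀ q₁ : Q)
  | op (k : Option (ZMod 6)) (q : Q)
  | mulAdd (r : R) (b a : ℕ) (q : Q)
  | divMod (r : R) (b : ℕ) (f : ℕ → Q)
  | halt

/-- Configurations of a counter machine: control state, register contents, and the position to
which the system has moved. -/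
structure St (R Q : Type) where
  q : Q
  regs : R → ℕ
  pos : Grid

namespace Cmd

variable {R Q : Type}

/-- The command is a move of the system. -/
def IsMove : Cmd R Q → Prop
  | op (some _) _ => True
  | _ => False

/-- The command is not one of the arithmetical ones. -/
def Basic : Cmd R Q → Prop
  | mulAdd _ _ _ _ => False
  | divMod _ _ _ => False
  | _ => True

/-- The command does not touch the register `z`, and its constants are bounded by `N`. -/
def Avoids (z : R) (N : ℕ) : Cmd R Q → Prop
  | inc r _ => r ≠ z
  | dec r _ _ => r ≠ z
  | mulAdd r b a _ => r ≠ z ∧ 0 < b ∧ b ≤ N ∧ a ≤ N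
  | divMod r b _ => r ≠ z ∧ 0 < b ∧ b ≤ N
  | _ => True

/-- Execution of a command; `v k` is the displacement by the move in the direction number `k`. -/
def exec [DecidableEq R] (v : ZMod 6 → Grid) (g : R → ℕ) (o : Grid) :
    Cmd R Q → Option (St R Q)
  | inc r q => some ⟨q, Function.update g r (g r + 1), o⟩
  | dec r q₀ q₁ => some (if g r = 0 then ⟨q₀, g, o⟩ else ⟨q₁, Function.update g r (g r - 1), o⟩)
  | op k q => some ⟨q, g, o + k.elim 0 v⟩
  | mulAdd r b a q => some ⟨q, Function.update g r (g r * b + a), o⟩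
  | divMod r b f => some ⟨f (g r % b), Function.update g r (g r / b), o⟩
  | halt => none

end Cmd

section Run

variable {R Q : Type} [DecidableEq R]

/-- `Run M v W K a b`: the machine `M` makes a step from `a` to `b`, the control state during this
step and the positions before and after it are related by `W`, and if the step is a move, the
registers satisfy `K`. -/
def Run (M : Q → Cmd R Q) (v : ZMod 6 → Grid) (W : Q → Grid → Prop) (K : (R → ℕ) → Prop)
    (a b : St R Q) : Prop :=
  (M a.q).exec v a.regs a.pos = some b ∧ W a.q a.pos ∧ W a.q b.pos ∧
    ((M a.q).IsMove → K a.regs)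

variable {M : Q → Cmd R Q} {v : ZMod 6 → Grid} {W : Q → Grid → Prop} {K : (R → ℕ) → Prop}

theorem Run.of_inc {q q' : Q} {r : R} {g : R → ℕ} {o : Grid} (h : M q = .inc r q')
    (hW : W q o) : Run M v W K ⟨q, g, o⟩ ⟨q', Function.update g r (g r + 1), o⟩ := by
  simp [Run, h, Cmd.exec, hW, Cmd.IsMove]

theorem Run.of_dec_zero {q q₀ q₁ : Q} {r : R} {g : R → ℕ} {o : Grid} (h : M q = .dec r q₀ q₁)
    (hg : g r = 0) (hW : W q o) : Run M v W K ⟨q, g, o⟩ ⟨q₀, g, o⟩ := by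
  simp [Run, h, Cmd.exec, hW, hg, Cmd.IsMove]

theorem Run.of_dec_pos {q q₀ q₁ : Q} {r : R} {g : R → ℕ} {o : Grid} (h : M q = .dec r q₀ q₁)
    (hg : g r ≠ 0) (hW : W q o) :
    Run M v W K ⟨q, g, o⟩ ⟨q₁, Function.update g r (g r - 1), o⟩ := by
  simp [Run, h, Cmd.exec, hW, hg, Cmd.IsMove]

theorem Run.of_skip {q q' : Q} {g : R → ℕ} {o : Grid} (h : M q = .op none q')
    (hW : W q o) : Run M v W K ⟨q, g, o⟩ ⟨q', g, o⟩ := by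
  simp [Run, h, Cmd.exec, hW, Cmd.IsMove]

theorem Run.of_op {q q' : Q} {k : Option (ZMod 6)} {g : R → ℕ} {o : Grid} (h : M q = .op k q')
    (hW : W q o) (hW' : W q (o + k.elim 0 v)) (hK : k ≠ none → K g) :
    Run M v W K ⟨q, g, o⟩ ⟨q', g, o + k.elim 0 v⟩ := by
  cases k <;> simp_all [Run, Cmd.exec, Cmd.IsMove]

theorem Run.of_mulAdd {q q' : Q} {r : R} {a b x : ℕ} {g : R → ℕ} {o : Grid}
    (h : M q = .mulAdd r b a q') (hx : g r = x) (hW : W q o) :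
    Run M v W K ⟨q, g, o⟩ ⟨q', Function.update g r (x * b + a), o⟩ := by
  simp [Run, h, hx, Cmd.exec, hW, Cmd.IsMove]

theorem Run.of_divMod {q : Q} {r : R} {b x : ℕ} {f : ℕ → Q} {g : R → ℕ} {o : Grid}
    (h : M q = .divMod r b f) (hx : g r = x) (hW : W q o) :
    Run M v W K ⟨q, g, o⟩ ⟨f (x % b), Function.update g r (x / b), o⟩ := by
  simp [Run, h, hx, Cmd.exec, hW, Cmd.IsMove]

end Run

/-! ### Arithmetical commands as loops -/

/-- The phases of the loops that implement an arithmetical command: `home` and `carry` move the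
contents of the register, multiplied or divided, to the scratch register, `back` and `restore`
move it back, and `add` adds a constant. -/
inductive LoopPhase
  | home
  | carry
  | back
  | restore
  | add

instance : Finite LoopPhase :=
  Finite.of_surjective (fun i : Fin 5 => ![.home, .carry, .back, .restore, .add] i) (by
    intro x
    cases x
    exacts [⟨0, rfl⟩, ⟨1, rfl⟩, ⟨2, rfl⟩, ⟨3, rfl⟩, ⟨4, rfl⟩])

section Loops

variable {R Q : Type}

/-- The machine that implements the arithmetical commands of `M` by loops with the scratch
register `z`. Its control states are those of `M` with a phase and a counter up to `N`. -/
def expandLoops (M : Q → Cmd R Q) (z : R) (N : ℕ) :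
    Q × LoopPhase × Fin (N + 1) → Cmd R (Q × LoopPhase × Fin (N + 1))
  | (q, ph, i) =>
    match M q with
    | .inc r q' => .inc r (q', .home, 0)
    | .dec r q₀ q₁ => .dec r (q₀, .home, 0) (q₁, .home, 0)
    | .op k q' => .op k (q', .home, 0)
    | .halt => .halt
    | .mulAdd r b a q' =>
      match ph with
      | .home => .dec r (q, .back, 0) (q, .carry, 0)
      | .carry => .inc z (if i + 1 < b then (q, .carry, Fin.ofNat (N + 1) (i + 1))
          else (q, .home, 0))
      | .back => .dec z (q, .add, 0) (q, .restore, 0)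
      | .restore => .inc r (q, .back, 0)
      | .add => if i < a then .inc r (q, .add, Fin.ofNat (N + 1) (i + 1))
          else .op none (q', .home, 0)
    | .divMod r b f =>
      match ph with
      | .home => .dec r (q, .back, i) (if i + 1 < b then (q, .home, Fin.ofNat (N + 1) (i + 1))
          else (q, .carry, 0))
      | .carry => .inc z (q, .home, 0)
      | .back => .dec z (f i, .home, 0) (q, .restore, i)
      | .restore => .inc r (q, .back, i)
      | .add => .halt

theorem expandLoops_basic (M : Q → Cmd R Q) (z : R) (N : ℕ) (x) :
    (expandLoops M z N x).Basic := by
  obtain ⟨q, ph, i⟩ := x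
  unfold expandLoops
  cases hq : M q <;> cases ph <;> simp only [hq] <;> (try split_ifs) <;> trivial

theorem isMove_of_expandLoops {M : Q → Cmd R Q} {z : R} {N : ℕ} {x}
    (h : (expandLoops M z N x).IsMove) : (M x.1).IsMove := by
  obtain ⟨q, ph, i⟩ := x
  unfold expandLoops at h
  cases hq : M q with
  | op k q' => cases k <;> simp_all [Cmd.IsMove]
  | _ => cases ph <;> simp only [hq] at h <;> (try split_ifs at h) <;> exact h.elim

theorem val_ofNat_succ {N i : ℕ} (h : i + 1 ≤ N) :
    (Fin.ofNat (N + 1) (i + 1) : ℕ) = i + 1 := by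
  simp [Fin.ofNat]; omega

variable [DecidableEq R] {M : Q → Cmd R Q} {z : R} {N : ℕ} {v : ZMod 6 → Grid}
  {W : Q → Grid → Prop} {K : (R → ℕ) → Prop}

/-- The register contents `g`, with `x` in `r` and `y` in `z`. -/
def setTwo (g : R → ℕ) (r z : R) (x y : ℕ) : R → ℕ :=
  Function.update (Function.update g r x) z y

section setTwo

variable {g : R → ℕ} {r : R} {x y : ℕ}

theorem setTwo_left (h : r ≠ z) : setTwo g r z x y r = x := by simp [setTwo, h]

theorem setTwo_right : setTwo g r z x y z = y := by simp [setTwo]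

theorem update_setTwo_left (h : r ≠ z) (x' : ℕ) :
    Function.update (setTwo g r z x y) r x' = setTwo g r z x' y := by
  unfold setTwo
  rw [Function.update_comm h.symm, Function.update_idem]

theorem update_setTwo_right (y' : ℕ) :
    Function.update (setTwo g r z x y) z y' = setTwo g r z x y' := by
  simp [setTwo]

theorem setTwo_eq_update (h : r ≠ z) (hz : g z = 0) :
    setTwo g r z x 0 = Function.update g r x := by
  unfold setTwo
  rw [Function.update_eq_self_iff]
  simp [h.symm, hz]

theorem setTwo_self (hz : g z = 0) : setTwo g r z (g r) 0 = g := by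
  unfold setTwo
  rw [Function.update_eq_self, ← hz, Function.update_eq_self]

end setTwo

variable (M z N v W K) in
/-- One or more steps of `expandLoops M z N`, with the predicates `W` and `K` of `M`. -/
abbrev LoopRuns : St R (Q × LoopPhase × Fin (N + 1)) → St R (Q × LoopPhase × Fin (N + 1)) → Prop :=
  Relation.TransGen (Run (expandLoops M z N) v (fun x => W x.1) K)

variable {q q' : Q} {r : R} {g : R → ℕ} {o : Grid} {a b : ℕ} {f : ℕ → Q}

/-- The register `r` is counted down to zero. The counter `i` keeps the count modulo `b`, and the
scratch register is incremented whenever the counter wraps around, so that the remainder ends up in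
the control state and the quotient in the scratch register. -/
theorem runs_divMod_scan (hM : M q = .divMod r b f) (hr : r ≠ z) (hb : 0 < b) (hN : b ≤ N)
    (hW : W q o) : ∀ (x y : ℕ) (i : Fin (N + 1)), (i : ℕ) < b → ∃ j : Fin (N + 1),
      (j : ℕ) = (x + i) % b ∧ LoopRuns M z N v W K ⟨(q, .home, i), setTwo g r z x y, o⟩
        ⟨(q, .back, j), setTwo g r z 0 (y + (x + i) / b), o⟩ := by
  intro x
  induction x with
  | zero =>
    intro y i hi
    refine ⟨i, by simp [Nat.mod_eq_of_lt hi], ?_⟩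
    simp only [zero_add, Nat.div_eq_of_lt hi, add_zero]
    exact .single (Run.of_dec_zero (by simp [expandLoops, hM]; rfl) (setTwo_left hr) hW)
  | succ x ih =>
    intro y i hi
    have h0 : (expandLoops M z N (q, .home, i)) = .dec r (q, .back, i)
        (if i + 1 < b then (q, .home, Fin.ofNat (N + 1) (i + 1)) else (q, .carry, 0)) := by
      simp [expandLoops, hM]
    have h1 := Run.of_dec_pos (v := v) (W := fun x => W x.1) (K := K) (o := o) h0
      (g := setTwo g r z (x + 1) y) (by simp [setTwo_left hr]) hW
    simp only [setTwo_left hr, update_setTwo_left hr, Nat.add_sub_cancel] at h1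
    by_cases hi' : (i : ℕ) + 1 < b
    · rw [if_pos hi'] at h1
      have hv : ((Fin.ofNat (N + 1) (i + 1) : Fin (N + 1)) : ℕ) = i + 1 :=
        val_ofNat_succ (by omega)
      obtain ⟨j, hj, h2⟩ := ih y (Fin.ofNat (N + 1) (i + 1)) (by omega)
      rw [hv] at hj h2
      refine ⟨j, by rw [hj]; congr 1; omega, ?_⟩
      rw [show x + 1 + (i : ℕ) = x + (i + 1) by omega]
      exact .head h1 h2
    · rw [if_neg hi'] at h1
      have h2 := Run.of_inc (v := v) (W := fun x => W x.1) (K := K) (o := o) (r := z)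
        (M := expandLoops M z N) (q := (q, .carry, 0)) (q' := (q, .home, 0))
        (g := setTwo g r z x y) (by simp [expandLoops, hM]) hW
      simp only [setTwo_right, update_setTwo_right] at h2
      obtain ⟨j, hj, h3⟩ := ih (y + 1) 0 (by simpa using hb)
      have hxb : x + 1 + (i : ℕ) = x + b := by omega
      refine ⟨j, by rw [hj, hxb]; simp, ?_⟩
      have : y + (x + 1 + (i : ℕ)) / b = y + 1 + (x + ((0 : Fin (N + 1)) : ℕ)) / b := by
        rw [hxb, Nat.add_div_right _ hb]; simp; omega
      rw [this]
      exact .head h1 (.head h2 h3)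

/-- The quotient is moved back from the scratch register; the remainder `i` selects the next state. -/
theorem runs_divMod_back (hM : M q = .divMod r b f) (hr : r ≠ z) (hW : W q o)
    (i : Fin (N + 1)) : ∀ y x : ℕ, LoopRuns M z N v W K ⟨(q, .back, i), setTwo g r z x y, o⟩
        ⟨(f i, .home, 0), setTwo g r z (x + y) 0, o⟩ := by
  intro y
  induction y with
  | zero =>
    intro x
    exact .single (Run.of_dec_zero (by simp [expandLoops, hM]; rfl) setTwo_right hW)
  | succ y ih =>
    intro x
    have h1 := Run.of_dec_pos (v := v) (W := fun x => W x.1) (K := K) (o := o) (r := z)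
      (M := expandLoops M z N) (q := (q, .back, i)) (q₀ := (f i, .home, 0))
      (q₁ := (q, .restore, i)) (g := setTwo g r z x (y + 1)) (by simp [expandLoops, hM])
      (by simp [setTwo_right]) hW
    have h2 := Run.of_inc (v := v) (W := fun x => W x.1) (K := K) (o := o) (r := r)
        (M := expandLoops M z N) (q := (q, .restore, i)) (q' := (q, .back, i))
        (g := setTwo g r z x y) (by simp [expandLoops, hM]) hW
    simp only [setTwo_right, update_setTwo_right, Nat.add_sub_cancel] at h1
    simp only [setTwo_left hr, update_setTwo_left hr] at h2
    rw [show x + (y + 1) = x + 1 + y by omega]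
    exact .head h1 (.head h2 (ih _))

/-- The scratch register is incremented until the counter, now at `i`, has reached `b`. -/
theorem runs_mulAdd_carry (hM : M q = .mulAdd r b a q') (hN : b ≤ N) (hW : W q o)
    (x : ℕ) : ∀ (k y : ℕ) (i : Fin (N + 1)), (i : ℕ) + (k + 1) = b →
      LoopRuns M z N v W K ⟨(q, .carry, i), setTwo g r z x y, o⟩ ⟨(q, .home, 0), setTwo g r z x (y + (k + 1)), o⟩ := by
  intro k
  induction k with
  | zero =>
    intro y i hi
    have h2 := Run.of_inc (v := v) (W := fun x => W x.1) (K := K) (o := o) (r := z)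
        (M := expandLoops M z N) (q := (q, .carry, i)) (q' := (q, .home, 0))
        (g := setTwo g r z x y) (by
          have : ¬ ((i : ℕ) + 1 < b) := by omega
          simp [expandLoops, hM, this]) hW
    simp only [setTwo_right, update_setTwo_right] at h2
    exact .single h2
  | succ k ih =>
    intro y i hi
    have h2 := Run.of_inc (v := v) (W := fun x => W x.1) (K := K) (o := o) (r := z)
        (M := expandLoops M z N) (q := (q, .carry, i))
        (q' := (q, .carry, Fin.ofNat (N + 1) (i + 1)))
        (g := setTwo g r z x y) (by
          have : (i : ℕ) + 1 < b := by omega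
          simp [expandLoops, hM, this]) hW
    simp only [setTwo_right, update_setTwo_right] at h2
    have h3 := ih (y + 1) (Fin.ofNat (N + 1) (i + 1)) (by rw [val_ofNat_succ (by omega)]; omega)
    rw [show y + (k + 1 + 1) = y + 1 + (k + 1) by omega]
    exact .head h2 h3

/-- For each unit that is removed from `r`, the scratch register grows by `b`. -/
theorem runs_mulAdd_home (hM : M q = .mulAdd r b a q') (hr : r ≠ z) (hb : 0 < b) (hN : b ≤ N)
    (hW : W q o) : ∀ x y : ℕ, LoopRuns M z N v W K ⟨(q, .home, 0), setTwo g r z x y, o⟩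
      ⟨(q, .back, 0), setTwo g r z 0 (y + x * b), o⟩ := by
  intro x
  induction x with
  | zero =>
    intro y
    simp only [zero_mul, add_zero]
    exact .single (Run.of_dec_zero (by simp [expandLoops, hM]; rfl) (setTwo_left hr) hW)
  | succ x ih =>
    intro y
    have h1 := Run.of_dec_pos (v := v) (W := fun x => W x.1) (K := K) (o := o) (r := r)
      (M := expandLoops M z N) (q := (q, .home, 0)) (q₀ := (q, .back, 0))
      (q₁ := (q, .carry, 0)) (g := setTwo g r z (x + 1) y) (by simp [expandLoops, hM])
      (by simp [setTwo_left hr]) hW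
    simp only [setTwo_left hr, update_setTwo_left hr, Nat.add_sub_cancel] at h1
    obtain ⟨k, rfl⟩ : ∃ k, b = k + 1 := ⟨b - 1, by omega⟩
    have h2 := runs_mulAdd_carry (v := v) (K := K) (g := g) (z := z) hM hN hW x k y 0 (by simp)
    rw [show y + (x + 1) * (k + 1) = y + (k + 1) + x * (k + 1) by ring]
    exact .head h1 (h2.trans (ih _))

/-- The constant `a` is added, the counter telling how much of it has been added already. -/
theorem runs_mulAdd_add (hM : M q = .mulAdd r b a q') (hr : r ≠ z) (hN : a ≤ N) (hW : W q o) :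
    ∀ (k x : ℕ) (i : Fin (N + 1)), (i : ℕ) + k = a →
      LoopRuns M z N v W K ⟨(q, .add, i), setTwo g r z x 0, o⟩ ⟨(q', .home, 0), setTwo g r z (x + k) 0, o⟩ := by
  intro k
  induction k with
  | zero =>
    intro x i hi
    exact .single (Run.of_skip (by
      have : ¬ ((i : ℕ) < a) := by omega
      simp [expandLoops, hM, this]) hW)
  | succ k ih =>
    intro x i hi
    have h2 := Run.of_inc (v := v) (W := fun x => W x.1) (K := K) (o := o) (r := r)
        (M := expandLoops M z N) (q := (q, .add, i))
        (q' := (q, .add, Fin.ofNat (N + 1) (i + 1)))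
        (g := setTwo g r z x 0) (by
          have : (i : ℕ) < a := by omega
          simp [expandLoops, hM, this]) hW
    simp only [setTwo_left hr, update_setTwo_left hr] at h2
    have h3 := ih (x + 1) (Fin.ofNat (N + 1) (i + 1)) (by rw [val_ofNat_succ (by omega)]; omega)
    rw [show x + (k + 1) = x + 1 + k by omega]
    exact .head h2 h3

/-- The product is moved back from the scratch register. -/
theorem runs_mulAdd_back (hM : M q = .mulAdd r b a q') (hr : r ≠ z) (hW : W q o) :
    ∀ y x : ℕ, LoopRuns M z N v W K ⟨(q, .back, 0), setTwo g r z x y, o⟩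
        ⟨(q, .add, 0), setTwo g r z (x + y) 0, o⟩ := by
  intro y
  induction y with
  | zero =>
    intro x
    exact .single (Run.of_dec_zero (by simp [expandLoops, hM]; rfl) setTwo_right hW)
  | succ y ih =>
    intro x
    have h1 := Run.of_dec_pos (v := v) (W := fun x => W x.1) (K := K) (o := o) (r := z)
      (M := expandLoops M z N) (q := (q, .back, 0)) (q₀ := (q, .add, 0))
      (q₁ := (q, .restore, 0)) (g := setTwo g r z x (y + 1)) (by simp [expandLoops, hM])
      (by simp [setTwo_right]) hW
    have h2 := Run.of_inc (v := v) (W := fun x => W x.1) (K := K) (o := o) (r := r)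
        (M := expandLoops M z N) (q := (q, .restore, 0)) (q' := (q, .back, 0))
        (g := setTwo g r z x y) (by simp [expandLoops, hM]) hW
    simp only [setTwo_right, update_setTwo_right, Nat.add_sub_cancel] at h1
    simp only [setTwo_left hr, update_setTwo_left hr] at h2
    rw [show x + (y + 1) = x + 1 + y by omega]
    exact .head h1 (.head h2 (ih _))

/-- A step of `M` with empty scratch register is simulated by the loops, and leaves the scratch
register empty. -/
theorem expandLoops_run (hM : ∀ q, (M q).Avoids z N) {s s' : St R Q} (hz : s.regs z = 0)
    (h : Run M v W K s s') :
    LoopRuns M z N v W K ⟨(s.q, .home, 0), s.regs, s.pos⟩ ⟨(s'.q, .home, 0), s'.regs, s'.pos⟩ ∧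
      s'.regs z = 0 := by
  obtain ⟨q, g, o⟩ := s
  obtain ⟨hs, hW, hW', hK⟩ := h
  dsimp only at *
  have hA := hM q
  cases hq : M q with
  | inc r q' =>
    simp only [hq, Cmd.exec, Option.some.injEq] at hs
    simp only [hq, Cmd.Avoids] at hA
    subst hs
    exact ⟨.single (Run.of_inc (by simp [expandLoops, hq]) hW), by simp [hA.symm, hz]⟩
  | dec r q₀ q₁ =>
    simp only [hq, Cmd.exec, Option.some.injEq] at hs
    simp only [hq, Cmd.Avoids] at hA
    by_cases h0 : g r = 0
    · rw [if_pos h0] at hs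
      subst hs
      exact ⟨.single (Run.of_dec_zero (by simp [expandLoops, hq]; rfl) h0 hW), hz⟩
    · rw [if_neg h0] at hs
      subst hs
      exact ⟨.single (Run.of_dec_pos (q₀ := (q₀, .home, 0)) (by simp [expandLoops, hq]) h0 hW),
        by simp [hA.symm, hz]⟩
  | op k q' =>
    simp only [hq, Cmd.exec, Option.some.injEq] at hs
    subst hs
    exact ⟨.single (Run.of_op (by simp [expandLoops, hq]) hW hW' fun hk =>
      hK (by rw [hq]; cases k <;> simp_all [Cmd.IsMove])), hz⟩
  | halt => simp [hq, Cmd.exec] at hs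
  | mulAdd r b a q' =>
    simp only [hq, Cmd.exec, Option.some.injEq] at hs
    simp only [hq, Cmd.Avoids] at hA
    obtain ⟨hr, hb, hbN, haN⟩ := hA
    subst hs
    refine ⟨?_, by simp [hr.symm, hz]⟩
    have h1 := runs_mulAdd_home (v := v) (K := K) (g := g) hq hr hb hbN hW (g r) 0
    have h2 := runs_mulAdd_back (N := N) (v := v) (K := K) (g := g) hq hr hW (0 + g r * b) 0
    have h3 := runs_mulAdd_add (v := v) (K := K) (g := g) hq hr haN hW a
      (0 + (0 + g r * b)) 0 (by simp)
    rw [setTwo_self hz] at h1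
    rw [zero_add, zero_add, setTwo_eq_update hr hz, setTwo_eq_update hr hz] at h3
    rw [zero_add] at h1 h2
    rw [zero_add, setTwo_eq_update hr hz] at h2
    exact h1.trans (h2.trans h3)
  | divMod r b f =>
    simp only [hq, Cmd.exec, Option.some.injEq] at hs
    simp only [hq, Cmd.Avoids] at hA
    obtain ⟨hr, hb, hbN⟩ := hA
    subst hs
    refine ⟨?_, by simp [hr.symm, hz]⟩
    obtain ⟨j, hj, h1⟩ := runs_divMod_scan (v := v) (K := K) (g := g) hq hr hb hbN hW (g r) 0 0
      (by simpa using hb)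
    have h2 := runs_divMod_back (N := N) (v := v) (K := K) (g := g) hq hr hW j (g r / b) 0
    rw [setTwo_self hz] at h1
    rw [zero_add, setTwo_eq_update hr hz, hj] at h2
    simp only [zero_add, Fin.val_zero, add_zero] at h1 h2
    exact h1.trans h2

end Loops

/-! ### Gödel numbering of the registers -/

section Goedel

variable {R Q : Type}

/-- The Gödel number of the register contents `g`, with the base `pr r` for the register `r`. -/
def goedelNum [Fintype R] (pr : R → ℕ) (g : R → ℕ) : ℕ := ∏ r, pr r ^ g r

/-- The machine that keeps the Gödel number of the registers of `M` in its register `0`. The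
states `(q, some i)` restore the number after an unsuccessful division with the remainder `i`. -/
def goedelize (M : Q → Cmd R Q) (pr : R → ℕ) (N : ℕ) :
    Q × Option (Fin (N + 1)) → Cmd (Fin 2) (Q × Option (Fin (N + 1)))
  | (q, none) =>
    match M q with
    | .inc r q' => .mulAdd 0 (pr r) 0 (q', none)
    | .dec r _ q₁ => .divMod 0 (pr r) fun i =>
        if i = 0 then (q₁, none) else (q, some (Fin.ofNat (N + 1) i))
    | .op k q' => .op k (q', none)
    | _ => .halt
  | (q, some i) =>
    match M q with
    | .dec r q₀ _ => .mulAdd 0 (pr r) i (q₀, none)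
    | _ => .halt

variable {M : Q → Cmd R Q} {pr : R → ℕ} {N : ℕ}

theorem goedelize_avoids (hpos : ∀ r, 0 < pr r) (hN : ∀ r, pr r ≤ N) (x) :
    (goedelize M pr N x).Avoids 1 N := by
  rcases x with ⟨q, _ | i⟩ <;> unfold goedelize <;> cases hq : M q <;>
    simp only [hq, Cmd.Avoids]
  · exact ⟨by decide, hpos _, hN _, Nat.zero_le _⟩
  · exact ⟨by decide, hpos _, hN _⟩
  · exact ⟨by decide, hpos _, hN _, Nat.le_of_lt_succ i.2⟩

theorem isMove_of_goedelize {x} (h : (goedelize M pr N x).IsMove) : (M x.1).IsMove := by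
  rcases x with ⟨q, _ | i⟩ <;> unfold goedelize at h <;> cases hq : M q <;>
    simp only [hq] at h <;> first | exact h.elim | skip
  rename_i k _
  cases k <;> simp_all [Cmd.IsMove]

variable [Fintype R] [DecidableEq R]

theorem goedelNum_update_succ (g : R → ℕ) (r : R) :
    goedelNum pr (Function.update g r (g r + 1)) = goedelNum pr g * pr r := by
  unfold goedelNum
  rw [← Finset.mul_prod_erase _ _ (Finset.mem_univ r),
    ← Finset.mul_prod_erase _ (fun r => pr r ^ g r) (Finset.mem_univ r)]
  have : ∏ x ∈ Finset.univ.erase r, pr x ^ Function.update g r (g r + 1) x =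
      ∏ x ∈ Finset.univ.erase r, pr x ^ g x :=
    Finset.prod_congr rfl fun x hx => by simp [Finset.ne_of_mem_erase hx]
  rw [this]
  simp [pow_succ]
  ring

theorem goedelNum_eq_mul {g : R → ℕ} {r : R} (h : g r ≠ 0) :
    goedelNum pr g = goedelNum pr (Function.update g r (g r - 1)) * pr r := by
  rw [← goedelNum_update_succ]
  simp [Nat.sub_add_cancel (Nat.pos_of_ne_zero h)]

omit [DecidableEq R] in
/-- As the bases are distinct primes, a register is zero exactly if its base does not divide the Gödel
number; this is how `goedelize` tests registers for zero. -/
theorem not_dvd_goedelNum (hp : ∀ r, (pr r).Prime) (hinj : Function.Injective pr) {g : R → ℕ}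
    {r : R} (h : g r = 0) : ¬ pr r ∣ goedelNum pr g := by
  unfold goedelNum
  rw [(hp r).prime.dvd_finsetProd_iff]
  rintro ⟨x, -, hx⟩
  have h1 := (Nat.prime_dvd_prime_iff_eq (hp r) (hp x)).1 ((hp r).dvd_of_dvd_pow hx)
  obtain rfl := hinj h1
  rw [h, pow_zero, Nat.dvd_one] at hx
  exact (hp r).one_lt.ne' hx

/-- The configuration of `goedelize` that represents a configuration of `M`. -/
def goedelSt (pr : R → ℕ) (N : ℕ) (s : St R Q) : St (Fin 2) (Q × Option (Fin (N + 1))) :=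
  ⟨(s.q, none), ![goedelNum pr s.regs, 0], s.pos⟩

/-- A step of `M` is simulated on the Gödel number: an increment is a multiplication by the prime of the
register, a decrement is a division by it, to be undone if there is a remainder. The register `1` is
zero throughout, so that moves are possible whenever they are for `M`. -/
theorem goedelize_run (hp : ∀ r, (pr r).Prime) (hinj : Function.Injective pr)
    (hN : ∀ r, pr r ≤ N) {v : ZMod 6 → Grid} {W : Q → Grid → Prop}
    {K : (R → ℕ) → Prop} {mv : Prop} (hK : ∀ g, K g → mv) (hM : ∀ q, (M q).Basic)
    {s s' : St R Q} (h : Run M v W K s s') :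
    Relation.TransGen (Run (goedelize M pr N) v (fun x => W x.1) fun g => mv ∧ g 1 = 0)
      (goedelSt pr N s) (goedelSt pr N s') := by
  obtain ⟨q, g, o⟩ := s
  obtain ⟨hs, hW, hW', hK'⟩ := h
  dsimp only [goedelSt] at *
  have hA := hM q
  have hset : ∀ x y : ℕ, Function.update ![x, 0] (0 : Fin 2) y = ![y, 0] := by
    intro x y; ext i; fin_cases i <;> simp
  cases hq : M q with
  | inc r q' =>
    simp only [hq, Cmd.exec, Option.some.injEq] at hs
    subst hs
    have := Run.of_mulAdd (M := goedelize M pr N) (v := v) (W := fun x => W x.1)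
      (K := fun g => mv ∧ g 1 = 0) (q := (q, none)) (q' := (q', none)) (r := 0) (a := 0) (o := o)
      (g := ![goedelNum pr g, 0]) (b := pr r) (x := goedelNum pr g)
      (by simp [goedelize, hq]) (by simp) hW
    rw [hset] at this
    rw [goedelNum_update_succ]
    exact .single this
  | dec r q₀ q₁ =>
    simp only [hq, Cmd.exec, Option.some.injEq] at hs
    have h1 := Run.of_divMod (M := goedelize M pr N) (v := v) (W := fun x => W x.1)
      (K := fun g => mv ∧ g 1 = 0) (q := (q, none)) (r := 0) (o := o)
      (g := ![goedelNum pr g, 0]) (b := pr r) (f := fun i =>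
        if i = 0 then (q₁, none) else (q, some (Fin.ofNat (N + 1) i))) (x := goedelNum pr g)
      (by simp [goedelize, hq]) (by simp) hW
    rw [hset] at h1
    by_cases h0 : g r = 0
    · rw [if_pos h0] at hs
      subst hs
      have hd := not_dvd_goedelNum hp hinj h0
      rw [if_neg (fun h => hd (Nat.dvd_of_mod_eq_zero h))] at h1
      have hlt : goedelNum pr g % pr r < N + 1 :=
        (Nat.mod_lt _ (hp r).pos).trans (Nat.lt_succ_of_le (hN r))
      have h2 := Run.of_mulAdd (M := goedelize M pr N) (v := v) (W := fun x => W x.1)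
        (K := fun g => mv ∧ g 1 = 0) (r := 0)
        (q := (q, some (Fin.ofNat (N + 1) (goedelNum pr g % pr r)))) (q' := (q₀, none)) (o := o)
        (g := ![goedelNum pr g / pr r, 0]) (b := pr r) (a := goedelNum pr g % pr r)
        (x := goedelNum pr g / pr r)
        (by simp [goedelize, hq, Nat.mod_eq_of_lt hlt]) (by simp) hW
      rw [hset, Nat.div_add_mod'] at h2
      exact .head h1 (.single h2)
    · rw [if_neg h0] at hs
      subst hs
      have he := goedelNum_eq_mul (pr := pr) h0
      rw [if_pos (by rw [he]; simp)] at h1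
      rw [he, Nat.mul_div_cancel _ (hp r).pos, ← he] at h1
      exact .single h1
  | op k q' =>
    simp only [hq, Cmd.exec, Option.some.injEq] at hs
    subst hs
    refine .single (Run.of_op (by simp [goedelize, hq]) hW hW' ?_)
    intro hk
    exact ⟨hK _ (hK' (by rw [hq]; cases k <;> simp_all [Cmd.IsMove])), by simp⟩
  | halt => simp [hq, Cmd.exec] at hs
  | mulAdd r b a q' => simp [hq, Cmd.Basic] at hA
  | divMod r b f => simp [hq, Cmd.Basic] at hA

end Goedel

end Amoebot

namespace Amoebot

/-! ### Directions and ports -/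

theorem unitVec_ne_zero : ∀ k : ZMod 6, unitVec k ≠ 0 := by decide

theorem unitVec_injective : Function.Injective unitVec := by
  have : ∀ a b : ZMod 6, unitVec a = unitVec b → a = b := by decide
  exact fun a b => this a b

theorem unitVec_add_three : ∀ k : ZMod 6, unitVec (k + 3) = -unitVec k := by decide

namespace Handedness

variable (h : Handedness)

theorem sign_mul_sign : h.sign * h.sign = 1 := by
  unfold sign; split_ifs <;> decide

theorem sign_mul_three : h.sign * 3 = 3 := by
  unfold sign; split_ifs <;> decide

theorem dir_port (d : ZMod 6) : h.dir (h.port d) = d := by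
  unfold dir port
  rw [← mul_assoc, sign_mul_sign, one_mul, add_sub_cancel]

theorem port_dir (p : ZMod 6) : h.port (h.dir p) = p := by
  unfold dir port
  rw [add_sub_cancel_left, ← mul_assoc, sign_mul_sign, one_mul]

theorem dir_add (p j : ZMod 6) : h.dir (p + j) = h.dir p + h.sign * j := by
  unfold dir
  ring

theorem dir_add_three (p : ZMod 6) : h.dir (p + 3) = h.dir p + 3 := by
  rw [dir_add, sign_mul_three]

end Handedness

/-! ### Configurations with a single effective particle -/

section Next

variable {A : Algorithm} {ι : Type}

/-- Whatever particles are active in the configuration `X`, it either remains as it is or becomes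
`X'`; the latter happens as soon as a certain particle is active. -/
def Next (hand : ι → Handedness) (X X' : Config A ι) : Prop :=
  ∃ i, ∀ active D, Stage hand active X D → (i ∈ active → D = X') ∧ (i ∉ active → D = X)

/-- Whatever particles are active in the configuration `X`, it remains as it is. -/
def Stuck (hand : ι → Handedness) (X : Config A ι) : Prop :=
  ∀ active D, Stage hand active X D → D = X

/-- Activation of the particle `j` in `X` has no effect. -/
def Passive (hand : ι → Handedness) (X : Config A ι) (j : ι) : Prop :=
  decision hand X j = ⟨(X j).state, fun _ => none, .stay⟩ ∧ (X j).inbox = fun _ => none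

theorem Particle.ext' {x y : Particle A} (h1 : x.head = y.head) (h2 : x.tail = y.tail)
    (h3 : x.state = y.state) (h4 : ∀ p m, x.inbox p = some m ↔ y.inbox p = some m) : x = y := by
  obtain ⟨a, b, c, e⟩ := x
  obtain ⟨a', b', c', e'⟩ := y
  dsimp only at *
  subst h1 h2 h3
  congr
  exact funext fun p => Option.ext (h4 p)

/-- The effect of the activation of `i` in a configuration in which all other particles are
passive. -/
structure Effect (hand : ι → Handedness) (X : Config A ι) (i : ι) (X' : Config A ι) : Prop where
  state : (X' i).state = (decision hand X i).state
  inbox : (X' i).inbox = fun _ => none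
  stay : (decision hand X i).move = .stay → (X' i).head = (X i).head ∧ (X' i).tail = (X i).tail
  contract : (decision hand X i).move = .contract →
    (X' i).head = (X i).head ∧ (X' i).tail = (X i).head
  expand : ∀ p, (decision hand X i).move = .expand p →
    (X i).head = (X i).tail ∧ (X' i).head = (X i).head + unitVec ((hand i).dir p) ∧
      ¬ Occupied X (X' i).head ∧ (X' i).tail = (X i).tail
  other : ∀ j ≠ i, (X' j).head = (X j).head ∧ (X' j).tail = (X j).tail ∧
    (X' j).state = (X j).state ∧ ∀ p m, (X' j).inbox p = some m ↔
      (X i).head = (X j).head + unitVec ((hand j).dir p) ∧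
        ∃ q, (X j).head = (X i).head + unitVec ((hand i).dir q) ∧
          (decision hand X i).send q = some m

/-- With all other particles passive there are no conflicts between particles, so that neither the
choice of the active particles nor the adversary matters: either `i` is active and takes effect, or
nothing changes. -/
theorem next_of_effect {hand : ι → Handedness} {X X' : Config A ι} {i : ι}
    (hpas : ∀ j ≠ i, Passive hand X j) (he : Effect hand X i X') : Next hand X X' := by
  refine ⟨i, fun active D hD => ?_⟩
  obtain ⟨winners, hsub, hw1, hw2, hw3, hin, hst, hwin, hlose, hbox⟩ := hD
  -- only `i` attempts to expand, hence only `i` can be a winner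
  have hatt : ∀ j v, Attempts hand X j v → j = i := by
    intro j v hj
    by_contra hne
    obtain ⟨-, p, hp, -⟩ := hj
    rw [(hpas j hne).1] at hp
    cases hp
  have hwi : ∀ j ∈ winners, j = i := fun j hj => by
    obtain ⟨v, hv, -⟩ := hw1 j hj
    exact hatt j v hv
  -- messages come from `i` alone
  have hrec : ∀ j p m, Receives hand active X j p m ↔ i ∈ active ∧
      (X i).head = (X j).head + unitVec ((hand j).dir p) ∧
        ∃ q, (X j).head = (X i).head + unitVec ((hand i).dir q) ∧
          (decision hand X i).send q = some m := by
    intro j p m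
    constructor
    · rintro ⟨k, hk, h1, q, h2, h3⟩
      by_cases hki : k = i
      · subst hki
        exact ⟨hk, h1, q, h2, h3⟩
      · rw [(hpas k hki).1] at h3
        cases h3
    · rintro ⟨hk, h1, q, h2, h3⟩
      exact ⟨i, hk, h1, q, h2, h3⟩
  -- no particle receives its own message, as its ports lead to other vertices
  have hself : ∀ p m, ¬ Receives hand active X i p m := by
    intro p m h
    obtain ⟨-, h, -⟩ := (hrec i p m).1 h
    exact unitVec_ne_zero _ (by simpa using h.symm)
  have hoth : ∀ j ≠ i, (D j).head = (X j).head ∧ (D j).tail = (X j).tail ∧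
      (D j).state = (X j).state := by
    intro j hj
    by_cases ha : j ∈ active
    · have h1 := hlose j ha fun h => hj (hwi j h)
      have h2 := hst j ha
      rw [(hpas j hj).1] at h1 h2
      exact ⟨h1.1, h1.2.2 (by simp), h2⟩
    · exact hin j ha
  have hothbox : ∀ j ≠ i, ∀ p m, (D j).inbox p = some m ↔ Receives hand active X j p m := by
    intro j hj p m
    rw [hbox, (hpas j hj).2]
    simp
  constructor
  · intro hi
    funext j
    by_cases hj : j = i
    · subst hj
      have hgeo : (D j).head = (X' j).head ∧ (D j).tail = (X' j).tail := by
        cases hm : (decision hand X j).move with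
        | stay =>
          have hnw : j ∉ winners := fun h => by
            obtain ⟨v, ⟨-, p, hp, -⟩, -⟩ := hw1 j h
            rw [hm] at hp
            cases hp
          have h1 := hlose j hi hnw
          have h2 := he.stay hm
          rw [h2.1, h2.2]
          exact ⟨h1.1, h1.2.2 (by simp [hm])⟩
        | contract =>
          have hnw : j ∉ winners := fun h => by
            obtain ⟨v, ⟨-, p, hp, -⟩, -⟩ := hw1 j h
            rw [hm] at hp
            cases hp
          have h1 := hlose j hi hnw
          have h2 := he.contract hm
          rw [h2.1, h2.2]
          exact ⟨h1.1, h1.2.1 hm⟩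
        | expand p =>
          obtain ⟨h1, h2, h3, h4⟩ := he.expand p hm
          have hA : Attempts hand X j (X' j).head := ⟨h1, p, hm, h2⟩
          obtain ⟨k, hk, hk'⟩ := hw3 j hi _ hA h3
          obtain rfl := hatt k _ hk'
          obtain ⟨⟨-, p', hp', hv⟩, ht⟩ := hwin k hk
          rw [hm] at hp'
          cases hp'
          exact ⟨hv.trans h2.symm, ht.trans h4.symm⟩
      refine Particle.ext' hgeo.1 hgeo.2 ((hst j hi).trans he.state.symm) fun p m => ?_
      rw [hbox, he.inbox]
      simp [hself, hi]
    · obtain ⟨h1, h2, h3⟩ := hoth j hj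
      obtain ⟨e1, e2, e3, e4⟩ := he.other j hj
      refine Particle.ext' (h1.trans e1.symm) (h2.trans e2.symm) (h3.trans e3.symm) fun p m => ?_
      rw [hothbox j hj, hrec, e4]
      simp [hi]
  · intro hi
    funext j
    by_cases hj : j = i
    · subst hj
      obtain ⟨h1, h2, h3⟩ := hin j hi
      refine Particle.ext' h1 h2 h3 fun p m => ?_
      rw [hbox]
      simp [hself, hi]
    · obtain ⟨h1, h2, h3⟩ := hoth j hj
      refine Particle.ext' h1 h2 h3 fun p m => ?_
      rw [hothbox j hj, hrec, (hpas j hj).2]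
      simp [hi]

theorem stuck_of_passive {hand : ι → Handedness} {X : Config A ι}
    (hpas : ∀ j, Passive hand X j) : Stuck hand X := by
  intro active D hD
  by_cases hι : Nonempty ι
  · obtain ⟨i⟩ := hι
    have he : Effect hand X i X := by
      have hi := hpas i
      refine ⟨by rw [hi.1], hi.2, fun _ => ⟨rfl, rfl⟩, ?_, ?_, fun j hj => ⟨rfl, rfl, rfl, ?_⟩⟩
      · rw [hi.1]; simp
      · rw [hi.1]; simp
      · rw [(hpas j).2, hi.1]; simp
    obtain ⟨i', h⟩ := next_of_effect (fun j _ => hpas j) he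
    by_cases ha : i' ∈ active
    · exact (h active D hD).1 ha
    · exact (h active D hD).2 ha
  · funext j
    exact (hι ⟨j⟩).elim

variable {hand : ι → Handedness} {active : ℕ → Set ι} {C : ℕ → Config A ι}

/-- By fairness the particle that can change the configuration is activated eventually. -/
theorem FairExecution.of_next (hC : FairExecution hand active C) {t : ℕ} {X' : Config A ι}
    (h : Next hand (C t) X') : ∃ t' > t, C t' = X' ∧ ∀ s, t ≤ s → s < t' → C s = C t := by
  classical
  obtain ⟨i, hi⟩ := h
  have hex := hC.2 i t
  -- the first time from `t` on at which `i` is active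
  set u := Nat.find hex with hu
  obtain ⟨hut, hui⟩ := Nat.find_spec hex
  have hconst : ∀ n, t + n ≤ u → C (t + n) = C t := by
    intro n
    induction n with
    | zero => simp
    | succ n ih =>
      intro hn
      have h1 := ih (by omega)
      have h2 : i ∉ active (t + n) := fun h => Nat.find_min hex (m := t + n) (by omega) ⟨by omega, h⟩
      have h3 := hC.1 (t + n)
      rw [h1] at h3
      exact (hi _ _ h3).2 h2
  have hconst' : ∀ s, t ≤ s → s ≤ u → C s = C t := by
    intro s hs hsu
    have := hconst (s - t) (by omega)
    rwa [Nat.add_sub_cancel' hs] at this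
  refine ⟨u + 1, by omega, ?_, fun s hs hs' => hconst' s hs (by omega)⟩
  have h3 := hC.1 u
  rw [hconst' u (by omega) le_rfl] at h3
  exact (hi _ _ h3).1 hui

/-- A fair execution passes through every chain of configurations linked by `Next`, dwelling on each of
them for some time. -/
theorem FairExecution.of_transGen (hC : FairExecution hand active C) {P : Config A ι → Prop}
    {t : ℕ} {X' : Config A ι}
    (h : Relation.TransGen (fun Y Z => Next hand Y Z ∧ P Y) (C t) X') :
    ∃ t' > t, C t' = X' ∧ ∀ s, t ≤ s → s < t' → P (C s) := by
  induction h with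
  | single h =>
    obtain ⟨t', ht, h1, h2⟩ := hC.of_next h.1
    exact ⟨t', ht, h1, fun s hs hs' => by rw [h2 s hs hs']; exact h.2⟩
  | tail _ h ih =>
    obtain ⟨t₁, ht, rfl, h2⟩ := ih
    obtain ⟨t', ht', h1, h3⟩ := hC.of_next h.1
    refine ⟨t', by omega, h1, fun s hs hs' => ?_⟩
    by_cases hst : s < t₁
    · exact h2 s hs hst
    · rw [h3 s (by omega) hs']
      exact h.2

theorem FairExecution.of_stuck (hC : FairExecution hand active C) {t : ℕ}
    (h : Stuck hand (C t)) : ∀ s ≥ t, C s = C t := by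
  intro s hs
  induction s, hs using Nat.le_induction with
  | base => rfl
  | succ s hs ih =>
    have := hC.1 s
    rw [ih] at this
    exact h _ _ this

end Next

end Amoebot

namespace Amoebot

/-! ### The algorithm -/

/-- The messages. The first four are requests of the leader: the neighbour is to move by the port
whose number exceeds by `j` the number of the port at which the request arrived (`shift`), or is to
follow the leader as soon as the leader has left its vertex (`follow`); the variants `shiftBoth` and
`followBoth`, sent to `M₂` when the pivot is next to it, demand the same of the pivot, too. -/
inductive Signal
  | shift (j : ZMod 6)
  | shiftBoth (j : ZMod 6)
  | follow
  | followBoth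
  | reply

/-- The internal states of the pivot and the markers; `p` is the port towards the sender of the
request that is being carried out, and `p + 3` is the opposite port, which leads from `M₂` to the
pivot. A particle is `contracting` after a move on its own. With `waitShift` the marker `M₂` waits
until the pivot has left its vertex, with `waitReply` until the pivot is prepared to follow, and with
`waitDone` until the pivot has followed. A particle that is `following` waits until the vertex ahead
is empty, and is expanded when `pulling`; `both` tells whether it draws the pivot behind it. -/
inductive MarkerState
  | idle
  | contracting
  | waitShift (p j : ZMod 6)
  | waitReply (p : ZMod 6)
  | following (p : ZMod 6) (both : Bool)
  | pulling (p : ZMod 6) (both : Bool)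
  | waitDone (p : ZMod 6)

/-- The phases of the leader within a task: it is `moving` while expanded, `waiting` after a message
has been sent, and `done` with its own step when the receiver is yet to follow. -/
inductive LeaderPhase
  | start
  | moving
  | waiting
  | done

/-- The tasks of the leader, with the control states to be entered afterwards. Ports are counted
from the port that leads forward. `look` tests whether there is nobody at a port; `step` is a step;
`send` sends a message and waits until the receiver has left its vertex or has refused to do so;
`pull` sends a message, waits for the reply, makes a step away from the receiver and waits until
the receiver has followed. -/
inductive Task (μ : Type)
  | look (p : ZMod 6) (free occupied : μ)
  | step (p : ZMod 6) (next : μ)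
  | send (p : ZMod 6) (m : Signal) (refused moved : μ)
  | pull (p : ZMod 6) (m : Signal) (next : μ)
  | halt

/-- The internal states of particles: a leader knows its port that leads forward. -/
abbrev PState (μ : Type) : Type := (ZMod 6 × μ × LeaderPhase) ⊕ MarkerState

instance : Finite Signal :=
  Finite.of_injective (β := Option (Option (Option (ZMod 6 ⊕ ZMod 6))))
    (fun
      | .shift j => some (some (some (.inl j)))
      | .shiftBoth j => some (some (some (.inr j)))
      | .follow => some (some none)
      | .followBoth => some none
      | .reply => none) (by
    intro x y
    cases x <;> cases y <;> simp)

instance : Finite LeaderPhase :=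
  Finite.of_surjective (fun i : Fin 4 => ![.start, .moving, .waiting, .done] i) (by
    intro x
    cases x
    exacts [⟨0, rfl⟩, ⟨1, rfl⟩, ⟨2, rfl⟩, ⟨3, rfl⟩])

instance : Finite MarkerState :=
  Finite.of_injective (β := Fin 7 × ZMod 6 × ZMod 6 × Bool)
    (fun
      | .idle => (0, 0, 0, false)
      | .contracting => (1, 0, 0, false)
      | .waitShift p j => (2, p, j, false)
      | .waitReply p => (3, p, 0, false)
      | .following p b => (4, p, 0, b)
      | .pulling p b => (5, p, 0, b)
      | .waitDone p => (6, p, 0, false)) (by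
    intro x y
    cases x <;> cases y <;> simp)

instance : DecidableEq Role := fun a b => by
  cases a <;> cases b <;> first | exact isTrue rfl | exact isFalse (by simp)

instance : Fintype Role :=
  ⟨{.pivot, .marker2, .leader, .marker1}, fun x => by cases x <;> simp⟩

/-- Nothing is seen. -/
def Look.free : Look → Bool
  | .empty => true
  | _ => false

/-- A single message `m` at the port `p`. -/
def single (p : ZMod 6) (m : Signal) : ZMod 6 → Option Signal :=
  fun q => if q = p then some m else none

/-- No message. -/
def noMsg : ZMod 6 → Option Signal := fun _ => none

open Classical in
/-- A message that has come in, with its port. -/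
noncomputable def received (b : ZMod 6 → Option Signal) : Option (ZMod 6 × Signal) :=
  if h : ∃ x : ZMod 6 × Signal, b x.1 = some x.2 then some h.choose else none

@[simp] theorem received_noMsg : received noMsg = none := by
  simp [received, noMsg]

@[simp] theorem received_single (p : ZMod 6) (m : Signal) :
    received (single p m) = some (p, m) := by
  have h : ∃ x : ZMod 6 × Signal, single p m x.1 = some x.2 := ⟨(p, m), by simp [single]⟩
  rw [received, dif_pos h]
  have h1 := h.choose_spec
  generalize h.choose = x at h1
  obtain ⟨q, m'⟩ := x
  unfold single at h1
  split_ifs at h1 with hq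
  simp_all

section Algorithm

variable {μ : Type}

/-- The decision to change nothing but the state. -/
def stayIn (s : PState μ) : Decision (PState μ) Signal := ⟨s, noMsg, .stay⟩

/-- The decisions of the pivot and the markers. -/
noncomputable def markerDecide (s : MarkerState) (look : ZMod 6 → Look)
    (box : ZMod 6 → Option Signal) : Decision (PState μ) Signal :=
  match s with
  | .idle =>
    match received box with
    | some (p, .shift j) =>
      if (look (p + j)).free then ⟨.inr .contracting, noMsg, .expand (p + j)⟩
      else ⟨.inr .idle, single p .reply, .stay⟩
    | some (p, .shiftBoth j) => ⟨.inr (.waitShift p j), single (p + 3) (.shift j), .stay⟩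
    | some (p, .follow) => ⟨.inr (.following p false), single p .reply, .stay⟩
    | some (p, .followBoth) => ⟨.inr (.waitReply p), single (p + 3) .follow, .stay⟩
    | _ => stayIn (.inr .idle)
  | .contracting => ⟨.inr .idle, noMsg, .contract⟩
  | .waitShift p j =>
    if (look (p + 3)).free then ⟨.inr .contracting, noMsg, .expand (p + j)⟩
    else stayIn (.inr s)
  | .waitReply p =>
    match received box with
    | some _ => ⟨.inr (.following p true), single p .reply, .stay⟩
    | none => stayIn (.inr s)
  | .following p both =>
    if (look p).free then ⟨.inr (.pulling p both), noMsg, .expand p⟩ else stayIn (.inr s)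
  | .pulling p true => ⟨.inr (.waitDone p), noMsg, .contract⟩
  | .pulling p false => ⟨.inr .idle, single p .reply, .contract⟩
  | .waitDone p =>
    match received box with
    | some _ => ⟨.inr .idle, single p .reply, .stay⟩
    | none => stayIn (.inr s)

/-- The decisions of the leader with the task `T` in the control state `x`. -/
noncomputable def leaderDecide (T : Task μ) (f : ZMod 6) (x : μ) (ph : LeaderPhase)
    (look : ZMod 6 → Look) (box : ZMod 6 → Option Signal) : Decision (PState μ) Signal :=
  match ph, T with
  | .start, .look p x₀ x₁ =>
    stayIn (.inl (f, if (look (f + p)).free then x₀ else x₁, .start))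
  | .start, .step p _ => ⟨.inl (f, x, .moving), noMsg, .expand (f + p)⟩
  | .start, .send p m _ _ => ⟨.inl (f, x, .waiting), single (f + p) m, .stay⟩
  | .start, .pull p m _ => ⟨.inl (f, x, .waiting), single (f + p) m, .stay⟩
  | .moving, .step _ y => ⟨.inl (f, y, .start), noMsg, .contract⟩
  | .moving, .pull _ _ _ => ⟨.inl (f, x, .done), noMsg, .contract⟩
  | .waiting, .send p _ x₀ x₁ =>
    match received box with
    | some _ => stayIn (.inl (f, x₀, .start))
    | none => stayIn (.inl (if (look (f + p)).free then (f, x₁, .start) else (f, x, .waiting)))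
  | .waiting, .pull p _ _ =>
    match received box with
    | some _ => ⟨.inl (f, x, .moving), noMsg, .expand (f + (p + 3))⟩
    | none => stayIn (.inl (f, x, .waiting))
  | .done, .pull _ _ y =>
    match received box with
    | some _ => stayIn (.inl (f, y, .start))
    | none => stayIn (.inl (f, x, .done))
  | _, _ => stayIn (.inl (f, x, ph))

/-- The algorithm in which the leader performs the tasks `task x`. -/
noncomputable abbrev taskAlg [Finite μ] (task : μ → Task μ) : Algorithm where
  State := PState μ
  Msg := Signal
  finState := inferInstance
  finMsg := inferInstance
  decide s look _ box :=
    match s with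
    | .inl (f, x, ph) => leaderDecide (task x) f x ph look box
    | .inr s => markerDecide s look box

end Algorithm

section Transitions

theorem free_lookAt {A : Algorithm} {ι : Type} {C : Config A ι} {v : Grid} :
    (lookAt C v).free = true ↔ ¬ Occupied C v := by
  unfold lookAt Occupied
  split_ifs with h1 h2
  · obtain ⟨i, hi⟩ := h1
    simp only [Look.free, Bool.false_eq_true, false_iff, not_not]
    exact ⟨i, .inl hi⟩
  · obtain ⟨i, hi⟩ := h2
    simp only [Look.free, Bool.false_eq_true, false_iff, not_not]
    exact ⟨i, .inr hi⟩
  · simp only [Look.free, true_iff]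
    rintro ⟨i, hi | hi⟩
    exacts [h1 ⟨i, hi⟩, h2 ⟨i, hi⟩]

theorem free_lookAt_of_occupied {A : Algorithm} {ι : Type} {C : Config A ι} {v : Grid}
    (h : Occupied C v) : (lookAt C v).free = false := by
  rw [← Bool.not_eq_true, free_lookAt]
  exact fun h' => h' h

variable {μ : Type} [Finite μ] {task : μ → Task μ} {hand : Role → Handedness}
  {X : Config (taskAlg task) Role} {i : Role}

theorem decision_of_marker {s : MarkerState} {b : ZMod 6 → Option Signal}
    (hs : (X i).state = .inr s) (hb : (X i).inbox = b) : decision hand X i =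
      markerDecide s (fun p => lookAt X ((X i).head + unitVec ((hand i).dir p))) b := by
  unfold decision
  rw [hs, hb]

theorem decision_of_leader {f : ZMod 6} {x : μ} {ph : LeaderPhase} {b : ZMod 6 → Option Signal}
    (hs : (X i).state = .inl (f, x, ph)) (hb : (X i).inbox = b) : decision hand X i =
      leaderDecide (task x) f x ph (fun p => lookAt X ((X i).head + unitVec ((hand i).dir p))) b := by
  unfold decision
  rw [hs, hb]

/-- A particle that would neither move, nor send, nor change its state or its inbox is passive. -/
theorem Passive.of_decision {s : PState μ} (hs : (X i).state = s) (hb : (X i).inbox = noMsg)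
    (h : decision hand X i = stayIn s) : Passive hand X i := by
  subst hs
  exact ⟨h, hb⟩

theorem passive_idle (hs : (X i).state = .inr .idle) (hb : (X i).inbox = noMsg) :
    Passive hand X i :=
  .of_decision hs hb (by rw [decision_of_marker hs hb]; simp [markerDecide])

theorem passive_waitShift {p j : ZMod 6} (hs : (X i).state = .inr (.waitShift p j))
    (hb : (X i).inbox = noMsg)
    (ho : Occupied X ((X i).head + unitVec ((hand i).dir (p + 3)))) : Passive hand X i :=
  .of_decision hs hb (by
    rw [decision_of_marker hs hb]; simp [markerDecide, free_lookAt_of_occupied ho])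

theorem passive_waitReply {p : ZMod 6} (hs : (X i).state = .inr (.waitReply p))
    (hb : (X i).inbox = noMsg) : Passive hand X i :=
  .of_decision hs hb (by rw [decision_of_marker hs hb]; simp [markerDecide])

theorem passive_waitDone {p : ZMod 6} (hs : (X i).state = .inr (.waitDone p))
    (hb : (X i).inbox = noMsg) : Passive hand X i :=
  .of_decision hs hb (by rw [decision_of_marker hs hb]; simp [markerDecide])

theorem passive_following {p : ZMod 6} {b : Bool} (hs : (X i).state = .inr (.following p b))
    (hb : (X i).inbox = noMsg)
    (ho : Occupied X ((X i).head + unitVec ((hand i).dir p))) : Passive hand X i :=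
  .of_decision hs hb (by
    rw [decision_of_marker hs hb]; simp [markerDecide, free_lookAt_of_occupied ho])

theorem passive_send {f p : ZMod 6} {x x₀ x₁ : μ} {m : Signal}
    (ht : task x = .send p m x₀ x₁) (hs : (X i).state = .inl (f, x, .waiting))
    (hb : (X i).inbox = noMsg)
    (ho : Occupied X ((X i).head + unitVec ((hand i).dir (f + p)))) : Passive hand X i :=
  .of_decision hs hb (by
    rw [decision_of_leader hs hb]; simp [leaderDecide, ht, free_lookAt_of_occupied ho])

theorem passive_pull_waiting {f p : ZMod 6} {x y : μ} {m : Signal}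
    (ht : task x = .pull p m y) (hs : (X i).state = .inl (f, x, .waiting))
    (hb : (X i).inbox = noMsg) : Passive hand X i :=
  .of_decision hs hb (by rw [decision_of_leader hs hb]; simp [leaderDecide, ht])

theorem passive_pull_done {f p : ZMod 6} {x y : μ} {m : Signal}
    (ht : task x = .pull p m y) (hs : (X i).state = .inl (f, x, .done))
    (hb : (X i).inbox = noMsg) : Passive hand X i :=
  .of_decision hs hb (by rw [decision_of_leader hs hb]; simp [leaderDecide, ht])

theorem passive_halt {f : ZMod 6} {x : μ}
    (ht : task x = .halt) (hs : (X i).state = .inl (f, x, .start))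
    (hb : (X i).inbox = noMsg) : Passive hand X i :=
  .of_decision hs hb (by rw [decision_of_leader hs hb]; simp [leaderDecide, ht])

variable {s : PState μ}

/-- If the only effective particle stays where it is and sends nothing, only its state changes and its
inbox is emptied. -/
theorem next_stay (hpas : ∀ j ≠ i, Passive hand X j) (hd : decision hand X i = ⟨s, noMsg, .stay⟩) :
    Next hand X (Function.update X i ⟨(X i).head, (X i).tail, s, noMsg⟩) := by
  refine next_of_effect (i := i) hpas ⟨?_, ?_, ?_, ?_, ?_, ?_⟩
  · simp [hd]
  · simp; rfl
  · simp
  · simp [hd]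
  · simp [hd]
  · intro j hj
    simp [hj, hd, noMsg, (hpas j hj).2]

theorem next_contract (hpas : ∀ j ≠ i, Passive hand X j)
    (hd : decision hand X i = ⟨s, noMsg, .contract⟩) :
    Next hand X (Function.update X i ⟨(X i).head, (X i).head, s, noMsg⟩) := by
  refine next_of_effect (i := i) hpas ⟨?_, ?_, ?_, ?_, ?_, ?_⟩
  · simp [hd]
  · simp; rfl
  · simp [hd]
  · simp
  · simp [hd]
  · intro j hj
    simp [hj, hd, noMsg, (hpas j hj).2]

theorem next_expand {p : ZMod 6} {v : Grid} (hpas : ∀ j ≠ i, Passive hand X j)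
    (hd : decision hand X i = ⟨s, noMsg, .expand p⟩) (hc : (X i).head = (X i).tail)
    (hv : v = (X i).head + unitVec ((hand i).dir p)) (ho : ¬ Occupied X v) :
    Next hand X (Function.update X i ⟨v, (X i).head, s, noMsg⟩) := by
  refine next_of_effect (i := i) hpas ⟨?_, ?_, ?_, ?_, ?_, ?_⟩
  · simp [hd]
  · simp; rfl
  · simp [hd]
  · simp [hd]
  · intro q hq
    rw [hd] at hq
    cases hq
    simp only [Function.update_self]
    exact ⟨hc, hv, ho, hc⟩
  · intro j hj
    simp [hj, hd, noMsg, (hpas j hj).2]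

/-- A message arrives at the only particle whose head is at the vertex to which it is sent. -/
theorem next_send {q D : ZMod 6} {m : Signal} {mv : Move} {k : Role} {t : Grid}
    (hpas : ∀ j ≠ i, Passive hand X j) (hd : decision hand X i = ⟨s, single q m, mv⟩)
    (hmv : (mv = .stay ∧ t = (X i).tail) ∨ (mv = .contract ∧ t = (X i).head))
    (hki : k ≠ i) (hD : (hand i).dir q = D) (hk : (X k).head = (X i).head + unitVec D)
    (hu : ∀ j, j ≠ i → j ≠ k → (X j).head ≠ (X k).head) :
    Next hand X (Function.update (Function.update X i ⟨(X i).head, t, s, noMsg⟩) k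
      ⟨(X k).head, (X k).tail, (X k).state, single ((hand k).port (D + 3)) m⟩) := by
  have hrel : ∀ q' m', (decision hand X i).send q' = some m' ↔ q' = q ∧ m = m' := by
    intro q' m'
    rw [hd]
    simp only [single]
    split_ifs with h <;> simp [h]
  subst hD
  refine next_of_effect (i := i) hpas ⟨?_, ?_, ?_, ?_, ?_, ?_⟩
  · simp [hd, hki.symm]
  · simp [hki.symm]; rfl
  · simp only [hd, ne_eq, hki.symm, not_false_eq_true, Function.update_of_ne,
      Function.update_self]
    rintro rfl
    simpa using hmv
  · simp only [hd, ne_eq, hki.symm, not_false_eq_true, Function.update_of_ne,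
      Function.update_self]
    rintro rfl
    simpa using hmv
  · rw [hd]
    rintro p rfl
    simp at hmv
  · intro j hj
    by_cases hjk : j = k
    · subst hjk
      simp only [Function.update_self, true_and]
      intro p m'
      simp only [hrel, single]
      constructor
      · intro h
        split_ifs at h with hp
        subst hp
        refine ⟨?_, q, hk, rfl, by simpa using h⟩
        rw [Handedness.dir_port, unitVec_add_three, hk]
        simp
      · rintro ⟨h1, q', h2, rfl, rfl⟩
        have h3 : unitVec ((hand j).dir p) = unitVec ((hand i).dir q' + 3) := by
          rw [unitVec_add_three]
          rw [h2] at h1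
          have : (X i).head = (X i).head + (unitVec ((hand i).dir q') + unitVec ((hand j).dir p)) := by
            rw [← add_assoc]; exact h1
          exact eq_neg_of_add_eq_zero_right (left_eq_add.1 this)
        rw [← unitVec_injective h3, Handedness.port_dir]
        simp
    · simp only [ne_eq, hjk, not_false_eq_true, Function.update_of_ne, hj, true_and]
      intro p m'
      rw [(hpas j hj).2]
      simp only [hrel, reduceCtorEq, false_iff]
      rintro ⟨-, q', h2, rfl, rfl⟩
      exact hu j hj hjk (h2.trans hk.symm)

end Transitions

end Amoebot

namespace Amoebot

/-! ### Executing the tasks of the leader -/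

section Tasks

variable {μ : Type} [Finite μ] {task : μ → Task μ} {hand : Role → Handedness}

/-- All particles are contracted, at the vertices `pos`; the leader is about to start a task in the
control state `x`, the others are idle, and there are no messages. -/
def rest (task : μ → Task μ) (f : ZMod 6) (pos : Role → Grid) (x : μ) :
    Config (taskAlg task) Role := fun i =>
  ⟨pos i, pos i, if i = .leader then .inl (f, x, .start) else .inr .idle, noMsg⟩

/-- The heads and tails satisfy `Φ`, and the leader is in the control state `x`. -/
def Guard (Φ : (Role → Grid) → (Role → Grid) → Prop) (x : μ) (X : Config (taskAlg task) Role) :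
    Prop :=
  Φ (fun i => (X i).head) (fun i => (X i).tail) ∧ ∃ f ph, (X .leader).state = .inl (f, x, ph)

/-- One or more changes of the configuration during a single task, with all configurations but the
last one satisfying `Φ`. -/
abbrev Adv (hand : Role → Handedness) (Φ : (Role → Grid) → (Role → Grid) → Prop) (x : μ) :
    Config (taskAlg task) Role → Config (taskAlg task) Role → Prop :=
  Relation.TransGen fun X Y => Next hand X Y ∧ Guard Φ x X

variable {Φ : (Role → Grid) → (Role → Grid) → Prop} {f : ZMod 6} {x y z : μ} {pos : Role → Grid}

theorem guard_rest (h : Φ pos pos) : Guard Φ x (rest task f pos x) :=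
  ⟨h, f, .start, rfl⟩

theorem rest_passive : ∀ j ≠ .leader, Passive hand (rest task f pos x) j :=
  fun j hj => passive_idle (by simp [rest, hj]) rfl

theorem occupied_rest {v : Grid} : Occupied (rest task f pos x) v ↔ ∃ i, pos i = v := by
  simp [Occupied, rest]

theorem stuck_rest (ht : task x = .halt) : Stuck hand (rest task f pos x) := by
  refine stuck_of_passive fun j => ?_
  by_cases hj : j = .leader
  · subst hj
    exact passive_halt ht (by simp [rest]; rfl) rfl
  · exact rest_passive j hj

theorem update_rest_leader {v : Grid} :
    Function.update (rest task f pos x) .leader ⟨v, v, .inl (f, y, .start), noMsg⟩ =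
      rest task f (Function.update pos .leader v) y := by
  funext j
  by_cases hj : j = .leader
  · subst hj; simp [rest]
  · simp [rest, hj]

/-- The leader tests whether the vertex at a port is occupied. -/
theorem adv_look {p : ZMod 6} (ht : task x = .look p y z) (hΦ : Φ pos pos) :
    (¬ (∃ i, pos i = pos .leader + unitVec ((hand .leader).dir (f + p))) →
      Adv hand Φ x (rest task f pos x) (rest task f pos y)) ∧
    ((∃ i, pos i = pos .leader + unitVec ((hand .leader).dir (f + p))) →
      Adv hand Φ x (rest task f pos x) (rest task f pos z)) := by
  have hs : (rest task f pos x .leader).state = .inl (f, x, .start) := by simp [rest]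
  have hd := decision_of_leader (hand := hand) hs rfl
  simp only [leaderDecide, ht] at hd
  constructor
  · intro h
    have h1 : (lookAt (rest task f pos x) ((rest task f pos x .leader).head +
        unitVec ((hand .leader).dir (f + p)))).free = true :=
      free_lookAt.2 (mt occupied_rest.1 h)
    rw [if_pos h1] at hd
    have := next_stay rest_passive hd
    rw [show (rest task f pos x .leader).head = pos .leader from rfl,
      show (rest task f pos x .leader).tail = pos .leader from rfl, update_rest_leader,
      Function.update_eq_self] at this
    exact .single ⟨this, guard_rest hΦ⟩
  · intro h
    have h1 : (lookAt (rest task f pos x) ((rest task f pos x .leader).head +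
        unitVec ((hand .leader).dir (f + p)))).free = false :=
      free_lookAt_of_occupied (occupied_rest.2 h)
    rw [if_neg (by rw [h1]; simp)] at hd
    have := next_stay rest_passive hd
    rw [show (rest task f pos x .leader).head = pos .leader from rfl,
      show (rest task f pos x .leader).tail = pos .leader from rfl, update_rest_leader,
      Function.update_eq_self] at this
    exact .single ⟨this, guard_rest hΦ⟩

/-- The leader and the particle `N` are as given, the others are contracted and idle at the
vertices `pos`. -/
def duo (pos : Role → Grid) (N : Role) (l n : Particle (taskAlg task)) :
    Config (taskAlg task) Role := fun i =>
  if i = .leader then l else if i = N then n else ⟨pos i, pos i, .inr .idle, noMsg⟩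

section duo

variable {N : Role} {l n l' n' : Particle (taskAlg task)}

@[simp] theorem duo_leader : duo pos N l n .leader = l := by simp [duo]

theorem duo_self (hN : N ≠ .leader) : duo pos N l n N = n := by simp [duo, hN]

theorem duo_other {j : Role} (h1 : j ≠ .leader) (h2 : j ≠ N) :
    duo pos N l n j = ⟨pos j, pos j, .inr .idle, noMsg⟩ := by simp [duo, h1, h2]

theorem update_duo_leader : Function.update (duo pos N l n) .leader l' = duo pos N l' n := by
  funext j
  by_cases hj : j = .leader
  · subst hj; simp
  · simp [hj, duo]

theorem update_duo_self (hN : N ≠ .leader) :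
    Function.update (duo pos N l n) N n' = duo pos N l n' := by
  funext j
  by_cases hj : j = N
  · subst hj; simp [duo, hN]
  · by_cases hl : j = .leader
    · subst hl; simp [hN.symm]
    · simp [hj, duo, hl]

theorem rest_eq_duo (hN : N ≠ .leader) : rest task f pos x =
    duo pos N ⟨pos .leader, pos .leader, .inl (f, x, .start), noMsg⟩
      ⟨pos N, pos N, .inr .idle, noMsg⟩ := by
  funext j
  by_cases hj : j = .leader
  · subst hj; simp [rest]
  · by_cases hn : j = N
    · subst hn; simp [duo, rest, hN]
    · simp [duo, rest, hj, hn]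

theorem duo_eq_rest (hN : N ≠ .leader) {a b : Grid} :
    duo pos N ⟨a, a, .inl (f, x, .start), noMsg⟩ ⟨b, b, .inr .idle, noMsg⟩ =
      rest task f (Function.update (Function.update pos .leader a) N b) x := by
  funext j
  by_cases hj : j = .leader
  · subst hj; simp [rest, hN.symm]
  · by_cases hn : j = N
    · subst hn; simp [duo, rest, hN]
    · simp [duo, rest, hj, hn]

theorem guard_duo (hN : N ≠ .leader) (h : Φ
      (Function.update (Function.update pos .leader l.head) N n.head)
      (Function.update (Function.update pos .leader l.tail) N n.tail))
    {ph : LeaderPhase} (hl : l.state = .inl (f, x, ph)) : Guard Φ x (duo pos N l n) := by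
  refine ⟨?_, f, ph, by rw [duo_leader, hl]⟩
  convert h using 1 <;>
  · funext j
    by_cases hj : j = .leader
    · subst hj; simp [hN.symm]
    · by_cases hn : j = N
      · subst hn; simp [duo, hN]
      · simp [duo, hj, hn]

theorem not_occupied_duo {v : Grid} (h1 : l.head ≠ v) (h2 : l.tail ≠ v) (h3 : n.head ≠ v)
    (h4 : n.tail ≠ v) (h : ∀ j, j ≠ .leader → j ≠ N → pos j ≠ v) :
    ¬ Occupied (duo pos N l n) v := by
  rintro ⟨j, hj⟩
  by_cases hl : j = .leader
  · subst hl; simp [h1, h2] at hj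
  · by_cases hn : j = N
    · subst hn; simp [duo, hl, h3, h4] at hj
    · have := h j hl hn
      simp [duo, hl, hn, this] at hj

theorem occupied_duo_leader : Occupied (duo pos N l n) l.head ∧ Occupied (duo pos N l n) l.tail :=
  ⟨⟨.leader, by simp⟩, ⟨.leader, by simp⟩⟩

theorem occupied_duo_self (hN : N ≠ .leader) :
    Occupied (duo pos N l n) n.head ∧ Occupied (duo pos N l n) n.tail :=
  ⟨⟨N, by simp [duo_self hN]⟩, ⟨N, by simp [duo_self hN]⟩⟩

theorem duo_passive_leader (hN : N ≠ .leader) (h : Passive hand (duo pos N l n) N) :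
    ∀ j ≠ .leader, Passive hand (duo pos N l n) j := by
  intro j hj
  by_cases hn : j = N
  · subst hn; exact h
  · exact passive_idle (by simp [duo, hj, hn]) (by simp [duo, hj, hn])

theorem duo_passive_self (h : Passive hand (duo pos N l n) .leader) :
    ∀ j ≠ N, Passive hand (duo pos N l n) j := by
  intro j hj
  by_cases hl : j = .leader
  · subst hl; exact h
  · exact passive_idle (by simp [duo, hj, hl]) (by simp [duo, hj, hl])

end duo

/-- The leader expands into an empty vertex and contracts. -/
theorem adv_step {p : ZMod 6} {v : Grid} (ht : task x = .step p y)
    (hv : v = pos .leader + unitVec ((hand .leader).dir (f + p))) (hfree : ∀ i, pos i ≠ v)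
    (hΦ₀ : Φ pos pos) (hΦ₁ : Φ (Function.update pos .leader v) pos) :
    Adv hand Φ x (rest task f pos x) (rest task f (Function.update pos .leader v) y) := by
  have hN : Role.pivot ≠ .leader := by decide
  rw [rest_eq_duo hN]
  -- the leader expands
  have e1 := next_expand (hand := hand) (X := duo (task := task) pos .pivot
      ⟨pos .leader, pos .leader, .inl (f, x, .start), noMsg⟩
      ⟨pos .pivot, pos .pivot, .inr .idle, noMsg⟩)
    (i := .leader) (s := .inl (f, x, .moving)) (p := f + p) (v := v)
    (duo_passive_leader hN (passive_idle (by simp [duo]) (by simp [duo])))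
    (by rw [decision_of_leader (f := f) (x := x) (ph := .start) (b := noMsg) (by simp) (by simp)]
        simp [leaderDecide, ht])
    (by simp) (by simpa using hv)
    (not_occupied_duo (hfree _) (hfree _) (hfree _) (hfree _) (fun j _ _ => hfree j))
  rw [update_duo_leader] at e1
  simp only [duo_leader] at e1
  -- the leader contracts
  have e2 := next_contract (hand := hand) (X := duo (task := task) pos .pivot
      ⟨v, pos .leader, .inl (f, x, .moving), noMsg⟩
      ⟨pos .pivot, pos .pivot, .inr .idle, noMsg⟩)
    (i := .leader) (s := .inl (f, y, .start))
    (duo_passive_leader hN (passive_idle (by simp [duo]) (by simp [duo])))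
    (by rw [decision_of_leader (f := f) (x := x) (ph := .moving) (b := noMsg) (by simp) (by simp)]
        simp [leaderDecide, ht])
  rw [update_duo_leader] at e2
  simp only [duo_leader] at e2
  rw [duo_eq_rest hN] at e2
  have hu : Function.update (Function.update pos .leader v) .pivot (pos .pivot) =
      Function.update pos .leader v := by
    funext j; by_cases hj : j = .pivot <;> simp [hj, Function.update]
  rw [hu] at e2
  refine .head ⟨e1, guard_duo hN ?_ rfl⟩ (.single ⟨e2, guard_duo hN ?_ rfl⟩)
  · simpa using hΦ₀
  · simpa [hu] using hΦ₁

section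

variable {N : Role} {p j E : ZMod 6} {v : Grid}

/-- A neighbour of the leader moves away on demand. -/
theorem adv_send_shift (hN : N ≠ .leader) (ht : task x = .send p (.shift j) y z)
    (hinj : Function.Injective pos) (hE : (hand .leader).dir (f + p) + 3 = E)
    (hpos : pos N = pos .leader + unitVec ((hand .leader).dir (f + p)))
    (hv : v = pos N + unitVec (E + (hand N).sign * j)) (hfree : ∀ i, pos i ≠ v)
    (hΦ₀ : Φ pos pos) (hΦ₁ : Φ (Function.update pos N v) pos)
    (hΦ₂ : Φ (Function.update pos N v) (Function.update pos N v)) :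
    Adv hand Φ x (rest task f pos x) (rest task f (Function.update pos N v) z) := by
  have hNe : ∀ j, j ≠ N → pos j ≠ pos N := fun j hj h => hj (hinj h)
  -- the leader sends the request
  have e1 := next_send (hand := hand) (X := duo (task := task) pos N
      ⟨pos .leader, pos .leader, .inl (f, x, .start), noMsg⟩
      ⟨pos N, pos N, .inr .idle, noMsg⟩)
    (i := .leader) (s := .inl (f, x, .waiting)) (q := f + p) (m := .shift j) (mv := .stay)
    (k := N) (t := pos .leader)
    (duo_passive_leader hN (passive_idle (by simp [duo_self hN]) (by simp [duo_self hN])))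
    (by rw [decision_of_leader (f := f) (x := x) (ph := .start) (b := noMsg) (by simp) (by simp)]
        simp [leaderDecide, ht])
    (by simp) hN rfl (by simpa [duo_self hN] using hpos)
    (fun k h1 h2 => by simpa [duo_other h1 h2, duo_self hN] using hNe k h2)
  rw [update_duo_leader, update_duo_self hN, hE] at e1
  simp only [duo_leader, duo_self hN] at e1
  -- the leader waits as long as the vertex of the neighbour is occupied by its head or its tail
  have w1 : ∀ n : Particle (taskAlg task), n.head = pos N ∨ n.tail = pos N →
      ∀ k ≠ N, Passive hand (duo (task := task) pos N
        ⟨pos .leader, pos .leader, .inl (f, x, .waiting), noMsg⟩ n) k := by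
    intro n hn
    refine duo_passive_self (passive_send ht (by simp; rfl) (by simp) ?_)
    simp only [duo_leader, ← hpos]
    rcases hn with hn | hn <;> rw [← hn]
    exacts [(occupied_duo_self hN).1, (occupied_duo_self hN).2]
  -- the neighbour expands into the empty vertex
  have e2 := next_expand (hand := hand) (X := duo (task := task) pos N
      ⟨pos .leader, pos .leader, .inl (f, x, .waiting), noMsg⟩
      ⟨pos N, pos N, .inr .idle, single ((hand N).port E) (.shift j)⟩)
    (i := N) (s := .inr .contracting) (p := (hand N).port E + j) (v := v)
    (w1 _ (.inl rfl))
    (by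
      rw [decision_of_marker (s := .idle) (b := single ((hand N).port E) (.shift j))
        (by simp [duo_self hN]) (by simp [duo_self hN])]
      have : (lookAt (duo (task := task) pos N
          ⟨pos .leader, pos .leader, .inl (f, x, .waiting), noMsg⟩
          ⟨pos N, pos N, .inr .idle, single ((hand N).port E) (.shift j)⟩)
          (pos N + unitVec (E + (hand N).sign * j))).free = true :=
        free_lookAt.2 (hv ▸ not_occupied_duo (hfree _) (hfree _) (hfree _) (hfree _)
          (fun j _ _ => hfree j))
      simp [markerDecide, duo_self hN, Handedness.dir_add, Handedness.dir_port, this])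
    (by simp [duo_self hN])
    (by simpa [duo_self hN, Handedness.dir_add, Handedness.dir_port] using hv)
    (not_occupied_duo (hfree _) (hfree _) (hfree _) (hfree _) (fun j _ _ => hfree j))
  rw [update_duo_self hN] at e2
  simp only [duo_self hN] at e2
  -- the neighbour contracts
  have e3 := next_contract (hand := hand) (X := duo (task := task) pos N
      ⟨pos .leader, pos .leader, .inl (f, x, .waiting), noMsg⟩
      ⟨v, pos N, .inr .contracting, noMsg⟩)
    (i := N) (s := .inr .idle)
    (w1 _ (.inr rfl))
    (by rw [decision_of_marker (s := .contracting) (b := noMsg)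
          (by simp [duo_self hN]) (by simp [duo_self hN])]
        simp [markerDecide])
  rw [update_duo_self hN] at e3
  simp only [duo_self hN] at e3
  -- the leader sees that the vertex of the neighbour is empty
  have e4 := next_stay (hand := hand) (X := duo (task := task) pos N
      ⟨pos .leader, pos .leader, .inl (f, x, .waiting), noMsg⟩
      ⟨v, v, .inr .idle, noMsg⟩)
    (i := .leader) (s := .inl (f, z, .start))
    (duo_passive_leader hN (passive_idle (by simp [duo_self hN]) (by simp [duo_self hN])))
    (by
      rw [decision_of_leader (f := f) (x := x) (ph := .waiting) (b := noMsg) (by simp) (by simp)]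
      have : (lookAt (duo (task := task) pos N
          ⟨pos .leader, pos .leader, .inl (f, x, .waiting), noMsg⟩
          ⟨v, v, .inr .idle, noMsg⟩)
          (pos .leader + unitVec ((hand .leader).dir (f + p)))).free = true :=
        free_lookAt.2 (hpos ▸ not_occupied_duo (hNe _ hN.symm) (hNe _ hN.symm) (hfree N).symm
          (hfree N).symm (fun j _ h => hNe j h))
      simp [leaderDecide, ht, this, stayIn])
  rw [update_duo_leader] at e4
  simp only [duo_leader] at e4
  rw [duo_eq_rest hN, Function.update_eq_self] at e4
  rw [rest_eq_duo hN]
  refine .head ⟨e1, guard_duo hN ?_ rfl⟩ (.head ⟨e2, guard_duo hN ?_ rfl⟩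
    (.head ⟨e3, guard_duo hN ?_ rfl⟩ (.single ⟨e4, guard_duo hN ?_ rfl⟩)))
  · simpa using hΦ₀
  · simpa using hΦ₀
  · simpa using hΦ₁
  · simpa using hΦ₂

/-- A neighbour of the leader refuses to move to an occupied vertex. -/
theorem adv_send_refused (hN : N ≠ .leader) (ht : task x = .send p (.shift j) y z)
    (hinj : Function.Injective pos) (hE : (hand .leader).dir (f + p) + 3 = E)
    (hpos : pos N = pos .leader + unitVec ((hand .leader).dir (f + p)))
    (hocc : ∃ i, pos i = pos N + unitVec (E + (hand N).sign * j)) (hΦ₀ : Φ pos pos) :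
    Adv hand Φ x (rest task f pos x) (rest task f pos y) := by
  have hNe : ∀ j, j ≠ N → pos j ≠ pos N := fun j hj h => hj (hinj h)
  -- the leader sends the request
  have e1 := next_send (hand := hand) (X := duo (task := task) pos N
      ⟨pos .leader, pos .leader, .inl (f, x, .start), noMsg⟩
      ⟨pos N, pos N, .inr .idle, noMsg⟩)
    (i := .leader) (s := .inl (f, x, .waiting)) (q := f + p) (m := .shift j) (mv := .stay)
    (k := N) (t := pos .leader)
    (duo_passive_leader hN (passive_idle (by simp [duo_self hN]) (by simp [duo_self hN])))
    (by rw [decision_of_leader (f := f) (x := x) (ph := .start) (b := noMsg) (by simp) (by simp)]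
        simp [leaderDecide, ht])
    (by simp) hN rfl (by simpa [duo_self hN] using hpos)
    (fun k h1 h2 => by simpa [duo_other h1 h2, duo_self hN] using hNe k h2)
  rw [update_duo_leader, update_duo_self hN, hE] at e1
  simp only [duo_leader, duo_self hN] at e1
  have hE' : pos .leader = pos N + unitVec E := by
    rw [← hE, unitVec_add_three, hpos]; simp
  -- the neighbour sees that its target is occupied, and replies
  have e2 := next_send (hand := hand) (X := duo (task := task) pos N
      ⟨pos .leader, pos .leader, .inl (f, x, .waiting), noMsg⟩
      ⟨pos N, pos N, .inr .idle, single ((hand N).port E) (.shift j)⟩)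
    (i := N) (s := .inr .idle) (q := (hand N).port E) (m := .reply) (mv := .stay)
    (k := .leader) (t := pos N)
    (duo_passive_self (passive_send ht (by simp; rfl) (by simp) (by
      simp only [duo_leader, ← hpos]
      exact (occupied_duo_self hN).1)))
    (by
      rw [decision_of_marker (s := .idle) (b := single ((hand N).port E) (.shift j))
        (by simp [duo_self hN]) (by simp [duo_self hN])]
      have : (lookAt (duo (task := task) pos N
          ⟨pos .leader, pos .leader, .inl (f, x, .waiting), noMsg⟩
          ⟨pos N, pos N, .inr .idle, single ((hand N).port E) (.shift j)⟩)
          (pos N + unitVec (E + (hand N).sign * j))).free = false := by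
        refine free_lookAt_of_occupied ?_
        obtain ⟨i, hi⟩ := hocc
        refine ⟨i, .inl ?_⟩
        rw [← hi]
        by_cases h1 : i = .leader
        · subst h1; simp
        · by_cases h2 : i = N
          · subst h2; simp [duo_self hN]
          · simp [duo_other h1 h2]
      simp [markerDecide, duo_self hN, Handedness.dir_add, Handedness.dir_port, this])
    (by simp [duo_self hN]) hN.symm (Handedness.dir_port _ _)
    (by simpa [duo_self hN] using hE')
    (fun k h1 h2 => by
      rw [duo_other h2 h1, duo_leader]
      exact fun h => h2 (hinj h))
  rw [update_duo_self hN, update_duo_leader] at e2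
  simp only [duo_leader, duo_self hN] at e2
  -- the leader receives the reply
  have e3 := next_stay (hand := hand) (X := duo (task := task) pos N
      ⟨pos .leader, pos .leader, .inl (f, x, .waiting),
        single ((hand .leader).port (E + 3)) .reply⟩
      ⟨pos N, pos N, .inr .idle, noMsg⟩)
    (i := .leader) (s := .inl (f, y, .start))
    (duo_passive_leader hN (passive_idle (by simp [duo_self hN]) (by simp [duo_self hN])))
    (by rw [decision_of_leader (f := f) (x := x) (ph := .waiting)
          (b := single ((hand .leader).port (E + 3)) .reply) (by simp) (by simp)]
        simp [leaderDecide, ht, stayIn])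
  rw [update_duo_leader] at e3
  simp only [duo_leader] at e3
  rw [← rest_eq_duo hN] at e3
  rw [rest_eq_duo hN]
  refine .head ⟨e1, guard_duo hN ?_ rfl⟩ (.head ⟨e2, guard_duo hN ?_ rfl⟩
    (.single ⟨e3, guard_duo hN ?_ rfl⟩)) <;> simpa using hΦ₀

/-- A neighbour of the leader follows it by one step. -/
theorem adv_pull (hN : N ≠ .leader) (ht : task x = .pull p .follow y)
    (hinj : Function.Injective pos) (hE : (hand .leader).dir (f + p) + 3 = E)
    (hpos : pos N = pos .leader + unitVec ((hand .leader).dir (f + p)))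
    (hv : v = pos .leader + unitVec E) (hfree : ∀ i, pos i ≠ v)
    (hΦ₀ : Φ pos pos) (hΦ₁ : Φ (Function.update pos .leader v) pos)
    (hΦ₂ : Φ (Function.update pos .leader v) (Function.update pos .leader v))
    (hΦ₃ : Φ (Function.update (Function.update pos .leader v) N (pos .leader))
      (Function.update pos .leader v))
    (hΦ₄ : Φ (Function.update (Function.update pos .leader v) N (pos .leader))
      (Function.update (Function.update pos .leader v) N (pos .leader))) :
    Adv hand Φ x (rest task f pos x)
      (rest task f (Function.update (Function.update pos .leader v) N (pos .leader)) y) := by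
  have hNe : ∀ j, j ≠ N → pos j ≠ pos N := fun j hj h => hj (hinj h)
  have hLe : ∀ j, j ≠ .leader → pos j ≠ pos .leader := fun j hj h => hj (hinj h)
  have hE' : pos .leader = pos N + unitVec E := by
    rw [← hE, unitVec_add_three, hpos]; simp
  have hu : ∀ g : Role → Grid, g N = pos N → Function.update g N (pos N) = g := by
    intro g hg; rw [← hg, Function.update_eq_self]
  -- the leader sends the request
  have e1 := next_send (hand := hand) (X := duo (task := task) pos N
      ⟨pos .leader, pos .leader, .inl (f, x, .start), noMsg⟩
      ⟨pos N, pos N, .inr .idle, noMsg⟩)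
    (i := .leader) (s := .inl (f, x, .waiting)) (q := f + p) (m := .follow) (mv := .stay)
    (k := N) (t := pos .leader)
    (duo_passive_leader hN (passive_idle (by simp [duo_self hN]) (by simp [duo_self hN])))
    (by rw [decision_of_leader (f := f) (x := x) (ph := .start) (b := noMsg) (by simp) (by simp)]
        simp [leaderDecide, ht])
    (by simp) hN rfl (by simpa [duo_self hN] using hpos)
    (fun k h1 h2 => by simpa [duo_other h1 h2, duo_self hN] using hNe k h2)
  rw [update_duo_leader, update_duo_self hN, hE] at e1
  simp only [duo_leader, duo_self hN] at e1
  -- the neighbour confirms that it is going to follow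
  have e2 := next_send (hand := hand) (X := duo (task := task) pos N
      ⟨pos .leader, pos .leader, .inl (f, x, .waiting), noMsg⟩
      ⟨pos N, pos N, .inr .idle, single ((hand N).port E) .follow⟩)
    (i := N) (s := .inr (.following ((hand N).port E) false)) (q := (hand N).port E)
    (m := .reply) (mv := .stay) (k := .leader) (t := pos N)
    (duo_passive_self (passive_pull_waiting ht (by simp; rfl) (by simp)))
    (by rw [decision_of_marker (s := .idle) (b := single ((hand N).port E) .follow)
          (by simp [duo_self hN]) (by simp [duo_self hN])]
        simp [markerDecide])
    (by simp [duo_self hN]) hN.symm (Handedness.dir_port _ _)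
    (by simpa [duo_self hN] using hE')
    (fun k h1 h2 => by
      rw [duo_other h2 h1, duo_leader]
      exact fun h => h2 (hinj h))
  rw [update_duo_self hN, update_duo_leader] at e2
  simp only [duo_leader, duo_self hN] at e2
  -- the neighbour waits as long as the leader occupies its old vertex
  have w : ∀ l : Particle (taskAlg task), l.head = pos .leader ∨ l.tail = pos .leader →
      ∀ k ≠ .leader, Passive hand (duo (task := task) pos N l
        ⟨pos N, pos N, .inr (.following ((hand N).port E) false), noMsg⟩) k := by
    intro l hl
    refine duo_passive_leader hN (passive_following (by simp [duo_self hN]; exact ⟨rfl, rfl⟩)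
      (by simp [duo_self hN]) ?_)
    simp only [duo_self hN, Handedness.dir_port, ← hE']
    rcases hl with hl | hl <;> rw [← hl]
    exacts [occupied_duo_leader.1, occupied_duo_leader.2]
  -- the leader receives the reply and expands away from the neighbour
  have e3 := next_expand (hand := hand) (X := duo (task := task) pos N
      ⟨pos .leader, pos .leader, .inl (f, x, .waiting),
        single ((hand .leader).port (E + 3)) .reply⟩
      ⟨pos N, pos N, .inr (.following ((hand N).port E) false), noMsg⟩)
    (i := .leader) (s := .inl (f, x, .moving)) (p := f + (p + 3)) (v := v)
    (w _ (.inl rfl))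
    (by rw [decision_of_leader (f := f) (x := x) (ph := .waiting)
          (b := single ((hand .leader).port (E + 3)) .reply) (by simp) (by simp)]
        simp [leaderDecide, ht])
    (by simp)
    (by rw [← add_assoc, Handedness.dir_add_three, hE]; simpa using hv)
    (not_occupied_duo (hfree _) (hfree _) (hfree _) (hfree _) (fun j _ _ => hfree j))
  rw [update_duo_leader] at e3
  simp only [duo_leader] at e3
  -- the leader contracts
  have e4 := next_contract (hand := hand) (X := duo (task := task) pos N
      ⟨v, pos .leader, .inl (f, x, .moving), noMsg⟩
      ⟨pos N, pos N, .inr (.following ((hand N).port E) false), noMsg⟩)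
    (i := .leader) (s := .inl (f, x, .done))
    (w _ (.inr rfl))
    (by rw [decision_of_leader (f := f) (x := x) (ph := .moving) (b := noMsg) (by simp) (by simp)]
        simp [leaderDecide, ht])
  rw [update_duo_leader] at e4
  simp only [duo_leader] at e4
  -- the leader now waits for a message, whatever the neighbour does
  have w' : ∀ n : Particle (taskAlg task), ∀ k ≠ N, Passive hand (duo (task := task) pos N
      ⟨v, v, .inl (f, x, .done), noMsg⟩ n) k := fun n =>
    duo_passive_self (passive_pull_done ht (by simp; rfl) (by simp))
  -- the neighbour sees that the old vertex of the leader is empty, and expands into it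
  have e5 := next_expand (hand := hand) (X := duo (task := task) pos N
      ⟨v, v, .inl (f, x, .done), noMsg⟩
      ⟨pos N, pos N, .inr (.following ((hand N).port E) false), noMsg⟩)
    (i := N) (s := .inr (.pulling ((hand N).port E) false)) (p := (hand N).port E)
    (v := pos .leader)
    (w' _)
    (by
      rw [decision_of_marker (s := .following ((hand N).port E) false) (b := noMsg)
        (by simp [duo_self hN]) (by simp [duo_self hN])]
      have : (lookAt (duo (task := task) pos N
          ⟨v, v, .inl (f, x, .done), noMsg⟩
          ⟨pos N, pos N, .inr (.following ((hand N).port E) false), noMsg⟩)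
          (pos N + unitVec E)).free = true :=
        free_lookAt.2 (hE' ▸ not_occupied_duo (hfree _).symm (hfree _).symm (hLe _ hN) (hLe _ hN)
          (fun j h _ => hLe j h))
      simp [markerDecide, duo_self hN, Handedness.dir_port, this])
    (by simp [duo_self hN])
    (by simpa [duo_self hN, Handedness.dir_port] using hE')
    (not_occupied_duo (hfree _).symm (hfree _).symm (hLe _ hN) (hLe _ hN) (fun j h _ => hLe j h))
  rw [update_duo_self hN] at e5
  simp only [duo_self hN] at e5
  -- the neighbour contracts and reports this
  have e6 := next_send (hand := hand) (X := duo (task := task) pos N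
      ⟨v, v, .inl (f, x, .done), noMsg⟩
      ⟨pos .leader, pos N, .inr (.pulling ((hand N).port E) false), noMsg⟩)
    (i := N) (s := .inr .idle) (q := (hand N).port E)
    (m := .reply) (mv := .contract) (k := .leader) (t := pos .leader)
    (w' _)
    (by rw [decision_of_marker (s := .pulling ((hand N).port E) false) (b := noMsg)
          (by simp [duo_self hN]) (by simp [duo_self hN])]
        simp [markerDecide])
    (by simp [duo_self hN]) hN.symm (Handedness.dir_port _ _)
    (by simpa [duo_self hN] using hv)
    (fun k h1 h2 => by
      rw [duo_other h2 h1, duo_leader]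
      exact hfree k)
  rw [update_duo_self hN, update_duo_leader] at e6
  simp only [duo_leader, duo_self hN] at e6
  -- the leader receives the report
  have e7 := next_stay (hand := hand) (X := duo (task := task) pos N
      ⟨v, v, .inl (f, x, .done), single ((hand .leader).port (E + 3)) .reply⟩
      ⟨pos .leader, pos .leader, .inr .idle, noMsg⟩)
    (i := .leader) (s := .inl (f, y, .start))
    (duo_passive_leader hN (passive_idle (by simp [duo_self hN]) (by simp [duo_self hN])))
    (by rw [decision_of_leader (f := f) (x := x) (ph := .done)
          (b := single ((hand .leader).port (E + 3)) .reply) (by simp) (by simp)]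
        simp [leaderDecide, ht, stayIn])
  rw [update_duo_leader] at e7
  simp only [duo_leader] at e7
  rw [duo_eq_rest hN] at e7
  rw [rest_eq_duo hN]
  refine .head ⟨e1, guard_duo hN ?_ rfl⟩ (.head ⟨e2, guard_duo hN ?_ rfl⟩
    (.head ⟨e3, guard_duo hN ?_ rfl⟩ (.head ⟨e4, guard_duo hN ?_ rfl⟩
    (.head ⟨e5, guard_duo hN ?_ rfl⟩ (.head ⟨e6, guard_duo hN ?_ rfl⟩
    (.single ⟨e7, guard_duo hN ?_ rfl⟩))))))
  · simpa using hΦ₀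
  · simpa using hΦ₀
  · simpa using hΦ₀
  · simpa [hu _ (Function.update_of_ne hN _ _)] using hΦ₁
  · simpa [hu _ (Function.update_of_ne hN _ _)] using hΦ₂
  · simpa [hu _ (Function.update_of_ne hN _ _)] using hΦ₃
  · simpa using hΦ₄

end

end Tasks

end Amoebot

namespace Amoebot

/-! ### Tasks that involve the pivot -/

/-- The function with the given values at `P`, `M₂`, `L` and `M₁`. -/
def quad {α : Type} (a b l c : α) : Role → α
  | .pivot => a
  | .marker2 => b
  | .leader => l
  | .marker1 => c

section quad

variable {α : Type} {a b l c x : α}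

@[simp] theorem quad_pivot : quad a b l c .pivot = a := rfl

@[simp] theorem quad_marker2 : quad a b l c .marker2 = b := rfl

@[simp] theorem quad_leader : quad a b l c .leader = l := rfl

@[simp] theorem quad_marker1 : quad a b l c .marker1 = c := rfl

@[simp] theorem update_quad_pivot :
    Function.update (quad a b l c) .pivot x = quad x b l c := by
  funext j; cases j <;> rfl

@[simp] theorem update_quad_marker2 :
    Function.update (quad a b l c) .marker2 x = quad a x l c := by
  funext j; cases j <;> rfl

@[simp] theorem update_quad_leader :
    Function.update (quad a b l c) .leader x = quad a b x c := by
  funext j; cases j <;> rfl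

@[simp] theorem update_quad_marker1 :
    Function.update (quad a b l c) .marker1 x = quad a b l x := by
  funext j; cases j <;> rfl

theorem forall_quad {P : α → Prop} : (∀ i, P (quad a b l c i)) ↔ P a ∧ P b ∧ P l ∧ P c :=
  ⟨fun h => ⟨h .pivot, h .marker2, h .leader, h .marker1⟩,
    fun ⟨h1, h2, h3, h4⟩ i => by cases i <;> assumption⟩

theorem exists_quad {P : α → Prop} : (∃ i, P (quad a b l c i)) ↔ P a ∨ P b ∨ P l ∨ P c :=
  ⟨fun ⟨i, hi⟩ => by
    cases i
    exacts [.inl hi, .inr (.inl hi), .inr (.inr (.inl hi)), .inr (.inr (.inr hi))],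
    by
      rintro (h | h | h | h)
      exacts [⟨.pivot, h⟩, ⟨.marker2, h⟩, ⟨.leader, h⟩, ⟨.marker1, h⟩]⟩

theorem quad_injective (h1 : a ≠ b) (h2 : a ≠ l) (h3 : a ≠ c) (h4 : b ≠ l) (h5 : b ≠ c)
    (h6 : l ≠ c) : Function.Injective (quad a b l c) := by
  intro i j h
  cases i <;> cases j <;> simp_all [quad]

end quad

section Tasks

variable {μ : Type} [Finite μ] {task : μ → Task μ} {hand : Role → Handedness}
  {Φ : (Role → Grid) → (Role → Grid) → Prop} {f : ZMod 6} {x y z : μ}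

theorem occupied_quad {A B L M : Particle (taskAlg task)} {v : Grid} :
    Occupied (quad A B L M) v ↔ (A.head = v ∨ A.tail = v) ∨ (B.head = v ∨ B.tail = v) ∨
      (L.head = v ∨ L.tail = v) ∨ (M.head = v ∨ M.tail = v) :=
  exists_quad (P := fun X : Particle (taskAlg task) => X.head = v ∨ X.tail = v)

theorem rest_quad {a b l c : Grid} : rest task f (quad a b l c) x =
    quad ⟨a, a, .inr .idle, noMsg⟩ ⟨b, b, .inr .idle, noMsg⟩
      ⟨l, l, .inl (f, x, .start), noMsg⟩ ⟨c, c, .inr .idle, noMsg⟩ := by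
  funext j; cases j <;> rfl

theorem guard_quad {A B L M : Particle (taskAlg task)}
    (h : Φ (quad A.head B.head L.head M.head) (quad A.tail B.tail L.tail M.tail))
    {ph : LeaderPhase} (hl : L.state = .inl (f, x, ph)) : Guard Φ x (quad A B L M) := by
  refine ⟨?_, f, ph, hl⟩
  convert h using 1 <;>
  · funext j; cases j <;> rfl

theorem passive_quad {A B L M : Particle (taskAlg task)} {i : Role}
    (h1 : i ≠ .pivot → Passive hand (quad A B L M) .pivot)
    (h2 : i ≠ .marker2 → Passive hand (quad A B L M) .marker2)
    (h3 : i ≠ .leader → Passive hand (quad A B L M) .leader)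
    (h4 : i ≠ .marker1 → Passive hand (quad A B L M) .marker1) :
    ∀ j ≠ i, Passive hand (quad A B L M) j := by
  intro j hj
  cases j
  exacts [h1 hj.symm, h2 hj.symm, h3 hj.symm, h4 hj.symm]

variable {p j E : ZMod 6} {a b l c a' b' v : Grid}

/-- The pivot and `M₂`, next to each other and to the leader, move in the same direction on
demand, the pivot first. -/
theorem adv_send_shiftBoth (ht : task x = .send p (.shiftBoth j) y z)
    (hE : (hand .leader).dir (f + p) + 3 = E)
    (hlb : l = b + unitVec E) (hba : b = a + unitVec E)
    (hbl : b ≠ l) (hal : a ≠ l) (hac : a ≠ c) (hbc : b ≠ c)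
    (ha' : a' = a + unitVec (E + (hand .pivot).sign * j))
    (hb' : b' = b + unitVec (E + (hand .marker2).sign * j))
    (h1 : a' ≠ b) (h2 : a' ≠ l) (h3 : a' ≠ c)
    (h4 : b' ≠ a') (h5 : b' ≠ l) (h6 : b' ≠ c)
    (hΦ₀ : Φ (quad a b l c) (quad a b l c)) (hΦ₁ : Φ (quad a' b l c) (quad a b l c))
    (hΦ₂ : Φ (quad a' b l c) (quad a' b l c)) (hΦ₃ : Φ (quad a' b' l c) (quad a' b l c))
    (hΦ₄ : Φ (quad a' b' l c) (quad a' b' l c)) :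
    Adv hand Φ x (rest task f (quad a b l c) x) (rest task f (quad a' b' l c) z) := by
  have hEE : E + 3 + 3 = E := by rw [add_assoc, show (3 : ZMod 6) + 3 = 0 by decide, add_zero]
  have hD : (hand .leader).dir (f + p) = E + 3 := by
    rw [← hE, add_assoc, show (3 : ZMod 6) + 3 = 0 by decide, add_zero]
  have hbl' : b = l + unitVec (E + 3) := by rw [unitVec_add_three, hlb]; simp
  have hab' : a = b + unitVec (E + 3) := by rw [unitVec_add_three, hba]; simp
  have haa : a' ≠ a := by rw [ha']; simpa using unitVec_ne_zero _
  have hbb : b' ≠ b := by rw [hb']; simpa using unitVec_ne_zero _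
  have hab : a ≠ b := by rw [hba]; simpa using (unitVec_ne_zero E)
  have pM : ∀ A B L : Particle (taskAlg task),
      Passive hand (quad (α := Particle (taskAlg task))
        A B L ⟨c, c, .inr .idle, noMsg⟩) .marker1 :=
    fun A B L => passive_idle rfl rfl
  have pP : ∀ (B L M : Particle (taskAlg task)) u,
      Passive hand (quad (α := Particle (taskAlg task))
        ⟨u, u, .inr .idle, noMsg⟩ B L M) .pivot :=
    fun B L M u => passive_idle rfl rfl
  have pB : ∀ (A L M : Particle (taskAlg task)) u,
      Passive hand (quad (α := Particle (taskAlg task))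
        A ⟨u, u, .inr .idle, noMsg⟩ L M) .marker2 :=
    fun A L M u => passive_idle rfl rfl
  have pL : ∀ A B M : Particle (taskAlg task), B.head = b ∨ B.tail = b →
      Passive hand (quad (α := Particle (taskAlg task))
        A B ⟨l, l, .inl (f, x, .waiting), noMsg⟩ M) .leader := by
    intro A B M h
    refine passive_send ht rfl rfl ?_
    change Occupied _ (l + unitVec _)
    rw [hD, ← hbl', occupied_quad]
    exact .inr (.inl h)
  have pW : ∀ A L M : Particle (taskAlg task), A.head = a ∨ A.tail = a →
      Passive hand (quad (α := Particle (taskAlg task))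
        A ⟨b, b, .inr (.waitShift ((hand .marker2).port E) j), noMsg⟩ L M)
        .marker2 := by
    intro A L M h
    refine passive_waitShift rfl rfl ?_
    change Occupied _ (b + unitVec _)
    rw [Handedness.dir_add_three, Handedness.dir_port, ← hab', occupied_quad]
    exact .inl h
  -- the leader sends the request to `M₂`
  have e1 := next_send (hand := hand) (X := quad (α := Particle (taskAlg task))
      ⟨a, a, .inr .idle, noMsg⟩ ⟨b, b, .inr .idle, noMsg⟩
      ⟨l, l, .inl (f, x, .start), noMsg⟩ ⟨c, c, .inr .idle, noMsg⟩)
    (i := .leader) (s := .inl (f, x, .waiting)) (q := f + p) (m := .shiftBoth j) (mv := .stay)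
    (k := .marker2) (t := l)
    (passive_quad (fun _ => pP _ _ _ _) (fun _ => pB _ _ _ _) (fun h => (h rfl).elim)
      (fun _ => pM _ _ _))
    (by rw [decision_of_leader (f := f) (x := x) (ph := .start) (b := noMsg) rfl rfl]
        simp [leaderDecide, ht])
    (.inl ⟨rfl, rfl⟩) (by decide) hD hbl'
    (by
      intro k hk hk'
      cases k <;>
        first | exact absurd rfl hk | exact absurd rfl hk' | exact hab | exact hbc.symm)
  rw [update_quad_leader, update_quad_marker2, hEE] at e1
  -- `M₂` passes the request on to the pivot
  have e2 := next_send (hand := hand) (X := quad (α := Particle (taskAlg task))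
      ⟨a, a, .inr .idle, noMsg⟩
      ⟨b, b, .inr .idle, single ((hand .marker2).port E) (.shiftBoth j)⟩
      ⟨l, l, .inl (f, x, .waiting), noMsg⟩ ⟨c, c, .inr .idle, noMsg⟩)
    (i := .marker2) (s := .inr (.waitShift ((hand .marker2).port E) j))
    (q := (hand .marker2).port E + 3) (D := E + 3) (m := .shift j) (mv := .stay)
    (k := .pivot) (t := b)
    (passive_quad (fun _ => pP _ _ _ _) (fun h => (h rfl).elim) (fun _ => pL _ _ _ (.inl rfl))
      (fun _ => pM _ _ _))
    (by rw [decision_of_marker (s := .idle)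
          (b := single ((hand .marker2).port E) (.shiftBoth j)) rfl rfl]
        simp [markerDecide])
    (.inl ⟨rfl, rfl⟩) (by decide) (by rw [Handedness.dir_add_three, Handedness.dir_port]) hab'
    (by
      intro k hk hk'
      cases k <;>
        first | exact absurd rfl hk | exact absurd rfl hk' | exact hal.symm | exact hac.symm)
  rw [update_quad_marker2, update_quad_pivot, hEE] at e2
  have o3 : ∀ L M : Particle (taskAlg task), L.head = l → L.tail = l → M.head = c → M.tail = c →
      ∀ B : Particle (taskAlg task), B.head = b → B.tail = b →
      ∀ A : Particle (taskAlg task), A.head = a → A.tail = a → ¬ Occupied (quad A B L M) a' := by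
    intro L M hL1 hL2 hM1 hM2 B hB1 hB2 A hA1 hA2
    rw [occupied_quad, hL1, hL2, hM1, hM2, hB1, hB2, hA1, hA2]
    simp [h1.symm, h2.symm, h3.symm, haa.symm]
  -- the pivot expands
  have e3 := next_expand (hand := hand) (X := quad (α := Particle (taskAlg task))
      ⟨a, a, .inr .idle, single ((hand .pivot).port E) (.shift j)⟩
      ⟨b, b, .inr (.waitShift ((hand .marker2).port E) j), noMsg⟩
      ⟨l, l, .inl (f, x, .waiting), noMsg⟩ ⟨c, c, .inr .idle, noMsg⟩)
    (i := .pivot) (s := .inr .contracting) (p := (hand .pivot).port E + j) (v := a')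
    (passive_quad (fun h => (h rfl).elim) (fun _ => pW _ _ _ (.inl rfl))
      (fun _ => pL _ _ _ (.inl rfl)) (fun _ => pM _ _ _))
    (by
      rw [decision_of_marker (s := .idle) (b := single ((hand .pivot).port E) (.shift j)) rfl rfl]
      have : (lookAt (quad (α := Particle (taskAlg task))
          ⟨a, a, .inr .idle, single ((hand .pivot).port E) (.shift j)⟩
          ⟨b, b, .inr (.waitShift ((hand .marker2).port E) j), noMsg⟩
          ⟨l, l, .inl (f, x, .waiting), noMsg⟩ ⟨c, c, .inr .idle, noMsg⟩)
          (a + unitVec (E + (hand .pivot).sign * j))).free = true :=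
        free_lookAt.2 (ha' ▸ o3 _ _ rfl rfl rfl rfl _ rfl rfl _ rfl rfl)
      simp [markerDecide, Handedness.dir_add, Handedness.dir_port, this])
    rfl (by rw [Handedness.dir_add, Handedness.dir_port]; exact ha')
    (o3 _ _ rfl rfl rfl rfl _ rfl rfl _ rfl rfl)
  rw [update_quad_pivot] at e3
  -- the pivot contracts
  have e4 := next_contract (hand := hand) (X := quad (α := Particle (taskAlg task))
      ⟨a', a, .inr .contracting, noMsg⟩
      ⟨b, b, .inr (.waitShift ((hand .marker2).port E) j), noMsg⟩
      ⟨l, l, .inl (f, x, .waiting), noMsg⟩ ⟨c, c, .inr .idle, noMsg⟩)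
    (i := .pivot) (s := .inr .idle)
    (passive_quad (fun h => (h rfl).elim) (fun _ => pW _ _ _ (.inr rfl))
      (fun _ => pL _ _ _ (.inl rfl)) (fun _ => pM _ _ _))
    (by rw [decision_of_marker (s := .contracting) (b := noMsg) rfl rfl]
        simp [markerDecide])
  rw [update_quad_pivot] at e4
  have o5 : ¬ Occupied (quad (α := Particle (taskAlg task))
      ⟨a', a', .inr .idle, noMsg⟩
      ⟨b, b, .inr (.waitShift ((hand .marker2).port E) j), noMsg⟩
      ⟨l, l, .inl (f, x, .waiting), noMsg⟩ ⟨c, c, .inr .idle, noMsg⟩) b' := by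
    rw [occupied_quad]; simp [h4.symm, hbb.symm, h5.symm, h6.symm]
  -- `M₂` sees that the vertex of the pivot is empty, and expands
  have e5 := next_expand (hand := hand) (X := quad (α := Particle (taskAlg task))
      ⟨a', a', .inr .idle, noMsg⟩
      ⟨b, b, .inr (.waitShift ((hand .marker2).port E) j), noMsg⟩
      ⟨l, l, .inl (f, x, .waiting), noMsg⟩ ⟨c, c, .inr .idle, noMsg⟩)
    (i := .marker2) (s := .inr .contracting) (p := (hand .marker2).port E + j) (v := b')
    (passive_quad (fun _ => pP _ _ _ _) (fun h => (h rfl).elim)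
      (fun _ => pL _ _ _ (.inl rfl)) (fun _ => pM _ _ _))
    (by
      rw [decision_of_marker (s := .waitShift ((hand .marker2).port E) j) (b := noMsg) rfl rfl]
      have : (lookAt (quad (α := Particle (taskAlg task))
          ⟨a', a', .inr .idle, noMsg⟩
          ⟨b, b, .inr (.waitShift ((hand .marker2).port E) j), noMsg⟩
          ⟨l, l, .inl (f, x, .waiting), noMsg⟩ ⟨c, c, .inr .idle, noMsg⟩)
          (b + unitVec (E + 3))).free = true := by
        rw [free_lookAt, ← hab', occupied_quad]
        simp [haa, hab.symm, hal.symm, hac.symm]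
      simp [markerDecide, Handedness.dir_add_three, Handedness.dir_port, this])
    rfl (by rw [Handedness.dir_add, Handedness.dir_port]; exact hb') o5
  rw [update_quad_marker2] at e5
  -- `M₂` contracts
  have e6 := next_contract (hand := hand) (X := quad (α := Particle (taskAlg task))
      ⟨a', a', .inr .idle, noMsg⟩ ⟨b', b, .inr .contracting, noMsg⟩
      ⟨l, l, .inl (f, x, .waiting), noMsg⟩ ⟨c, c, .inr .idle, noMsg⟩)
    (i := .marker2) (s := .inr .idle)
    (passive_quad (fun _ => pP _ _ _ _) (fun h => (h rfl).elim)
      (fun _ => pL _ _ _ (.inr rfl)) (fun _ => pM _ _ _))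
    (by rw [decision_of_marker (s := .contracting) (b := noMsg) rfl rfl]
        simp [markerDecide])
  rw [update_quad_marker2] at e6
  -- the leader sees that the vertex of `M₂` is empty
  have e7 := next_stay (hand := hand) (X := quad (α := Particle (taskAlg task))
      ⟨a', a', .inr .idle, noMsg⟩ ⟨b', b', .inr .idle, noMsg⟩
      ⟨l, l, .inl (f, x, .waiting), noMsg⟩ ⟨c, c, .inr .idle, noMsg⟩)
    (i := .leader) (s := .inl (f, z, .start))
    (passive_quad (fun _ => pP _ _ _ _) (fun _ => pB _ _ _ _) (fun h => (h rfl).elim)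
      (fun _ => pM _ _ _))
    (by
      rw [decision_of_leader (f := f) (x := x) (ph := .waiting) (b := noMsg) rfl rfl]
      have : (lookAt (quad (α := Particle (taskAlg task))
          ⟨a', a', .inr .idle, noMsg⟩ ⟨b', b', .inr .idle, noMsg⟩
          ⟨l, l, .inl (f, x, .waiting), noMsg⟩ ⟨c, c, .inr .idle, noMsg⟩)
          (l + unitVec (E + 3))).free = true := by
        rw [free_lookAt, ← hbl', occupied_quad]
        simp [h1, hbb, hbl.symm, hbc.symm]
      simp [leaderDecide, ht, stayIn, hD, this])
  rw [update_quad_leader] at e7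
  rw [rest_quad, rest_quad]
  exact .head ⟨e1, guard_quad hΦ₀ rfl⟩ (.head ⟨e2, guard_quad hΦ₀ rfl⟩
    (.head ⟨e3, guard_quad hΦ₀ rfl⟩ (.head ⟨e4, guard_quad hΦ₁ rfl⟩
    (.head ⟨e5, guard_quad hΦ₂ rfl⟩ (.head ⟨e6, guard_quad hΦ₃ rfl⟩
    (.single ⟨e7, guard_quad hΦ₄ rfl⟩))))))

/-- The pivot and `M₂`, next to each other and to the leader, follow the leader by one step. -/
theorem adv_pullBoth (ht : task x = .pull p .followBoth y)
    (hE : (hand .leader).dir (f + p) + 3 = E)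
    (hvl : v = l + unitVec E) (hlb : l = b + unitVec E) (hba : b = a + unitVec E)
    (hva : v ≠ a) (hvb : v ≠ b) (hvc : v ≠ c)
    (hal : a ≠ l) (hac : a ≠ c) (hbc : b ≠ c) (hlc : l ≠ c)
    (hΦ₀ : Φ (quad a b l c) (quad a b l c)) (hΦ₁ : Φ (quad a b v c) (quad a b l c))
    (hΦ₂ : Φ (quad a b v c) (quad a b v c)) (hΦ₃ : Φ (quad a l v c) (quad a b v c))
    (hΦ₄ : Φ (quad a l v c) (quad a l v c)) (hΦ₅ : Φ (quad b l v c) (quad a l v c))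
    (hΦ₆ : Φ (quad b l v c) (quad b l v c)) :
    Adv hand Φ x (rest task f (quad a b l c) x) (rest task f (quad b l v c) y) := by
  have hEE : E + 3 + 3 = E := by rw [add_assoc, show (3 : ZMod 6) + 3 = 0 by decide, add_zero]
  have hD : (hand .leader).dir (f + p) = E + 3 := by
    rw [← hE, add_assoc, show (3 : ZMod 6) + 3 = 0 by decide, add_zero]
  have hbl' : b = l + unitVec (E + 3) := by rw [unitVec_add_three, hlb]; simp
  have hab' : a = b + unitVec (E + 3) := by rw [unitVec_add_three, hba]; simp
  have hab : a ≠ b := by rw [hba]; simpa using (unitVec_ne_zero E)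
  have hbl : b ≠ l := by rw [hlb]; simpa using (unitVec_ne_zero E)
  have hvl' : v ≠ l := by rw [hvl]; simpa using (unitVec_ne_zero E)
  have pM : ∀ A B L : Particle (taskAlg task),
      Passive hand (quad (α := Particle (taskAlg task))
        A B L ⟨c, c, .inr .idle, noMsg⟩) .marker1 :=
    fun A B L => passive_idle rfl rfl
  have pP : ∀ (B L M : Particle (taskAlg task)) u,
      Passive hand (quad (α := Particle (taskAlg task))
        ⟨u, u, .inr .idle, noMsg⟩ B L M) .pivot :=
    fun B L M u => passive_idle rfl rfl
  have pB : ∀ (A L M : Particle (taskAlg task)) u,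
      Passive hand (quad (α := Particle (taskAlg task))
        A ⟨u, u, .inr .idle, noMsg⟩ L M) .marker2 :=
    fun A L M u => passive_idle rfl rfl
  have pL : ∀ (A B M : Particle (taskAlg task)) (u : Grid),
      Passive hand (quad (α := Particle (taskAlg task))
        A B ⟨u, u, .inl (f, x, .waiting), noMsg⟩ M) .leader :=
    fun A B M u => passive_pull_waiting ht rfl rfl
  have pD : ∀ (A B M : Particle (taskAlg task)) (u : Grid),
      Passive hand (quad (α := Particle (taskAlg task))
        A B ⟨u, u, .inl (f, x, .done), noMsg⟩ M) .leader :=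
    fun A B M u => passive_pull_done ht rfl rfl
  have pW : ∀ (A L M : Particle (taskAlg task)) (u : Grid),
      Passive hand (quad (α := Particle (taskAlg task))
        A ⟨u, u, .inr (.waitReply ((hand .marker2).port E)), noMsg⟩ L M)
        .marker2 := fun A L M u => passive_waitReply rfl rfl
  have pW' : ∀ (A L M : Particle (taskAlg task)) (u : Grid),
      Passive hand (quad (α := Particle (taskAlg task))
        A ⟨u, u, .inr (.waitDone ((hand .marker2).port E)), noMsg⟩ L M)
        .marker2 := fun A L M u => passive_waitDone rfl rfl
  have pF : ∀ (A L M : Particle (taskAlg task)), L.head = l ∨ L.tail = l →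
      Passive hand (quad (α := Particle (taskAlg task))
        A ⟨b, b, .inr (.following ((hand .marker2).port E) true), noMsg⟩ L M)
        .marker2 := by
    intro A L M h
    refine passive_following rfl rfl ?_
    change Occupied _ (b + unitVec _)
    rw [Handedness.dir_port, ← hlb, occupied_quad]
    exact .inr (.inr (.inl h))
  have pF' : ∀ (B L M : Particle (taskAlg task)), B.head = b ∨ B.tail = b →
      Passive hand (quad (α := Particle (taskAlg task))
        ⟨a, a, .inr (.following ((hand .pivot).port E) false), noMsg⟩ B L M)
        .pivot := by
    intro B L M h
    refine passive_following rfl rfl ?_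
    change Occupied _ (a + unitVec _)
    rw [Handedness.dir_port, ← hba, occupied_quad]
    exact .inr (.inl h)
  -- the leader sends the request to `M₂`
  have e1 := next_send (hand := hand) (X := quad (α := Particle (taskAlg task))
      ⟨a, a, .inr .idle, noMsg⟩ ⟨b, b, .inr .idle, noMsg⟩
      ⟨l, l, .inl (f, x, .start), noMsg⟩ ⟨c, c, .inr .idle, noMsg⟩)
    (i := .leader) (s := .inl (f, x, .waiting)) (q := f + p) (m := .followBoth) (mv := .stay)
    (k := .marker2) (t := l)
    (passive_quad (fun _ => pP _ _ _ _) (fun _ => pB _ _ _ _) (fun h => (h rfl).elim)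
      (fun _ => pM _ _ _))
    (by rw [decision_of_leader (f := f) (x := x) (ph := .start) (b := noMsg) rfl rfl]
        simp [leaderDecide, ht])
    (.inl ⟨rfl, rfl⟩) (by decide) hD hbl'
    (by
      intro k hk hk'
      cases k <;>
        first | exact absurd rfl hk | exact absurd rfl hk' | exact hab | exact hbc.symm)
  rw [update_quad_leader, update_quad_marker2, hEE] at e1
  -- `M₂` passes the request on to the pivot
  have e2 := next_send (hand := hand) (X := quad (α := Particle (taskAlg task))
      ⟨a, a, .inr .idle, noMsg⟩
      ⟨b, b, .inr .idle, single ((hand .marker2).port E) .followBoth⟩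
      ⟨l, l, .inl (f, x, .waiting), noMsg⟩ ⟨c, c, .inr .idle, noMsg⟩)
    (i := .marker2) (s := .inr (.waitReply ((hand .marker2).port E)))
    (q := (hand .marker2).port E + 3) (D := E + 3) (m := .follow) (mv := .stay)
    (k := .pivot) (t := b)
    (passive_quad (fun _ => pP _ _ _ _) (fun h => (h rfl).elim) (fun _ => pL _ _ _ _)
      (fun _ => pM _ _ _))
    (by rw [decision_of_marker (s := .idle)
          (b := single ((hand .marker2).port E) .followBoth) rfl rfl]
        simp [markerDecide])
    (.inl ⟨rfl, rfl⟩) (by decide) (by rw [Handedness.dir_add_three, Handedness.dir_port]) hab'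
    (by
      intro k hk hk'
      cases k <;>
        first | exact absurd rfl hk | exact absurd rfl hk' | exact hal.symm | exact hac.symm)
  rw [update_quad_marker2, update_quad_pivot, hEE] at e2
  -- the pivot confirms
  have e3 := next_send (hand := hand) (X := quad (α := Particle (taskAlg task))
      ⟨a, a, .inr .idle, single ((hand .pivot).port E) .follow⟩
      ⟨b, b, .inr (.waitReply ((hand .marker2).port E)), noMsg⟩
      ⟨l, l, .inl (f, x, .waiting), noMsg⟩ ⟨c, c, .inr .idle, noMsg⟩)
    (i := .pivot) (s := .inr (.following ((hand .pivot).port E) false))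
    (q := (hand .pivot).port E) (D := E) (m := .reply) (mv := .stay)
    (k := .marker2) (t := a)
    (passive_quad (fun h => (h rfl).elim) (fun _ => pW _ _ _ _) (fun _ => pL _ _ _ _)
      (fun _ => pM _ _ _))
    (by rw [decision_of_marker (s := .idle)
          (b := single ((hand .pivot).port E) .follow) rfl rfl]
        simp [markerDecide])
    (.inl ⟨rfl, rfl⟩) (by decide) (Handedness.dir_port _ _) hba
    (by
      intro k hk hk'
      cases k <;>
        first | exact absurd rfl hk | exact absurd rfl hk' | exact hbl.symm | exact hbc.symm)
  rw [update_quad_pivot, update_quad_marker2] at e3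
  -- `M₂` confirms
  have e4 := next_send (hand := hand) (X := quad (α := Particle (taskAlg task))
      ⟨a, a, .inr (.following ((hand .pivot).port E) false), noMsg⟩
      ⟨b, b, .inr (.waitReply ((hand .marker2).port E)),
        single ((hand .marker2).port (E + 3)) .reply⟩
      ⟨l, l, .inl (f, x, .waiting), noMsg⟩ ⟨c, c, .inr .idle, noMsg⟩)
    (i := .marker2) (s := .inr (.following ((hand .marker2).port E) true))
    (q := (hand .marker2).port E) (D := E) (m := .reply) (mv := .stay)
    (k := .leader) (t := b)
    (passive_quad (fun _ => pF' _ _ _ (.inl rfl)) (fun h => (h rfl).elim) (fun _ => pL _ _ _ _)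
      (fun _ => pM _ _ _))
    (by rw [decision_of_marker (s := .waitReply ((hand .marker2).port E))
          (b := single ((hand .marker2).port (E + 3)) .reply) rfl rfl]
        simp [markerDecide])
    (.inl ⟨rfl, rfl⟩) (by decide) (Handedness.dir_port _ _) hlb
    (by
      intro k hk hk'
      cases k <;>
        first | exact absurd rfl hk | exact absurd rfl hk' | exact hal | exact hlc.symm)
  rw [update_quad_marker2, update_quad_leader] at e4
  -- the leader expands forward
  have e5 := next_expand (hand := hand) (X := quad (α := Particle (taskAlg task))
      ⟨a, a, .inr (.following ((hand .pivot).port E) false), noMsg⟩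
      ⟨b, b, .inr (.following ((hand .marker2).port E) true), noMsg⟩
      ⟨l, l, .inl (f, x, .waiting), single ((hand .leader).port (E + 3)) .reply⟩
      ⟨c, c, .inr .idle, noMsg⟩)
    (i := .leader) (s := .inl (f, x, .moving)) (p := f + (p + 3)) (v := v)
    (passive_quad (fun _ => pF' _ _ _ (.inl rfl)) (fun _ => pF _ _ _ (.inl rfl))
      (fun h => (h rfl).elim) (fun _ => pM _ _ _))
    (by rw [decision_of_leader (f := f) (x := x) (ph := .waiting)
          (b := single ((hand .leader).port (E + 3)) .reply) rfl rfl]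
        simp [leaderDecide, ht])
    rfl (by rw [← add_assoc, Handedness.dir_add_three, hE]; exact hvl)
    (by rw [occupied_quad]; simp [hva.symm, hvb.symm, hvc.symm, hvl'.symm])
  rw [update_quad_leader] at e5
  -- the leader contracts
  have e6 := next_contract (hand := hand) (X := quad (α := Particle (taskAlg task))
      ⟨a, a, .inr (.following ((hand .pivot).port E) false), noMsg⟩
      ⟨b, b, .inr (.following ((hand .marker2).port E) true), noMsg⟩
      ⟨v, l, .inl (f, x, .moving), noMsg⟩ ⟨c, c, .inr .idle, noMsg⟩)
    (i := .leader) (s := .inl (f, x, .done))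
    (passive_quad (fun _ => pF' _ _ _ (.inl rfl)) (fun _ => pF _ _ _ (.inr rfl))
      (fun h => (h rfl).elim) (fun _ => pM _ _ _))
    (by rw [decision_of_leader (f := f) (x := x) (ph := .moving) (b := noMsg) rfl rfl]
        simp [leaderDecide, ht])
  rw [update_quad_leader] at e6
  have o7 : ¬ Occupied (quad (α := Particle (taskAlg task))
      ⟨a, a, .inr (.following ((hand .pivot).port E) false), noMsg⟩
      ⟨b, b, .inr (.following ((hand .marker2).port E) true), noMsg⟩
      ⟨v, v, .inl (f, x, .done), noMsg⟩ ⟨c, c, .inr .idle, noMsg⟩) l := by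
    rw [occupied_quad]; simp [hal, hbl, hlc.symm, hvl']
  -- `M₂` expands into the old vertex of the leader
  have e7 := next_expand (hand := hand) (X := quad (α := Particle (taskAlg task))
      ⟨a, a, .inr (.following ((hand .pivot).port E) false), noMsg⟩
      ⟨b, b, .inr (.following ((hand .marker2).port E) true), noMsg⟩
      ⟨v, v, .inl (f, x, .done), noMsg⟩ ⟨c, c, .inr .idle, noMsg⟩)
    (i := .marker2) (s := .inr (.pulling ((hand .marker2).port E) true))
    (p := (hand .marker2).port E) (v := l)
    (passive_quad (fun _ => pF' _ _ _ (.inl rfl)) (fun h => (h rfl).elim)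
      (fun _ => pD _ _ _ _) (fun _ => pM _ _ _))
    (by
      rw [decision_of_marker (s := .following ((hand .marker2).port E) true) (b := noMsg) rfl rfl]
      have : (lookAt (quad (α := Particle (taskAlg task))
          ⟨a, a, .inr (.following ((hand .pivot).port E) false), noMsg⟩
          ⟨b, b, .inr (.following ((hand .marker2).port E) true), noMsg⟩
          ⟨v, v, .inl (f, x, .done), noMsg⟩ ⟨c, c, .inr .idle, noMsg⟩)
          (b + unitVec E)).free = true := by
        rw [free_lookAt, ← hlb]; exact o7
      simp [markerDecide, Handedness.dir_port, this])
    rfl (by rw [Handedness.dir_port]; exact hlb) o7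
  rw [update_quad_marker2] at e7
  -- `M₂` contracts
  have e8 := next_contract (hand := hand) (X := quad (α := Particle (taskAlg task))
      ⟨a, a, .inr (.following ((hand .pivot).port E) false), noMsg⟩
      ⟨l, b, .inr (.pulling ((hand .marker2).port E) true), noMsg⟩
      ⟨v, v, .inl (f, x, .done), noMsg⟩ ⟨c, c, .inr .idle, noMsg⟩)
    (i := .marker2) (s := .inr (.waitDone ((hand .marker2).port E)))
    (passive_quad (fun _ => pF' _ _ _ (.inr rfl)) (fun h => (h rfl).elim)
      (fun _ => pD _ _ _ _) (fun _ => pM _ _ _))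
    (by rw [decision_of_marker (s := .pulling ((hand .marker2).port E) true) (b := noMsg) rfl rfl]
        simp [markerDecide])
  rw [update_quad_marker2] at e8
  have o9 : ¬ Occupied (quad (α := Particle (taskAlg task))
      ⟨a, a, .inr (.following ((hand .pivot).port E) false), noMsg⟩
      ⟨l, l, .inr (.waitDone ((hand .marker2).port E)), noMsg⟩
      ⟨v, v, .inl (f, x, .done), noMsg⟩ ⟨c, c, .inr .idle, noMsg⟩) b := by
    rw [occupied_quad]; simp [hab, hbl.symm, hvb, hbc.symm]
  -- the pivot expands into the old vertex of `M₂`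
  have e9 := next_expand (hand := hand) (X := quad (α := Particle (taskAlg task))
      ⟨a, a, .inr (.following ((hand .pivot).port E) false), noMsg⟩
      ⟨l, l, .inr (.waitDone ((hand .marker2).port E)), noMsg⟩
      ⟨v, v, .inl (f, x, .done), noMsg⟩ ⟨c, c, .inr .idle, noMsg⟩)
    (i := .pivot) (s := .inr (.pulling ((hand .pivot).port E) false))
    (p := (hand .pivot).port E) (v := b)
    (passive_quad (fun h => (h rfl).elim) (fun _ => pW' _ _ _ _)
      (fun _ => pD _ _ _ _) (fun _ => pM _ _ _))
    (by
      rw [decision_of_marker (s := .following ((hand .pivot).port E) false) (b := noMsg) rfl rfl]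
      have : (lookAt (quad (α := Particle (taskAlg task))
          ⟨a, a, .inr (.following ((hand .pivot).port E) false), noMsg⟩
          ⟨l, l, .inr (.waitDone ((hand .marker2).port E)), noMsg⟩
          ⟨v, v, .inl (f, x, .done), noMsg⟩ ⟨c, c, .inr .idle, noMsg⟩)
          (a + unitVec E)).free = true := by
        rw [free_lookAt, ← hba]; exact o9
      simp [markerDecide, Handedness.dir_port, this])
    rfl (by rw [Handedness.dir_port]; exact hba) o9
  rw [update_quad_pivot] at e9
  -- the pivot contracts and reports this to `M₂`
  have e10 := next_send (hand := hand) (X := quad (α := Particle (taskAlg task))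
      ⟨b, a, .inr (.pulling ((hand .pivot).port E) false), noMsg⟩
      ⟨l, l, .inr (.waitDone ((hand .marker2).port E)), noMsg⟩
      ⟨v, v, .inl (f, x, .done), noMsg⟩ ⟨c, c, .inr .idle, noMsg⟩)
    (i := .pivot) (s := .inr .idle)
    (q := (hand .pivot).port E) (D := E) (m := .reply) (mv := .contract)
    (k := .marker2) (t := b)
    (passive_quad (fun h => (h rfl).elim) (fun _ => pW' _ _ _ _)
      (fun _ => pD _ _ _ _) (fun _ => pM _ _ _))
    (by rw [decision_of_marker (s := .pulling ((hand .pivot).port E) false) (b := noMsg) rfl rfl]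
        simp [markerDecide])
    (.inr ⟨rfl, rfl⟩) (by decide) (Handedness.dir_port _ _) hlb
    (by
      intro k hk hk'
      cases k <;>
        first | exact absurd rfl hk | exact absurd rfl hk' | exact hvl' | exact hlc.symm)
  rw [update_quad_pivot, update_quad_marker2] at e10
  -- `M₂` passes the report on to the leader
  have e11 := next_send (hand := hand) (X := quad (α := Particle (taskAlg task))
      ⟨b, b, .inr .idle, noMsg⟩
      ⟨l, l, .inr (.waitDone ((hand .marker2).port E)),
        single ((hand .marker2).port (E + 3)) .reply⟩
      ⟨v, v, .inl (f, x, .done), noMsg⟩ ⟨c, c, .inr .idle, noMsg⟩)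
    (i := .marker2) (s := .inr .idle)
    (q := (hand .marker2).port E) (D := E) (m := .reply) (mv := .stay)
    (k := .leader) (t := l)
    (passive_quad (fun _ => pP _ _ _ _) (fun h => (h rfl).elim)
      (fun _ => pD _ _ _ _) (fun _ => pM _ _ _))
    (by rw [decision_of_marker (s := .waitDone ((hand .marker2).port E))
          (b := single ((hand .marker2).port (E + 3)) .reply) rfl rfl]
        simp [markerDecide])
    (.inl ⟨rfl, rfl⟩) (by decide) (Handedness.dir_port _ _) hvl
    (by
      intro k hk hk'
      cases k <;>
        first | exact absurd rfl hk | exact absurd rfl hk' | exact hvb.symm | exact hvc.symm)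
  rw [update_quad_marker2, update_quad_leader] at e11
  -- the leader receives the report
  have e12 := next_stay (hand := hand) (X := quad (α := Particle (taskAlg task))
      ⟨b, b, .inr .idle, noMsg⟩ ⟨l, l, .inr .idle, noMsg⟩
      ⟨v, v, .inl (f, x, .done), single ((hand .leader).port (E + 3)) .reply⟩
      ⟨c, c, .inr .idle, noMsg⟩)
    (i := .leader) (s := .inl (f, y, .start))
    (passive_quad (fun _ => pP _ _ _ _) (fun _ => pB _ _ _ _)
      (fun h => (h rfl).elim) (fun _ => pM _ _ _))
    (by rw [decision_of_leader (f := f) (x := x) (ph := .done)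
          (b := single ((hand .leader).port (E + 3)) .reply) rfl rfl]
        simp [leaderDecide, ht, stayIn])
  rw [update_quad_leader] at e12
  rw [rest_quad, rest_quad]
  exact .head ⟨e1, guard_quad hΦ₀ rfl⟩ (.head ⟨e2, guard_quad hΦ₀ rfl⟩
    (.head ⟨e3, guard_quad hΦ₀ rfl⟩ (.head ⟨e4, guard_quad hΦ₀ rfl⟩
    (.head ⟨e5, guard_quad hΦ₀ rfl⟩ (.head ⟨e6, guard_quad hΦ₁ rfl⟩
    (.head ⟨e7, guard_quad hΦ₂ rfl⟩ (.head ⟨e8, guard_quad hΦ₃ rfl⟩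
    (.head ⟨e9, guard_quad hΦ₄ rfl⟩ (.head ⟨e10, guard_quad hΦ₅ rfl⟩
    (.head ⟨e11, guard_quad hΦ₆ rfl⟩ (.single ⟨e12, guard_quad hΦ₆ rfl⟩)))))))))))

end Tasks

end Amoebot

namespace Amoebot

/-! ### Executing the commands of a machine with two registers -/

/-- The legs of the way of the leader during the execution of a command: it walks to one of the
markers, acts there, walks to the other marker, and acts there, possibly twice. -/
inductive Leg
  | seek₁
  | step₁
  | act₁
  | seek₂
  | step₂
  | act₂
  | act₃

instance : Finite Leg :=
  Finite.of_surjective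
    (fun i : Fin 7 => ![.seek₁, .step₁, .act₁, .seek₂, .step₂, .act₂, .act₃] i) (by
    intro x
    cases x
    exacts [⟨0, rfl⟩, ⟨1, rfl⟩, ⟨2, rfl⟩, ⟨3, rfl⟩, ⟨4, rfl⟩, ⟨5, rfl⟩, ⟨6, rfl⟩])

section Program

variable {Q : Type}

/-- The tasks of the leader when it walks to the particle in the direction of the port `p` first,
and acts as prescribed by `T₁`, `T₂` and `T₃`. -/
def itinerary (q : Q) (p : ZMod 6) (T₁ T₂ T₃ : Task (Q × Leg)) : Leg → Task (Q × Leg)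
  | .seek₁ => .look p (q, .step₁) (q, .act₁)
  | .step₁ => .step p (q, .seek₁)
  | .act₁ => T₁
  | .seek₂ => .look (p + 3) (q, .step₂) (q, .act₂)
  | .step₂ => .step (p + 3) (q, .seek₂)
  | .act₂ => T₂
  | .act₃ => T₃

/-- The tasks by which the leader executes a machine with two registers. The port `0` leads to
`M₁`, the port `3` to `M₂`. The marker `M₁` has to be moved along with every change of the second
register, as the first register is measured from `M₂`. -/
def regTask (M : Q → Cmd (Fin 2) Q) : Q × Leg → Task (Q × Leg)
  | (q, leg) =>
    match M q with
    | .inc 0 q' =>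
      itinerary q 0 (.send 0 (.shift 3) (q, .act₁) (q', .seek₁)) .halt .halt leg
    | .inc 1 q' =>
      itinerary q 0 (.send 0 (.shift 3) (q, .act₁) (q, .seek₂)) (.pull 3 .follow (q', .seek₁))
        .halt leg
    | .dec 0 q₀ q₁ =>
      itinerary q 0 (.look 3 (q, .act₂) (q₀, .seek₁)) (.pull 0 .follow (q₁, .seek₁)) .halt leg
    | .dec 1 q₀ q₁ =>
      itinerary q 3 (.send 3 (.shift 3) (q₀, .seek₁) (q, .seek₂)) (.pull 0 .follow (q₁, .seek₁))
        .halt leg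
    | .op none q' => .look 0 (q', .seek₁) (q', .seek₁)
    | .op (some k) q' =>
      if k = 0 then
        itinerary q 0 (.send 0 (.shift 3) (q, .act₁) (q, .seek₂))
          (.pull 3 .followBoth (q', .seek₁)) .halt leg
      else if k = 3 then
        itinerary q 3 (.send 3 (.shiftBoth 3) (q, .act₁) (q, .seek₂))
          (.pull 0 .follow (q', .seek₁)) .halt leg
      else
        itinerary q 0 (.send 0 (.shift (k + 3)) (q, .act₁) (q, .seek₂))
          (.send 3 (.shiftBoth k) (q, .act₂) (q, .act₃)) (.step k (q', .seek₁)) leg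
    | _ => .halt

end Program

/-! ### Coordinates along the line -/

/-- The vertex with the coordinates `c` with respect to the origin `o` and the axes `d`, `e`. -/
def site (o : Grid) (d e : ZMod 6) (c : ℤ × ℤ) : Grid := o + c.1 • unitVec d + c.2 • unitVec e

section site

variable {o : Grid} {d e : ZMod 6}

theorem det_unitVec_ne_zero : ∀ d e : ZMod 6, e ≠ d → e ≠ d + 3 →
    (unitVec d).1 * (unitVec e).2 - (unitVec d).2 * (unitVec e).1 ≠ 0 := by decide

theorem site_injective (h1 : e ≠ d) (h2 : e ≠ d + 3) : Function.Injective (site o d e) := by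
  rintro ⟨x, y⟩ ⟨x', y'⟩ h
  have hdet := det_unitVec_ne_zero d e h1 h2
  unfold site at h
  have e1 := congrArg Prod.fst h
  have e2 := congrArg Prod.snd h
  simp only [Prod.fst_add, Prod.snd_add, Prod.smul_fst, Prod.smul_snd, smul_eq_mul] at e1 e2
  have hx : (x - x') * ((unitVec d).1 * (unitVec e).2 - (unitVec d).2 * (unitVec e).1) = 0 := by
    linear_combination (unitVec e).2 * e1 - (unitVec e).1 * e2
  have hy : (y - y') * ((unitVec d).1 * (unitVec e).2 - (unitVec d).2 * (unitVec e).1) = 0 := by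
    linear_combination (unitVec d).1 * e2 - (unitVec d).2 * e1
  rcases mul_eq_zero.1 hx with hx | hx
  · rcases mul_eq_zero.1 hy with hy | hy
    · exact Prod.ext (sub_eq_zero.1 hx) (sub_eq_zero.1 hy)
    · exact absurd hy hdet
  · exact absurd hx hdet

theorem site_add_axis (x y : ℤ) : site o d e (x, y) + unitVec d = site o d e (x + 1, y) := by
  simp only [site, add_smul, one_smul]; abel

theorem site_sub_axis (x y : ℤ) : site o d e (x, y) + unitVec (d + 3) = site o d e (x - 1, y) := by
  simp only [site, sub_smul, one_smul, unitVec_add_three]; abel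

theorem site_add_side (x y : ℤ) : site o d e (x, y) + unitVec e = site o d e (x, y + 1) := by
  simp only [site, add_smul, one_smul]; abel

end site

section Commands

variable {Q : Type} [Finite Q] {M : Q → Cmd (Fin 2) Q} {hand : Role → Handedness}
  {Φ : (Role → Grid) → (Role → Grid) → Prop} {f : ZMod 6} {q : Q} {o : Grid} {d e : ZMod 6}

/-- One or more changes of the configuration during the execution of the command `M q`, with all
configurations but the last one satisfying `Φ`. -/
abbrev Steps (M : Q → Cmd (Fin 2) Q) (hand : Role → Handedness)
    (Φ : (Role → Grid) → (Role → Grid) → Prop) (q : Q) :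
    Config (taskAlg (regTask M)) Role → Config (taskAlg (regTask M)) Role → Prop :=
  Relation.TransGen fun X Y => Next hand X Y ∧
    Φ (fun i => (X i).head) (fun i => (X i).tail) ∧
      ∃ f leg ph, (X .leader).state = .inl (f, (q, leg), ph)

theorem Adv.steps {leg : Leg} {X Y : Config (taskAlg (regTask M)) Role}
    (h : Adv hand Φ (q, leg) X Y) : Steps M hand Φ q X Y := by
  refine Relation.TransGen.mono ?_ _ _ h
  rintro X Y ⟨h1, h2, f, ph, h3⟩
  exact ⟨h1, h2, f, leg, ph, h3⟩

/-- The leader walks until it meets another particle. -/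
theorem steps_walk {p D : ZMod 6} {lg₁ lg₂ lg₃ : Leg} {a b c : Grid} {line : ℕ → Grid} {n : ℕ}
    (h₁ : regTask M (q, lg₁) = .look p (q, lg₂) (q, lg₃))
    (h₂ : regTask M (q, lg₂) = .step p (q, lg₁)) (hD : (hand .leader).dir (f + p) = D)
    (hline : ∀ i, line (i + 1) = line i + unitVec D)
    (hfree : ∀ i < n, a ≠ line (i + 1) ∧ b ≠ line (i + 1) ∧ c ≠ line (i + 1))
    (hend : a = line (n + 1) ∨ b = line (n + 1) ∨ c = line (n + 1))
    (hΦ : ∀ i j, i ≤ n → j ≤ n → Φ (quad a b (line i) c) (quad a b (line j) c)) :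
    Steps M hand Φ q (rest _ f (quad a b (line 0) c) (q, lg₁))
      (rest _ f (quad a b (line n) c) (q, lg₃)) := by
  -- induction on the number of steps that remain
  have key : ∀ k, k ≤ n → Steps M hand Φ q (rest _ f (quad a b (line (n - k)) c) (q, lg₁))
      (rest _ f (quad a b (line n) c) (q, lg₃)) := by
    intro k
    induction k with
    | zero =>
      intro _
      refine Adv.steps ((adv_look h₁ (hΦ _ _ le_rfl le_rfl)).2 ?_)
      rw [hD, quad_leader, ← hline]
      exact (exists_quad (P := fun g => g = line (n + 1))).2 (by tauto)
    | succ k ih =>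
      intro hk
      obtain ⟨m, hm⟩ : ∃ m, m = n - (k + 1) := ⟨_, rfl⟩
      have hm' : n - k = m + 1 := by omega
      have ih := ih (by omega)
      rw [hm'] at ih
      rw [← hm]
      obtain ⟨f1, f2, f3⟩ := hfree m (by omega)
      have f4 : line m ≠ line (m + 1) := by
        rw [hline]; simpa using (unitVec_ne_zero D)
      have hall : ∀ i, quad a b (line m) c i ≠ line (m + 1) :=
        (forall_quad (P := fun g => g ≠ line (m + 1))).2 ⟨f1, f2, f4, f3⟩
      have s1 := Adv.steps ((adv_look (hand := hand) (f := f) h₁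
        (hΦ m m (by omega) (by omega))).1 (by
          rw [hD, quad_leader, ← hline]
          rintro ⟨i, hi⟩
          exact hall i hi))
      have s2 := Adv.steps (adv_step (hand := hand) (f := f) (pos := quad a b (line m) c)
        (v := line (m + 1)) (Φ := Φ) h₂ (by rw [hD, quad_leader, ← hline])
        hall (hΦ m m (by omega) (by omega)) (by
          rw [update_quad_leader]; exact hΦ _ _ (by omega) (by omega)))
      rw [update_quad_leader] at s2
      exact s1.trans (s2.trans ih)
  have := key n le_rfl
  rwa [Nat.sub_self] at this

variable (hf : (hand .leader).dir f = d) (he₁ : e ≠ d) (he₂ : e ≠ d + 3)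

include hf he₁ he₂

/-- The leader walks forward until it meets `M₁`. -/
theorem steps_forward {lg₁ lg₂ lg₃ : Leg} {A B : ℤ × ℤ} {l c : ℤ}
    (h₁ : regTask M (q, lg₁) = .look 0 (q, lg₂) (q, lg₃))
    (h₂ : regTask M (q, lg₂) = .step 0 (q, lg₁)) (hlc : l < c)
    (hA : ∀ i, l < i → i < c → A ≠ (i, 0)) (hB : ∀ i, l < i → i < c → B ≠ (i, 0))
    (hΦ : ∀ i j, l ≤ i → i < c → l ≤ j → j < c →
      Φ (quad (site o d e A) (site o d e B) (site o d e (i, 0)) (site o d e (c, 0)))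
        (quad (site o d e A) (site o d e B) (site o d e (j, 0)) (site o d e (c, 0)))) :
    Steps M hand Φ q
      (rest _ f (quad (site o d e A) (site o d e B) (site o d e (l, 0)) (site o d e (c, 0)))
        (q, lg₁))
      (rest _ f (quad (site o d e A) (site o d e B) (site o d e (c - 1, 0)) (site o d e (c, 0)))
        (q, lg₃)) := by
  have hinj := site_injective (o := o) he₁ he₂
  have := steps_walk (hand := hand) (f := f) (Φ := Φ) (a := site o d e A) (b := site o d e B)
    (c := site o d e (c, 0)) (line := fun i => site o d e (l + i, 0)) (n := (c - 1 - l).toNat)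
    (D := d) h₁ h₂ (by rw [add_zero, hf])
    (fun i => by rw [site_add_axis]; push_cast; rw [add_assoc])
    (fun i hi => ⟨fun h => hA _ (by push_cast; omega) (by push_cast; omega) (hinj h),
      fun h => hB _ (by push_cast; omega) (by push_cast; omega) (hinj h),
      fun h => by have := congrArg Prod.fst (hinj h); push_cast at this; omega⟩)
    (by right; right; push_cast; congr 2; omega)
    (fun i j hi hj => hΦ _ _ (by omega) (by omega) (by omega) (by omega))
  rw [show l + ((c - 1 - l).toNat : ℤ) = c - 1 by omega] at this
  simpa using this

/-- The leader walks backward until it meets `M₂`. -/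
theorem steps_backward {lg₁ lg₂ lg₃ : Leg} {A C : ℤ × ℤ} {b l : ℤ}
    (h₁ : regTask M (q, lg₁) = .look 3 (q, lg₂) (q, lg₃))
    (h₂ : regTask M (q, lg₂) = .step 3 (q, lg₁)) (hlc : b < l)
    (hA : ∀ i, b < i → i < l → A ≠ (i, 0)) (hC : ∀ i, b < i → i < l → C ≠ (i, 0))
    (hΦ : ∀ i j, b < i → i ≤ l → b < j → j ≤ l →
      Φ (quad (site o d e A) (site o d e (b, 0)) (site o d e (i, 0)) (site o d e C))
        (quad (site o d e A) (site o d e (b, 0)) (site o d e (j, 0)) (site o d e C))) :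
    Steps M hand Φ q
      (rest _ f (quad (site o d e A) (site o d e (b, 0)) (site o d e (l, 0)) (site o d e C))
        (q, lg₁))
      (rest _ f (quad (site o d e A) (site o d e (b, 0)) (site o d e (b + 1, 0)) (site o d e C))
        (q, lg₃)) := by
  have hinj := site_injective (o := o) he₁ he₂
  have := steps_walk (hand := hand) (f := f) (Φ := Φ) (a := site o d e A)
    (b := site o d e (b, 0))
    (c := site o d e C) (line := fun i => site o d e (l - i, 0)) (n := (l - 1 - b).toNat)
    (D := d + 3) h₁ h₂ (by rw [Handedness.dir_add_three, hf])
    (fun i => by rw [site_sub_axis]; push_cast; rw [sub_sub])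
    (fun i hi => ⟨fun h => hA _ (by push_cast; omega) (by push_cast; omega) (hinj h),
      fun h => by have := congrArg Prod.fst (hinj h); push_cast at this; omega,
      fun h => hC _ (by push_cast; omega) (by push_cast; omega) (hinj h)⟩)
    (by right; left; push_cast; congr 2; omega)
    (fun i j hi hj => hΦ _ _ (by omega) (by omega) (by omega) (by omega))
  rw [show l - ((l - 1 - b).toNat : ℤ) = b + 1 by omega] at this
  simpa using this

end Commands

end Amoebot

namespace Amoebot

/-! ### Commands and moves on the line -/

section Commands

variable {Q : Type} [Finite Q] {M : Q → Cmd (Fin 2) Q} {hand : Role → Handedness}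
  {Φ : (Role → Grid) → (Role → Grid) → Prop} {f : ZMod 6} {q : Q} {o : Grid} {d e : ZMod 6}

variable (hf : (hand .leader).dir f = d) (he₁ : e ≠ d) (he₂ : e ≠ d + 3)

include hf he₁ he₂

/-- The leader makes `M₁` move to `T`. -/
theorem steps_push {j : ZMod 6} {lg : Leg} {z z' : Q × Leg} {A B T : ℤ × ℤ} {c : ℤ}
    (ht : regTask M (q, lg) = .send 0 (.shift j) z' z)
    (hT : site o d e (c, 0) + unitVec (d + 3 + (hand .marker1).sign * j) = site o d e T)
    (h1 : A ≠ B) (h2 : A ≠ (c - 1, 0)) (h3 : A ≠ (c, 0)) (h4 : B ≠ (c - 1, 0)) (h5 : B ≠ (c, 0))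
    (t1 : A ≠ T) (t2 : B ≠ T) (t3 : (c - 1, 0) ≠ T)
    (hΦ₀ : Φ (quad (site o d e A) (site o d e B) (site o d e (c - 1, 0)) (site o d e (c, 0)))
      (quad (site o d e A) (site o d e B) (site o d e (c - 1, 0)) (site o d e (c, 0))))
    (hΦ₁ : Φ (quad (site o d e A) (site o d e B) (site o d e (c - 1, 0)) (site o d e T))
      (quad (site o d e A) (site o d e B) (site o d e (c - 1, 0)) (site o d e (c, 0))))
    (hΦ₂ : Φ (quad (site o d e A) (site o d e B) (site o d e (c - 1, 0)) (site o d e T))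
      (quad (site o d e A) (site o d e B) (site o d e (c - 1, 0)) (site o d e T))) :
    Steps M hand Φ q
      (rest _ f (quad (site o d e A) (site o d e B) (site o d e (c - 1, 0)) (site o d e (c, 0)))
        (q, lg))
      (rest _ f (quad (site o d e A) (site o d e B) (site o d e (c - 1, 0)) (site o d e T)) z) := by
  have hinj := site_injective (o := o) he₁ he₂
  have h6 : site o d e (c, 0) ≠ site o d e T := by
    rw [← hT]; simpa using (unitVec_ne_zero _)
  have h7 : site o d e (c - 1, 0) ≠ site o d e (c, 0) := hinj.ne (by simp)
  have := adv_send_shift (hand := hand) (f := f) (Φ := Φ) (N := .marker1) (E := d + 3)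
    (pos := quad (site o d e A) (site o d e B) (site o d e (c - 1, 0)) (site o d e (c, 0)))
    (v := site o d e T) (by decide) ht
    (quad_injective (hinj.ne h1) (hinj.ne h2) (hinj.ne h3) (hinj.ne h4) (hinj.ne h5) h7)
    (by rw [add_zero, hf]) (by simp [hf, site_add_axis]) hT.symm
    ((forall_quad (P := fun g => g ≠ site o d e T)).2
      ⟨hinj.ne t1, hinj.ne t2, hinj.ne t3, h6⟩)
    hΦ₀ (by rwa [update_quad_marker1]) (by rwa [update_quad_marker1])
  rw [update_quad_marker1] at this
  exact this.steps

/-- The leader makes `M₁` follow it by one step. -/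
theorem steps_pull {lg : Leg} {z : Q × Leg} {A B : ℤ × ℤ} {c : ℤ}
    (ht : regTask M (q, lg) = .pull 0 .follow z)
    (h1 : A ≠ B) (h2 : A ≠ (c - 1, 0)) (h3 : A ≠ (c, 0)) (h4 : B ≠ (c - 1, 0)) (h5 : B ≠ (c, 0))
    (t1 : A ≠ (c - 2, 0)) (t2 : B ≠ (c - 2, 0))
    (hΦ : ∀ l l' k k', c - 2 ≤ l → c - 2 ≤ l' → c - 1 ≤ k → c - 1 ≤ k' → k ≤ c → k' ≤ c →
      max l l' < min k k' →
      Φ (quad (site o d e A) (site o d e B) (site o d e (l, 0)) (site o d e (k, 0)))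
        (quad (site o d e A) (site o d e B) (site o d e (l', 0)) (site o d e (k', 0)))) :
    Steps M hand Φ q
      (rest _ f (quad (site o d e A) (site o d e B) (site o d e (c - 1, 0)) (site o d e (c, 0)))
        (q, lg))
      (rest _ f (quad (site o d e A) (site o d e B) (site o d e (c - 2, 0))
        (site o d e (c - 1, 0))) z) := by
  have hinj := site_injective (o := o) he₁ he₂
  have h7 : site o d e (c - 1, 0) ≠ site o d e (c, 0) := hinj.ne (by simp)
  have := adv_pull (hand := hand) (f := f) (Φ := Φ) (N := .marker1) (E := d + 3)
    (pos := quad (site o d e A) (site o d e B) (site o d e (c - 1, 0)) (site o d e (c, 0)))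
    (v := site o d e (c - 2, 0)) (by decide) ht
    (quad_injective (hinj.ne h1) (hinj.ne h2) (hinj.ne h3) (hinj.ne h4) (hinj.ne h5) h7)
    (by rw [add_zero, hf]) (by simp [hf, site_add_axis])
    (by rw [quad_leader, site_sub_axis]; congr 2; omega)
    ((forall_quad (P := fun g => g ≠ site o d e (c - 2, 0))).2
      ⟨hinj.ne t1, hinj.ne t2, hinj.ne (by simp), hinj.ne (by simp; omega)⟩)
    (hΦ _ _ _ _ (by omega) (by omega) (by omega) (by omega) (by omega) (by omega) (by omega))
    (by
      rw [update_quad_leader]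
      exact hΦ _ _ _ _ (by omega) (by omega) (by omega) (by omega) (by omega) (by omega)
        (by omega))
    (by
      rw [update_quad_leader]
      exact hΦ _ _ _ _ (by omega) (by omega) (by omega) (by omega) (by omega) (by omega)
        (by omega))
    (by
      rw [update_quad_leader, update_quad_marker1]
      exact hΦ _ _ _ _ (by omega) (by omega) (by omega) (by omega) (by omega) (by omega)
        (by omega))
    (by
      rw [update_quad_leader, update_quad_marker1]
      exact hΦ _ _ _ _ (by omega) (by omega) (by omega) (by omega) (by omega) (by omega)
        (by omega))
  rw [update_quad_leader, update_quad_marker1] at this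
  exact this.steps

section OnLine

variable {b l c : ℤ}
  (hΦ : ∀ b l c b' l' c' : ℤ, 0 < min b b' → max b b' < min l l' → max l l' < min c c' →
    Φ (quad (site o d e (0, 0)) (site o d e (b, 0)) (site o d e (l, 0)) (site o d e (c, 0)))
      (quad (site o d e (0, 0)) (site o d e (b', 0)) (site o d e (l', 0)) (site o d e (c', 0))))
  (hb : 0 < b) (hbl : b < l) (hlc : l < c)

include hΦ hb hbl hlc

/-- To increment the first register, the leader walks to `M₁` and makes it step forward. -/
theorem steps_inc_zero {q' : Q} (hq : M q = .inc 0 q') :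
    Steps M hand Φ q
      (rest _ f (quad (site o d e (0, 0)) (site o d e (b, 0)) (site o d e (l, 0))
        (site o d e (c, 0))) (q, .seek₁))
      (rest _ f (quad (site o d e (0, 0)) (site o d e (b, 0)) (site o d e (c - 1, 0))
        (site o d e (c + 1, 0))) (q', .seek₁)) := by
  have s1 := steps_forward (M := M) (Φ := Φ) (o := o) (q := q) (lg₁ := .seek₁) (lg₂ := .step₁)
    (lg₃ := .act₁) (A := (0, 0)) (B := (b, 0)) hf he₁ he₂
    (by simp [regTask, hq, itinerary]) (by simp [regTask, hq, itinerary]) hlc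
    (fun i h1 h2 => by simp; omega) (fun i h1 h2 => by simp; omega)
    (fun i j h1 h2 h3 h4 => hΦ _ _ _ _ _ _ (by omega) (by omega) (by omega))
  have s2 := steps_push (M := M) (Φ := Φ) (o := o) (q := q) (lg := .act₁) (j := 3)
    (z := (q', .seek₁)) (z' := (q, .act₁))
    (A := (0, 0)) (B := (b, 0)) (c := c) (T := (c + 1, 0)) hf he₁ he₂
    (by simp only [regTask, hq, itinerary])
    (by rw [Handedness.sign_mul_three, add_assoc, show (3 : ZMod 6) + 3 = 0 by decide, add_zero,
          site_add_axis])
    (by simp; omega) (by simp; omega) (by simp; omega) (by simp; omega) (by simp; omega)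
    (by simp; omega) (by simp; omega) (by simp; omega)
    (hΦ _ _ _ _ _ _ (by omega) (by omega) (by omega))
    (hΦ _ _ _ _ _ _ (by omega) (by omega) (by omega))
    (hΦ _ _ _ _ _ _ (by omega) (by omega) (by omega))
  exact s1.trans s2

/-- To increment the second register, the leader makes `M₁` step forward, walks back to `M₂`, and makes
a step forward with `M₂` following. The first register is unchanged, as both markers have moved. -/
theorem steps_inc_one {q' : Q} (hq : M q = .inc 1 q') :
    Steps M hand Φ q
      (rest _ f (quad (site o d e (0, 0)) (site o d e (b, 0)) (site o d e (l, 0))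
        (site o d e (c, 0))) (q, .seek₁))
      (rest _ f (quad (site o d e (0, 0)) (site o d e (b + 1, 0)) (site o d e (b + 2, 0))
        (site o d e (c + 1, 0))) (q', .seek₁)) := by
  have hinj := site_injective (o := o) he₁ he₂
  have s1 := steps_forward (M := M) (Φ := Φ) (o := o) (q := q) (lg₁ := .seek₁) (lg₂ := .step₁)
    (lg₃ := .act₁) (A := (0, 0)) (B := (b, 0)) hf he₁ he₂
    (by simp [regTask, hq, itinerary]) (by simp [regTask, hq, itinerary]) hlc
    (fun i h1 h2 => by simp; omega) (fun i h1 h2 => by simp; omega)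
    (fun i j h1 h2 h3 h4 => hΦ _ _ _ _ _ _ (by omega) (by omega) (by omega))
  have s2 := steps_push (M := M) (Φ := Φ) (o := o) (q := q) (lg := .act₁) (j := 3)
    (z := (q, .seek₂)) (z' := (q, .act₁))
    (A := (0, 0)) (B := (b, 0)) (c := c) (T := (c + 1, 0)) hf he₁ he₂
    (by simp only [regTask, hq, itinerary])
    (by rw [Handedness.sign_mul_three, add_assoc, show (3 : ZMod 6) + 3 = 0 by decide, add_zero,
          site_add_axis])
    (by simp; omega) (by simp; omega) (by simp; omega) (by simp; omega) (by simp; omega)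
    (by simp; omega) (by simp; omega) (by simp; omega)
    (hΦ _ _ _ _ _ _ (by omega) (by omega) (by omega))
    (hΦ _ _ _ _ _ _ (by omega) (by omega) (by omega))
    (hΦ _ _ _ _ _ _ (by omega) (by omega) (by omega))
  have s3 := steps_backward (M := M) (Φ := Φ) (o := o) (q := q) (lg₁ := .seek₂) (lg₂ := .step₂)
    (lg₃ := .act₂) (A := (0, 0)) (C := (c + 1, 0)) (b := b) (l := c - 1) hf he₁ he₂
    (by simp [regTask, hq, itinerary]) (by simp [regTask, hq, itinerary]) (by omega)
    (fun i h1 h2 => by simp; omega) (fun i h1 h2 => by simp; omega)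
    (fun i j h1 h2 h3 h4 => hΦ _ _ _ _ _ _ (by omega) (by omega) (by omega))
  have s4 := adv_pull (task := regTask M) (x := (q, .act₂)) (y := (q', .seek₁))
    (hand := hand) (f := f) (Φ := Φ)
    (N := .marker2) (E := d) (p := 3)
    (pos := quad (site o d e (0, 0)) (site o d e (b, 0)) (site o d e (b + 1, 0))
      (site o d e (c + 1, 0)))
    (v := site o d e (b + 2, 0)) (by decide) (by simp [regTask, hq, itinerary])
    (quad_injective (hinj.ne (by simp; omega)) (hinj.ne (by simp; omega))
      (hinj.ne (by simp; omega)) (hinj.ne (by simp)) (hinj.ne (by simp; omega))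
      (hinj.ne (by simp; omega)))
    (by rw [Handedness.dir_add_three, hf, add_assoc, show (3 : ZMod 6) + 3 = 0 by decide,
          add_zero])
    (by simp [Handedness.dir_add_three, hf, site_sub_axis])
    (by rw [quad_leader, site_add_axis]; congr 2; omega)
    ((forall_quad (P := fun g => g ≠ site o d e (b + 2, 0))).2
      ⟨hinj.ne (by simp; omega), hinj.ne (by simp), hinj.ne (by simp),
        hinj.ne (by simp; omega)⟩)
    (hΦ _ _ _ _ _ _ (by omega) (by omega) (by omega))
    (by rw [update_quad_leader]; exact hΦ _ _ _ _ _ _ (by omega) (by omega) (by omega))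
    (by rw [update_quad_leader]; exact hΦ _ _ _ _ _ _ (by omega) (by omega) (by omega))
    (by
      rw [update_quad_leader, update_quad_marker2]
      exact hΦ _ _ _ _ _ _ (by omega) (by omega) (by omega))
    (by
      rw [update_quad_leader, update_quad_marker2]
      exact hΦ _ _ _ _ _ _ (by omega) (by omega) (by omega))
  rw [update_quad_leader, update_quad_marker2] at s4
  exact s1.trans (s2.trans (s3.trans s4.steps))

/-- To test the first register, the leader walks to `M₁` and looks backward: the register is zero
exactly if `M₂` is its other neighbour. Otherwise it makes a step backward with `M₁` following. -/
theorem steps_dec_zero {q₀ q₁ : Q} (hq : M q = .dec 0 q₀ q₁) :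
    (c = b + 2 → Steps M hand Φ q
      (rest _ f (quad (site o d e (0, 0)) (site o d e (b, 0)) (site o d e (l, 0))
        (site o d e (c, 0))) (q, .seek₁))
      (rest _ f (quad (site o d e (0, 0)) (site o d e (b, 0)) (site o d e (c - 1, 0))
        (site o d e (c, 0))) (q₀, .seek₁))) ∧
    (c ≠ b + 2 → Steps M hand Φ q
      (rest _ f (quad (site o d e (0, 0)) (site o d e (b, 0)) (site o d e (l, 0))
        (site o d e (c, 0))) (q, .seek₁))
      (rest _ f (quad (site o d e (0, 0)) (site o d e (b, 0)) (site o d e (c - 2, 0))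
        (site o d e (c - 1, 0))) (q₁, .seek₁))) := by
  have hinj := site_injective (o := o) he₁ he₂
  have s1 := steps_forward (M := M) (Φ := Φ) (o := o) (q := q) (lg₁ := .seek₁) (lg₂ := .step₁)
    (lg₃ := .act₁) (A := (0, 0)) (B := (b, 0)) hf he₁ he₂
    (by simp [regTask, hq, itinerary]) (by simp [regTask, hq, itinerary]) hlc
    (fun i h1 h2 => by simp; omega) (fun i h1 h2 => by simp; omega)
    (fun i j h1 h2 h3 h4 => hΦ _ _ _ _ _ _ (by omega) (by omega) (by omega))
  have hlook := adv_look (task := regTask M) (x := (q, .act₁)) (y := (q, .act₂))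
    (z := (q₀, .seek₁)) (hand := hand) (f := f) (Φ := Φ) (p := 3)
    (pos := quad (site o d e (0, 0)) (site o d e (b, 0)) (site o d e (c - 1, 0))
      (site o d e (c, 0))) (by simp [regTask, hq, itinerary])
    (hΦ _ _ _ _ _ _ (by omega) (by omega) (by omega))
  rw [Handedness.dir_add_three, hf, quad_leader, site_sub_axis] at hlook
  constructor
  · intro hc
    refine s1.trans (Adv.steps (hlook.2 ⟨.marker2, ?_⟩))
    rw [quad_marker2, hc]
    congr 2
    omega
  · intro hc
    refine s1.trans ((Adv.steps (hlook.1 ?_)).trans ?_)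
    · rw [exists_quad (P := fun g => g = site o d e (c - 1 - 1, 0))]
      simp only [hinj.eq_iff, Prod.mk.injEq, and_true]
      omega
    · exact steps_pull (M := M) (Φ := Φ) (o := o) (q := q) (lg := .act₂)
        (A := (0, 0)) (B := (b, 0)) (c := c) hf he₁ he₂
        (by simp [regTask, hq, itinerary])
        (by simp; omega) (by simp; omega) (by simp; omega) (by simp; omega) (by simp; omega)
        (by simp; omega) (by simp; omega)
        (fun l l' k k' h1 h2 h3 h4 h5 h6 h7 =>
          hΦ _ _ _ _ _ _ (by omega) (by omega) (by omega))

/-- To test the second register, the leader walks to `M₂` and makes it step backward, which `M₂` refuses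
exactly if the pivot is next to it. Otherwise the leader takes `M₁` one step backward, too. -/
theorem steps_dec_one {q₀ q₁ : Q} (hq : M q = .dec 1 q₀ q₁) :
    (b = 1 → Steps M hand Φ q
      (rest _ f (quad (site o d e (0, 0)) (site o d e (b, 0)) (site o d e (l, 0))
        (site o d e (c, 0))) (q, .seek₁))
      (rest _ f (quad (site o d e (0, 0)) (site o d e (b, 0)) (site o d e (b + 1, 0))
        (site o d e (c, 0))) (q₀, .seek₁))) ∧
    (b ≠ 1 → Steps M hand Φ q
      (rest _ f (quad (site o d e (0, 0)) (site o d e (b, 0)) (site o d e (l, 0))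
        (site o d e (c, 0))) (q, .seek₁))
      (rest _ f (quad (site o d e (0, 0)) (site o d e (b - 1, 0)) (site o d e (c - 2, 0))
        (site o d e (c - 1, 0))) (q₁, .seek₁))) := by
  have hinj := site_injective (o := o) he₁ he₂
  have h33 : (3 : ZMod 6) + 3 = 0 := by decide
  have s1 := steps_backward (M := M) (Φ := Φ) (o := o) (q := q) (lg₁ := .seek₁) (lg₂ := .step₁)
    (lg₃ := .act₁) (A := (0, 0)) (C := (c, 0)) (b := b) hf he₁ he₂
    (by simp [regTask, hq, itinerary]) (by simp [regTask, hq, itinerary]) hbl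
    (fun i h1 h2 => by simp; omega) (fun i h1 h2 => by simp; omega)
    (fun i j h1 h2 h3 h4 => hΦ _ _ _ _ _ _ (by omega) (by omega) (by omega))
  have hposinj : Function.Injective (quad (site o d e (0, 0)) (site o d e (b, 0))
      (site o d e (b + 1, 0)) (site o d e (c, 0))) :=
    quad_injective (hinj.ne (by simp; omega)) (hinj.ne (by simp; omega))
      (hinj.ne (by simp; omega)) (hinj.ne (by simp)) (hinj.ne (by simp; omega))
      (hinj.ne (by simp; omega))
  have hE : (hand .leader).dir (f + 3) + 3 = d := by
    rw [Handedness.dir_add_three, hf, add_assoc, h33, add_zero]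
  have hM2 : site o d e (b, 0) = site o d e (b + 1, 0) + unitVec ((hand .leader).dir (f + 3)) := by
    rw [Handedness.dir_add_three, hf, site_sub_axis, add_sub_cancel_right]
  have htgt : site o d e (b, 0) + unitVec (d + (hand .marker2).sign * 3) =
      site o d e (b - 1, 0) := by
    rw [Handedness.sign_mul_three, site_sub_axis]
  constructor
  · intro hb1
    refine s1.trans (Adv.steps (adv_send_refused (N := .marker2) (p := 3) (j := 3) (E := d)
      (z := (q, .seek₂)) (by decide) (by simp [regTask, hq, itinerary]) hposinj hE hM2
      ⟨.pivot, ?_⟩ (hΦ _ _ _ _ _ _ (by omega) (by omega) (by omega))))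
    rw [quad_pivot, quad_marker2, htgt, hb1]
    rfl
  · intro hb1
    have s2 := adv_send_shift (task := regTask M) (x := (q, .act₁)) (y := (q₀, .seek₁))
      (z := (q, .seek₂)) (hand := hand) (f := f) (Φ := Φ) (N := .marker2) (p := 3) (j := 3)
      (E := d) (v := site o d e (b - 1, 0)) (by decide) (by simp [regTask, hq, itinerary])
      hposinj hE hM2 htgt.symm
      ((forall_quad (P := fun g => g ≠ site o d e (b - 1, 0))).2
        ⟨hinj.ne (by simp; omega), hinj.ne (by simp; omega), hinj.ne (by simp; omega),
          hinj.ne (by simp; omega)⟩)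
      (hΦ _ _ _ _ _ _ (by omega) (by omega) (by omega))
      (by rw [update_quad_marker2]; exact hΦ _ _ _ _ _ _ (by omega) (by omega) (by omega))
      (by rw [update_quad_marker2]; exact hΦ _ _ _ _ _ _ (by omega) (by omega) (by omega))
    rw [update_quad_marker2] at s2
    have s3 := steps_forward (M := M) (Φ := Φ) (o := o) (q := q) (lg₁ := .seek₂) (lg₂ := .step₂)
      (lg₃ := .act₂) (A := (0, 0)) (B := (b - 1, 0)) (l := b + 1) (c := c) hf he₁ he₂
      (by simp [regTask, hq, itinerary, h33]) (by simp [regTask, hq, itinerary, h33]) (by omega)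
      (fun i h1 h2 => by simp; omega) (fun i h1 h2 => by simp; omega)
      (fun i j h1 h2 h3 h4 => hΦ _ _ _ _ _ _ (by omega) (by omega) (by omega))
    have s4 := steps_pull (M := M) (Φ := Φ) (o := o) (q := q) (lg := .act₂) (z := (q₁, .seek₁))
      (A := (0, 0)) (B := (b - 1, 0)) (c := c) hf he₁ he₂
      (by simp [regTask, hq, itinerary])
      (by simp; omega) (by simp; omega) (by simp; omega) (by simp; omega) (by simp; omega)
      (by simp; omega) (by simp; omega)
      (fun l l' k k' h1 h2 h3 h4 h5 h6 h7 =>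
        hΦ _ _ _ _ _ _ (by omega) (by omega) (by omega))
    exact s1.trans (s2.steps.trans (s3.trans s4))

end OnLine

section Moves

variable {l c : ℤ} {k : ZMod 6} {q' : Q} (hl : 1 < l) (hlc : l < c) (hq : M q = .op (some k) q')

include hl hlc hq

/-- A move forward is possible if `M₂` is next to the pivot: `M₁` makes a step forward, and then the
leader, `M₂` and the pivot do so, in a row. -/
theorem steps_move_forward (hk : k = 0)
    (hΦ : ∀ h t, (h .pivot = site o d e (0, 0) ∨ h .pivot = site o d e (1, 0)) → Φ h t) :
    Steps M hand Φ q
      (rest _ f (quad (site o d e (0, 0)) (site o d e (1, 0)) (site o d e (l, 0))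
        (site o d e (c, 0))) (q, .seek₁))
      (rest _ f (quad (site o d e (1, 0)) (site o d e (2, 0)) (site o d e (3, 0))
        (site o d e (c + 1, 0))) (q', .seek₁)) := by
  have hinj := site_injective (o := o) he₁ he₂
  have h33 : (3 : ZMod 6) + 3 = 0 := by decide
  have s1 := steps_forward (M := M) (Φ := Φ) (o := o) (q := q) (lg₁ := .seek₁) (lg₂ := .step₁)
    (lg₃ := .act₁) (A := (0, 0)) (B := (1, 0)) hf he₁ he₂
    (by simp [regTask, hq, hk, itinerary]) (by simp [regTask, hq, hk, itinerary]) hlc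
    (fun i h1 h2 => by simp; omega) (fun i h1 h2 => by simp; omega)
    (fun i j h1 h2 h3 h4 => hΦ _ _ (.inl rfl))
  have s2 := steps_push (M := M) (Φ := Φ) (o := o) (q := q) (lg := .act₁) (j := 3)
    (z := (q, .seek₂)) (z' := (q, .act₁))
    (A := (0, 0)) (B := (1, 0)) (c := c) (T := (c + 1, 0)) hf he₁ he₂
    (by simp [regTask, hq, hk, itinerary])
    (by rw [Handedness.sign_mul_three, add_assoc, h33, add_zero, site_add_axis])
    (by simp) (by simp; omega) (by simp; omega) (by simp; omega) (by simp; omega)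
    (by simp; omega) (by simp; omega) (by simp; omega)
    (hΦ _ _ (.inl rfl)) (hΦ _ _ (.inl rfl)) (hΦ _ _ (.inl rfl))
  have s3 := steps_backward (M := M) (Φ := Φ) (o := o) (q := q) (lg₁ := .seek₂) (lg₂ := .step₂)
    (lg₃ := .act₂) (A := (0, 0)) (C := (c + 1, 0)) (b := 1) (l := c - 1) hf he₁ he₂
    (by simp [regTask, hq, hk, itinerary]) (by simp [regTask, hq, hk, itinerary]) (by omega)
    (fun i h1 h2 => by simp; omega) (fun i h1 h2 => by simp; omega)
    (fun i j h1 h2 h3 h4 => hΦ _ _ (.inl rfl))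
  have s4 := adv_pullBoth (task := regTask M) (x := (q, .act₂)) (y := (q', .seek₁))
    (hand := hand) (f := f) (Φ := Φ) (E := d) (p := 3) (a := site o d e (0, 0))
    (b := site o d e (1, 0)) (l := site o d e (2, 0)) (c := site o d e (c + 1, 0))
    (v := site o d e (3, 0)) (by simp [regTask, hq, hk, itinerary])
    (by rw [Handedness.dir_add_three, hf, add_assoc, h33, add_zero])
    (by rw [site_add_axis]; rfl) (by rw [site_add_axis]; rfl) (by rw [site_add_axis]; rfl)
    (hinj.ne (by simp)) (hinj.ne (by simp)) (hinj.ne (by simp; omega)) (hinj.ne (by simp))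
    (hinj.ne (by simp; omega)) (hinj.ne (by simp; omega)) (hinj.ne (by simp; omega))
    (hΦ _ _ (.inl rfl)) (hΦ _ _ (.inl rfl)) (hΦ _ _ (.inl rfl)) (hΦ _ _ (.inl rfl))
    (hΦ _ _ (.inl rfl)) (hΦ _ _ (.inr rfl)) (hΦ _ _ (.inr rfl))
  exact s1.trans (s2.trans (s3.trans s4.steps))

/-- A move backward: the pivot and `M₂` make a step backward, and then the leader takes `M₁` one step
backward. -/
theorem steps_move_backward (hk : k = 3)
    (hΦ : ∀ h t, (h .pivot = site o d e (0, 0) ∨ h .pivot = site o d e (-1, 0)) → Φ h t) :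
    Steps M hand Φ q
      (rest _ f (quad (site o d e (0, 0)) (site o d e (1, 0)) (site o d e (l, 0))
        (site o d e (c, 0))) (q, .seek₁))
      (rest _ f (quad (site o d e (-1, 0)) (site o d e (0, 0)) (site o d e (c - 2, 0))
        (site o d e (c - 1, 0))) (q', .seek₁)) := by
  have hinj := site_injective (o := o) he₁ he₂
  have h33 : (3 : ZMod 6) + 3 = 0 := by decide
  have h30 : ¬ (3 : ZMod 6) = 0 := by decide
  have s1 := steps_backward (M := M) (Φ := Φ) (o := o) (q := q) (lg₁ := .seek₁) (lg₂ := .step₁)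
    (lg₃ := .act₁) (A := (0, 0)) (C := (c, 0)) (b := 1) hf he₁ he₂
    (by simp [regTask, hq, hk, h30, itinerary]) (by simp [regTask, hq, hk, h30, itinerary]) hl
    (fun i h1 h2 => by simp; omega) (fun i h1 h2 => by simp; omega)
    (fun i j h1 h2 h3 h4 => hΦ _ _ (.inl rfl))
  have s2 := adv_send_shiftBoth (task := regTask M) (x := (q, .act₁)) (y := (q, .act₁))
    (z := (q, .seek₂)) (hand := hand) (f := f) (Φ := Φ) (E := d) (p := 3) (j := 3)
    (a := site o d e (0, 0)) (b := site o d e (1, 0)) (l := site o d e (1 + 1, 0))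
    (c := site o d e (c, 0)) (a' := site o d e (-1, 0)) (b' := site o d e (0, 0))
    (by simp [regTask, hq, hk, h30, itinerary])
    (by rw [Handedness.dir_add_three, hf, add_assoc, h33, add_zero])
    (by rw [site_add_axis]) (by rw [site_add_axis]; rfl)
    (hinj.ne (by simp)) (hinj.ne (by simp)) (hinj.ne (by simp; omega))
    (hinj.ne (by simp; omega)) 
    (by rw [Handedness.sign_mul_three, site_sub_axis]; rfl)
    (by rw [Handedness.sign_mul_three, site_sub_axis]; rfl)
    (hinj.ne (by simp)) (hinj.ne (by simp)) (hinj.ne (by simp; omega)) (hinj.ne (by simp))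
    (hinj.ne (by simp)) (hinj.ne (by simp; omega))
    (hΦ _ _ (.inl rfl)) (hΦ _ _ (.inr rfl)) (hΦ _ _ (.inr rfl)) (hΦ _ _ (.inr rfl))
    (hΦ _ _ (.inr rfl))
  have s3 := steps_forward (M := M) (Φ := Φ) (o := o) (q := q) (lg₁ := .seek₂) (lg₂ := .step₂)
    (lg₃ := .act₂) (A := (-1, 0)) (B := (0, 0)) (l := 1 + 1) (c := c) hf he₁ he₂
    (by simp [regTask, hq, hk, h30, itinerary, h33])
    (by simp [regTask, hq, hk, h30, itinerary, h33]) (by omega)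
    (fun i h1 h2 => by simp; omega) (fun i h1 h2 => by simp; omega)
    (fun i j h1 h2 h3 h4 => hΦ _ _ (.inr rfl))
  have s4 := steps_pull (M := M) (Φ := Φ) (o := o) (q := q) (lg := .act₂) (z := (q', .seek₁))
    (A := (-1, 0)) (B := (0, 0)) (c := c) hf he₁ he₂
    (by simp [regTask, hq, hk, h30, itinerary])
    (by simp) (by simp; omega) (by simp; omega) (by simp; omega) (by simp; omega)
    (by simp; omega) (by simp; omega)
    (fun l l' k k' h1 h2 h3 h4 h5 h6 h7 => hΦ _ _ (.inr rfl))
  exact s1.trans (s2.steps.trans (s3.trans s4))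

/-- A move in a direction that is not along the line. A request counts ports from the port towards
the sender, which lies forward for `M₂` and the pivot but backward for `M₁`; hence the numbers `k`
and `k + 3`. All particles have to agree on the sense of rotation. -/
theorem steps_move_sideways (hk₀ : k ≠ 0) (hk₃ : k ≠ 3)
    (he : ∀ i, d + (hand i).sign * k = e)
    (hΦ : ∀ h t, (h .pivot = site o d e (0, 0) ∨ h .pivot = site o d e (0, 1)) → Φ h t) :
    Steps M hand Φ q
      (rest _ f (quad (site o d e (0, 0)) (site o d e (1, 0)) (site o d e (l, 0))
        (site o d e (c, 0))) (q, .seek₁))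
      (rest _ f (quad (site o d e (0, 1)) (site o d e (1, 1)) (site o d e (2, 1))
        (site o d e (c, 1))) (q', .seek₁)) := by
  have hinj := site_injective (o := o) he₁ he₂
  have h33 : (3 : ZMod 6) + 3 = 0 := by decide
  have s1 := steps_forward (M := M) (Φ := Φ) (o := o) (q := q) (lg₁ := .seek₁) (lg₂ := .step₁)
    (lg₃ := .act₁) (A := (0, 0)) (B := (1, 0)) hf he₁ he₂
    (by simp [regTask, hq, hk₀, hk₃, itinerary]) (by simp [regTask, hq, hk₀, hk₃, itinerary]) hlc
    (fun i h1 h2 => by simp; omega) (fun i h1 h2 => by simp; omega)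
    (fun i j h1 h2 h3 h4 => hΦ _ _ (.inl rfl))
  have s2 := steps_push (M := M) (Φ := Φ) (o := o) (q := q) (lg := .act₁) (j := k + 3)
    (z := (q, .seek₂)) (z' := (q, .act₁))
    (A := (0, 0)) (B := (1, 0)) (c := c) (T := (c, 1)) hf he₁ he₂
    (by simp [regTask, hq, hk₀, hk₃, itinerary])
    (by
      have : d + 3 + (hand .marker1).sign * (k + 3) = e := by
        rw [mul_add, Handedness.sign_mul_three, ← he .marker1]
        linear_combination h33
      rw [this, site_add_side]; rfl)
    (by simp) (by simp; omega) (by simp; omega) (by simp; omega) (by simp; omega)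
    (by simp) (by simp) (by simp)
    (hΦ _ _ (.inl rfl)) (hΦ _ _ (.inl rfl)) (hΦ _ _ (.inl rfl))
  have s3 := steps_backward (M := M) (Φ := Φ) (o := o) (q := q) (lg₁ := .seek₂) (lg₂ := .step₂)
    (lg₃ := .act₂) (A := (0, 0)) (C := (c, 1)) (b := 1) (l := c - 1) hf he₁ he₂
    (by simp [regTask, hq, hk₀, hk₃, itinerary]) (by simp [regTask, hq, hk₀, hk₃, itinerary])
    (by omega)
    (fun i h1 h2 => by simp; omega) (fun i h1 h2 => by simp)
    (fun i j h1 h2 h3 h4 => hΦ _ _ (.inl rfl))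
  have s4 := adv_send_shiftBoth (task := regTask M) (x := (q, .act₂)) (y := (q, .act₂))
    (z := (q, .act₃)) (hand := hand) (f := f) (Φ := Φ) (E := d) (p := 3) (j := k)
    (a := site o d e (0, 0)) (b := site o d e (1, 0)) (l := site o d e (1 + 1, 0))
    (c := site o d e (c, 1)) (a' := site o d e (0, 1)) (b' := site o d e (1, 1))
    (by simp [regTask, hq, hk₀, hk₃, itinerary])
    (by rw [Handedness.dir_add_three, hf, add_assoc, h33, add_zero])
    (by rw [site_add_axis]) (by rw [site_add_axis]; rfl)
    (hinj.ne (by simp)) (hinj.ne (by simp)) (hinj.ne (by simp)) (hinj.ne (by simp))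
    (by rw [he, site_add_side]; rfl) (by rw [he, site_add_side]; rfl)
    (hinj.ne (by simp)) (hinj.ne (by simp)) (hinj.ne (by simp; omega)) (hinj.ne (by simp))
    (hinj.ne (by simp)) (hinj.ne (by simp; omega))
    (hΦ _ _ (.inl rfl)) (hΦ _ _ (.inr rfl)) (hΦ _ _ (.inr rfl)) (hΦ _ _ (.inr rfl))
    (hΦ _ _ (.inr rfl))
  have s5 := adv_step (task := regTask M) (x := (q, .act₃)) (y := (q', .seek₁))
    (hand := hand) (f := f) (Φ := Φ) (p := k)
    (pos := quad (site o d e (0, 1)) (site o d e (1, 1)) (site o d e (1 + 1, 0))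
      (site o d e (c, 1)))
    (v := site o d e (2, 1)) (by simp [regTask, hq, hk₀, hk₃, itinerary])
    (by rw [Handedness.dir_add, hf, he, quad_leader, site_add_side]; rfl)
    ((forall_quad (P := fun g => g ≠ site o d e (2, 1))).2
      ⟨hinj.ne (by simp), hinj.ne (by simp), hinj.ne (by simp), hinj.ne (by simp; omega)⟩)
    (hΦ _ _ (.inr rfl)) (by rw [update_quad_leader]; exact hΦ _ _ (.inr rfl))
  rw [update_quad_leader] at s5
  exact s1.trans (s2.trans (s3.trans (s4.steps.trans s5.steps)))

end Moves

end Commands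

end Amoebot

namespace Amoebot

/-! ### Machines realized by four particles -/

/-- The condition `Layout`, in terms of the heads and the tails of the particles. -/
def OnLine (o : Grid) (d : ZMod 6) (H T : Role → Grid) : Prop :=
  ∃ h t : Role → ℤ,
    (∀ i, H i = o + h i • unitVec d ∧ T i = o + t i • unitVec d) ∧
    h Role.pivot = 0 ∧ t Role.pivot = 0 ∧
    0 < min (h Role.marker2) (t Role.marker2) ∧
    max (h Role.marker2) (t Role.marker2) < min (h Role.leader) (t Role.leader) ∧
    max (h Role.leader) (t Role.leader) < min (h Role.marker1) (t Role.marker1)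

theorem onLine_site {o : Grid} {d e : ZMod 6} {b l c b' l' c' : ℤ} (h1 : 0 < min b b')
    (h2 : max b b' < min l l') (h3 : max l l' < min c c') :
    OnLine o d
      (quad (site o d e (0, 0)) (site o d e (b, 0)) (site o d e (l, 0)) (site o d e (c, 0)))
      (quad (site o d e (0, 0)) (site o d e (b', 0)) (site o d e (l', 0)) (site o d e (c', 0))) := by
  refine ⟨quad 0 b l c, quad 0 b' l' c', fun i => ?_, rfl, rfl, h1, h2, h3⟩
  cases i <;> simp [site]

/-- What holds during the execution of a command: the state of the leader, from which the control
state of the machine is retrieved by `read`, and the position of the pivot are related by `W`, and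
the particles are on their line in their order unless `mv` holds. -/
structure Good {V : Simulator} {α : Type} (read : V.alg.State → α) (d : ZMod 6)
    (W : α → Grid → Prop) (mv : Prop) (X : V.Cfg) : Prop where
  rel : W (read (X .leader).state) (X .pivot).head
  layout : ¬ mv → Layout (X .pivot).head d X

/-- One or more changes of the configuration, all but the last one satisfying `Good`. -/
abbrev GoodSteps {V : Simulator} {α : Type} (hand : Role → Handedness) (read : V.alg.State → α)
    (d : ZMod 6) (W : α → Grid → Prop) (mv : Prop) : V.Cfg → V.Cfg → Prop :=
  Relation.TransGen fun Y Z => Next hand Y Z ∧ Good read d W mv Y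

/-- The displacement of the system by a move in the direction number `k`. -/
def moveVec (hand : Role → Handedness) (d k : ZMod 6) : Grid :=
  unitVec (d + (hand .leader).sign * k)

/-- `Rel` relates the configurations of a machine to the configurations of the particles that
represent them, so that the particles simulate the machine. The registers are represented as the
pair `enc`, their initial contents have to satisfy `init`, and moves are possible if the contents
satisfy `ok`. -/
structure Simulates (V : Simulator) {R Q : Type} [DecidableEq R] (read : V.alg.State → Q)
    (M : Q → Cmd R Q) (q₀ : Q) (enc : (R → ℕ) → ℕ × ℕ) (init ok : (R → ℕ) → Prop)
    (hand : Role → Handedness) (d : ZMod 6) (Rel : St R Q → V.Cfg → Prop) : Prop where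
  start : ∀ {o g X}, init g → V.Starts hand o d (enc g).1 (enc g).2 X → Rel ⟨q₀, g, o⟩ X
  encodes : ∀ {s X}, Rel s X → Encodes s.pos d (enc s.regs).1 (enc s.regs).2 X
  read_eq : ∀ {s X}, Rel s X → read (X .leader).state = s.q
  stuck : ∀ {s X}, Rel s X → M s.q = .halt → Stuck hand X
  run : ∀ {W mv s s' X}, Rel s X → Run M (moveVec hand d) W (fun g => mv ∧ ok g) s s' →
    ∃ X', Rel s' X' ∧ GoodSteps hand read d W mv X X'

/-- The particles with the algorithm and the initial states `V` simulate the machine `M`, provided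
that the port numberings have the same sense of rotation if the machine makes moves. -/
def Realizes (V : Simulator) {R Q : Type} [DecidableEq R] (read : V.alg.State → Q)
    (M : Q → Cmd R Q) (q₀ : Q) (enc : (R → ℕ) → ℕ × ℕ) (init ok : (R → ℕ) → Prop) : Prop :=
  ∀ hand d, ((∃ q, (M q).IsMove) → CommonRotation hand) →
    ∃ Rel, Simulates V read M q₀ enc init ok hand d Rel

/-- The simulation of several steps, one after the other. -/
theorem Simulates.runs {V : Simulator} {R Q : Type} [DecidableEq R] {read : V.alg.State → Q}
    {M : Q → Cmd R Q} {q₀ : Q} {enc : (R → ℕ) → ℕ × ℕ} {init ok : (R → ℕ) → Prop}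
    {hand : Role → Handedness} {d : ZMod 6} {Rel : St R Q → V.Cfg → Prop}
    (h : Simulates V read M q₀ enc init ok hand d Rel) {W : Q → Grid → Prop} {mv : Prop}
    {s s' : St R Q} {X : V.Cfg} (hX : Rel s X)
    (hs : Relation.TransGen (Run M (moveVec hand d) W fun g => mv ∧ ok g) s s') :
    ∃ X', Rel s' X' ∧ GoodSteps hand read d W mv X X' := by
  induction hs with
  | single hs => exact h.run hX hs
  | tail _ hs ih =>
    obtain ⟨Y, hY, hXY⟩ := ih
    obtain ⟨Z, hZ, hYZ⟩ := h.run hY hs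
    exact ⟨Z, hZ, hXY.trans hYZ⟩

section Base

variable {Q : Type} [Finite Q]

/-- The algorithm and the initial states for a machine with two registers. -/
noncomputable def regSim (M : Q → Cmd (Fin 2) Q) (q₀ : Q) : Simulator where
  alg := taskAlg (regTask M)
  pivot := .inr .idle
  marker2 := .inr .idle
  leader f := .inl (f, (q₀, .seek₁), .start)
  marker1 := .inr .idle

/-- The control state that is stored by the leader. -/
def regRead (q₀ : Q) : PState (Q × Leg) → Q
  | .inl (_, (q, _), _) => q
  | .inr _ => q₀

variable {M : Q → Cmd (Fin 2) Q} {q₀ : Q} {hand : Role → Handedness} {d : ZMod 6}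

/-- The vertices of the four particles on their line. -/
def linePos (o : Grid) (d : ZMod 6) (b l c : ℤ) : Role → Grid :=
  quad o (o + b • unitVec d) (o + l • unitVec d) (o + c • unitVec d)

theorem linePos_eq_quad (o : Grid) (d e : ZMod 6) (b l c : ℤ) : linePos o d b l c =
    quad (site o d e (0, 0)) (site o d e (b, 0)) (site o d e (l, 0)) (site o d e (c, 0)) := by
  simp [linePos, site]

/-- The configuration represents a configuration of the machine, and the leader is about to execute
the next command. -/
def Ready (M : Q → Cmd (Fin 2) Q) (hand : Role → Handedness) (d : ZMod 6) (s : St (Fin 2) Q)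
    (X : Config (taskAlg (regTask M)) Role) : Prop :=
  ∃ f, (hand .leader).dir f = d ∧ ∃ l b c : ℤ, b = s.regs 1 + 1 ∧ c = s.regs 0 + s.regs 1 + 3 ∧
    b < l ∧ l < c ∧ X = rest _ f (linePos s.pos d b l c) (s.q, .seek₁)

theorem ready_of_starts {o : Grid} {g : Fin 2 → ℕ} {X : (regSim M q₀).Cfg}
    (h : (regSim M q₀).Starts hand o d (g 0) (g 1) X) : Ready M hand d ⟨q₀, g, o⟩ X := by
  obtain ⟨⟨h0, hP, h2, ⟨j, hj, hL⟩, h1⟩, sP, s2, sL, s1, hbox⟩ := h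
  refine ⟨(hand .leader).port d, Handedness.dir_port _ _, g 1 + 1 + (j + 1), _, _, rfl, rfl,
    by dsimp only; omega, by dsimp only; omega, ?_⟩
  have key : ∀ i, (X i).head = linePos o d (g 1 + 1) (g 1 + 1 + (j + 1)) (g 0 + g 1 + 3) i := by
    intro i
    cases i
    · exact hP
    · rw [h2]
      simp only [linePos, quad_marker2]
      rw [← natCast_zsmul]; push_cast; rfl
    · rw [hL]
      simp only [linePos, quad_leader]
      rw [← natCast_zsmul]; push_cast; rfl
    · rw [h1]
      simp only [linePos, quad_marker1]
      rw [← natCast_zsmul]; push_cast; congr 2; ring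
  funext i
  refine Particle.ext' (key i) ((h0 i).symm.trans (key i)) ?_ (fun p m => ?_)
  · cases i
    · exact sP
    · exact s2
    · exact sL
    · exact s1
  · rw [hbox]; simp [rest, noMsg]

theorem Ready.encodes {s : St (Fin 2) Q} {X : Config (taskAlg (regTask M)) Role}
    (h : Ready M hand d s X) : Encodes s.pos d (s.regs 0) (s.regs 1) X := by
  obtain ⟨f, hf, l, b, c, rfl, rfl, h1, h2, rfl⟩ := h
  refine ⟨fun i => rfl, rfl, ?_, ⟨(l - s.regs 1 - 2).toNat, by omega, ?_⟩, ?_⟩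
  · simp only [rest, linePos, quad_marker2]
    rw [← natCast_zsmul]; push_cast; rfl
  · simp only [rest, linePos, quad_leader]
    rw [← natCast_zsmul]; push_cast; congr 2; omega
  · simp only [rest, linePos, quad_marker1]
    rw [← natCast_zsmul]; push_cast; congr 2; ring

theorem Ready.stuck {s : St (Fin 2) Q} {X : Config (taskAlg (regTask M)) Role}
    (h : Ready M hand d s X) (hM : M s.q = .halt) : Stuck hand X := by
  obtain ⟨f, -, l, b, c, -, -, -, -, rfl⟩ := h
  exact stuck_rest (by simp [regTask, hM])

/-- The guard during the execution of the command in the control state `q`. -/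
def guardOf (W : Q → Grid → Prop) (mv : Prop) (d : ZMod 6) (q : Q) (H T : Role → Grid) : Prop :=
  W q (H .pivot) ∧ (¬ mv → OnLine (H .pivot) d H T)

theorem Steps.good {W : Q → Grid → Prop} {mv : Prop} {q : Q}
    {X Y : Config (taskAlg (regTask M)) Role} (h : Steps M hand (guardOf W mv d q) q X Y) :
    GoodSteps (V := regSim M q₀) hand (regRead q₀) d W mv X Y := by
  refine Relation.TransGen.mono ?_ _ _ h
  rintro X Y ⟨h1, ⟨h2, h3⟩, f, leg, ph, h4⟩
  refine ⟨h1, ?_, h3⟩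
  rw [h4]
  exact h2

theorem sign_mul_eq_of_commonRotation (h : CommonRotation hand) (i j : Role) (k : ZMod 6) :
    (hand i).sign * k = (hand j).sign * k := by
  unfold Handedness.sign
  rw [h i j]

theorem add_sign_mul_ne {s d k : ZMod 6} (hs : s = 1 ∨ s = -1) (h0 : k ≠ 0) (h3 : k ≠ 3) :
    d + s * k ≠ d ∧ d + s * k ≠ d + 3 := by
  have : ∀ k : ZMod 6, k ≠ 0 → k ≠ 3 → -k ≠ 0 ∧ -k ≠ 3 := by decide
  rcases hs with rfl | rfl
  · simpa using ⟨h0, h3⟩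
  · simpa using this k h0 h3

/-- The particles carry out the commands of a machine with two registers; moves require the second
register to be zero. -/
theorem Ready.run (hM : ∀ q, (M q).Basic) (hcom : (∃ q, (M q).IsMove) → CommonRotation hand)
    {W : Q → Grid → Prop} {mv : Prop} {s s' : St (Fin 2) Q}
    {X : Config (taskAlg (regTask M)) Role} (hX : Ready M hand d s X)
    (hs : Run M (moveVec hand d) W (fun g => mv ∧ g 1 = 0) s s') :
    ∃ X', Ready M hand d s' X' ∧
      GoodSteps (V := regSim M q₀) hand (regRead q₀) d W mv X X' := by
  suffices ∃ X', Ready M hand d s' X' ∧ Steps M hand (guardOf W mv d s.q) s.q X X' from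
    this.imp fun X' h => ⟨h.1, Steps.good h.2⟩
  obtain ⟨q, g, o⟩ := s
  obtain ⟨hs, hW, hW', hK⟩ := hs
  obtain ⟨f, hf, l, b, c, hb, hc, hbl, hlc, rfl⟩ := hX
  dsimp only at *
  have hbasic := hM q
  have hb0 : 0 < b := by omega
  -- only sideways moves leave the line; for the rest any second axis does, such as `d + 1`
  have e1 : d + 1 ≠ d := by simpa using (by decide : (1 : ZMod 6) ≠ 0)
  have e2 : d + 1 ≠ d + 3 := by simpa using (by decide : (1 : ZMod 6) ≠ 3)
  have hguard : ∀ b l c b' l' c' : ℤ, 0 < min b b' → max b b' < min l l' →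
      max l l' < min c c' → guardOf W mv d q
        (quad (site o d (d + 1) (0, 0)) (site o d (d + 1) (b, 0)) (site o d (d + 1) (l, 0))
          (site o d (d + 1) (c, 0)))
        (quad (site o d (d + 1) (0, 0)) (site o d (d + 1) (b', 0)) (site o d (d + 1) (l', 0))
          (site o d (d + 1) (c', 0))) := by
    intro b l c b' l' c' h1 h2 h3
    have h4 := onLine_site (o := o) (d := d) (e := d + 1) h1 h2 h3
    have h5 : site o d (d + 1) (0, 0) = o := by simp [site]
    refine ⟨?_, fun _ => ?_⟩
    · rw [quad_pivot, h5]; exact hW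
    · rw [quad_pivot]
      nth_rewrite 1 [h5]
      exact h4
  cases hq : M q with
  | mulAdd r b a q' => simp [hq, Cmd.Basic] at hbasic
  | divMod r b f => simp [hq, Cmd.Basic] at hbasic
  | halt => simp [hq, Cmd.exec] at hs
  | inc r q' =>
    simp only [hq, Cmd.exec, Option.some.injEq] at hs
    subst hs
    rw [linePos_eq_quad o d (d + 1)]
    fin_cases r
    · have := steps_inc_zero (M := M) hf e1 e2 hguard hb0 hbl hlc hq
      refine ⟨_, ⟨f, hf, c - 1, b, c + 1, ?_, ?_, ?_, ?_, ?_⟩, this⟩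
      · simpa using hb
      · simp; omega
      · omega
      · omega
      · rw [linePos_eq_quad o d (d + 1)]
    · have := steps_inc_one (M := M) hf e1 e2 hguard hb0 hbl hlc hq
      refine ⟨_, ⟨f, hf, b + 2, b + 1, c + 1, ?_, ?_, ?_, ?_, ?_⟩, this⟩
      · simpa using hb
      · simp; omega
      · omega
      · omega
      · rw [linePos_eq_quad o d (d + 1)]
  | dec r q₁ q₂ =>
    simp only [hq, Cmd.exec, Option.some.injEq] at hs
    rw [linePos_eq_quad o d (d + 1)]
    fin_cases r
    · have := steps_dec_zero (M := M) hf e1 e2 hguard hb0 hbl hlc hq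
      by_cases h0 : g 0 = 0
      · simp only [Fin.zero_eta, h0, if_true] at hs
        subst hs
        refine ⟨_, ⟨f, hf, c - 1, b, c, hb, hc, ?_, ?_, ?_⟩, this.1 (by omega)⟩
        · omega
        · omega
        · rw [linePos_eq_quad o d (d + 1)]
      · simp only [Fin.zero_eta, h0, if_false] at hs
        subst hs
        refine ⟨_, ⟨f, hf, c - 2, b, c - 1, ?_, ?_, ?_, ?_, ?_⟩, this.2 (by omega)⟩
        · simpa using hb
        · simp; omega
        · omega
        · omega
        · rw [linePos_eq_quad o d (d + 1)]
    · have := steps_dec_one (M := M) hf e1 e2 hguard hb0 hbl hlc hq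
      by_cases h0 : g 1 = 0
      · simp only [Fin.mk_one, h0, if_true] at hs
        subst hs
        refine ⟨_, ⟨f, hf, b + 1, b, c, hb, hc, ?_, ?_, ?_⟩, this.1 (by omega)⟩
        · omega
        · omega
        · rw [linePos_eq_quad o d (d + 1)]
      · simp only [Fin.mk_one, h0, if_false] at hs
        subst hs
        refine ⟨_, ⟨f, hf, c - 2, b - 1, c - 1, ?_, ?_, ?_, ?_, ?_⟩, this.2 (by omega)⟩
        · simp; omega
        · simp; omega
        · omega
        · omega
        · rw [linePos_eq_quad o d (d + 1)]
  | op k q' =>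
    simp only [hq, Cmd.exec, Option.some.injEq] at hs
    subst hs
    cases k with
    | none =>
      have hl := adv_look (task := regTask M) (hand := hand) (Φ := guardOf W mv d q) (f := f)
        (x := (q, .seek₁)) (y := (q', .seek₁)) (z := (q', .seek₁)) (p := 0)
        (pos := linePos o d b l c) (by simp [regTask, hq])
        (by
          rw [linePos_eq_quad o d (d + 1)]
          exact hguard _ _ _ _ _ _ (by omega) (by omega) (by omega))
      refine ⟨_, ⟨f, hf, l, b, c, hb, hc, hbl, hlc, rfl⟩, ?_⟩
      simp only [Option.elim_none, add_zero]
      by_cases h : ∃ i, linePos o d b l c i = linePos o d b l c .leader +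
          unitVec ((hand .leader).dir (f + 0))
      · exact (hl.2 h).steps
      · exact (hl.1 h).steps
    | some k =>
      have hmove : (M q).IsMove := by simp [hq, Cmd.IsMove]
      obtain ⟨hmv, hg⟩ := hK hmove
      simp only [Option.elim_some] at hW' ⊢
      -- the second register is zero, hence `M₂` is next to the pivot
      have hb1 : b = 1 := by rw [hb, hg]; simp
      subst hb1
      by_cases hk0 : k = 0
      · subst hk0
        have hv : moveVec hand d 0 = unitVec d := by simp [moveVec]
        rw [linePos_eq_quad o d (d + 1)]
        rw [hv] at hW' ⊢
        have := steps_move_forward (M := M) (Φ := guardOf W mv d q) (o := o) hf e1 e2 hbl hlc hq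
          rfl (fun h t ht => ⟨by
            rcases ht with ht | ht
            · rw [ht]; simpa [site] using hW
            · rw [ht]; simpa [site] using hW', fun h => absurd hmv h⟩)
        refine ⟨_, ⟨f, hf, 2, 1, c, hb, hc, ?_, ?_, ?_⟩, this⟩
        · omega
        · omega
        · dsimp only
          congr 1
          simp only [linePos, site]
          congr 1 <;> simp only [add_smul, one_smul, zero_smul, add_zero, ofNat_smul_eq_nsmul] <;>
            abel
      · by_cases hk3 : k = 3
        · subst hk3
          have hv : moveVec hand d 3 = -unitVec d := by
            rw [moveVec, Handedness.sign_mul_three, unitVec_add_three]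
          rw [linePos_eq_quad o d (d + 1)]
          rw [hv] at hW' ⊢
          have := steps_move_backward (M := M) (Φ := guardOf W mv d q) (o := o) hf e1 e2 hbl hlc hq
            rfl (fun h t ht => ⟨by
              rcases ht with ht | ht
              · rw [ht]; simpa [site] using hW
              · rw [ht]; simpa [site] using hW', fun h => absurd hmv h⟩)
          refine ⟨_, ⟨f, hf, c - 1, 1, c, hb, hc, ?_, ?_, ?_⟩, this⟩
          · omega
          · omega
          · dsimp only
            congr 1
            simp only [linePos, site]
            congr 1 <;> simp only [sub_smul, one_smul, zero_smul, add_zero, neg_smul, two_smul] <;>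
              abel
        · have hsign : (hand .leader).sign = 1 ∨ (hand .leader).sign = -1 := by
            unfold Handedness.sign
            split_ifs <;> simp
          obtain ⟨e3, e4⟩ := add_sign_mul_ne (d := d) hsign hk0 hk3
          have hcr := hcom ⟨q, hmove⟩
          -- the direction of the move is the second axis
          rw [linePos_eq_quad o d (d + (hand .leader).sign * k)]
          have := steps_move_sideways (M := M) (Φ := guardOf W mv d q) (o := o) hf e3 e4 hbl hlc hq
            hk0 hk3 (fun i => by rw [sign_mul_eq_of_commonRotation hcr i .leader])
            (fun h t ht => ⟨by
              rcases ht with ht | ht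
              · rw [ht]; simpa [site] using hW
              · rw [ht]; simpa [site, moveVec] using hW', fun h => absurd hmv h⟩)
          refine ⟨_, ⟨f, hf, 2, 1, c, hb, hc, ?_, ?_, ?_⟩, this⟩
          · omega
          · omega
          · dsimp only
            congr 1
            simp only [linePos, site, moveVec]
            congr 1 <;> simp only [one_smul, zero_smul, add_zero] <;> abel

/-- Machines with two registers and without arithmetical commands are realized by four particles. -/
theorem realizes_regSim (hM : ∀ q, (M q).Basic) : Realizes (regSim M q₀) (regRead q₀) M q₀
    (fun g => (g 0, g 1)) (fun _ => True) (fun g => g 1 = 0) := by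
  intro hand d hcom
  refine ⟨Ready M hand d, fun _ h => ready_of_starts h, Ready.encodes, ?_, Ready.stuck,
    fun hX hs => Ready.run hM hcom hX hs⟩
  rintro s X ⟨f, -, l, b, c, -, -, -, -, rfl⟩
  rfl

end Base

section Lift

variable {V : Simulator} {R Q : Type} [DecidableEq R] {M : Q → Cmd R Q} {q₀ : Q}

/-- Arithmetical commands can be dispensed with at the cost of a scratch register. -/
theorem Realizes.of_expandLoops {enc : (R → ℕ) → ℕ × ℕ} {init ok : (R → ℕ) → Prop} {z : R}
    {N : ℕ} {read : V.alg.State → Q × LoopPhase × Fin (N + 1)}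
    (hM : ∀ q, (M q).Avoids z N)
    (h : Realizes V read (expandLoops M z N) (q₀, .home, 0) enc init ok) :
    Realizes V (fun s => (read s).1) M q₀ enc (fun g => init g ∧ g z = 0) ok := by
  intro hand d hcom
  obtain ⟨Rel, hRel⟩ := h hand d fun ⟨q, hq⟩ => hcom ⟨_, isMove_of_expandLoops hq⟩
  refine ⟨fun s X => Rel ⟨(s.q, .home, 0), s.regs, s.pos⟩ X ∧ s.regs z = 0,
    fun hi hX => ⟨hRel.start hi.1 hX, hi.2⟩, fun hX => hRel.encodes hX.1,
    fun hX => by rw [hRel.read_eq hX.1], fun hX hh => hRel.stuck hX.1 (by simp [expandLoops, hh]),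
    fun hX hs => ?_⟩
  obtain ⟨h1, h2⟩ := expandLoops_run hM hX.2 hs
  obtain ⟨X', h3, h4⟩ := hRel.runs hX.1 h1
  refine ⟨X', ⟨h3, h2⟩, Relation.TransGen.mono ?_ _ _ h4⟩
  rintro Y Z ⟨h5, h6, h7⟩
  exact ⟨h5, h6, h7⟩

/-- Many registers can be replaced by one that holds their Gödel number. The other register is then
empty at every move. -/
theorem Realizes.of_goedelize [Fintype R] {pr : R → ℕ} {N : ℕ}
    {read : V.alg.State → Q × Option (Fin (N + 1))} (hp : ∀ r, (pr r).Prime)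
    (hinj : Function.Injective pr) (hN : ∀ r, pr r ≤ N) (hM : ∀ q, (M q).Basic)
    (h : Realizes V read (goedelize M pr N) (q₀, none) (fun g => (g 0, g 1))
      (fun g => True ∧ g 1 = 0) (fun g => g 1 = 0)) :
    Realizes V (fun s => (read s).1) M q₀ (fun g => (goedelNum pr g, 0)) (fun _ => True)
      (fun _ => True) := by
  intro hand d hcom
  obtain ⟨Rel, hRel⟩ := h hand d fun ⟨q, hq⟩ => hcom ⟨_, isMove_of_goedelize hq⟩
  refine ⟨fun s X => Rel (goedelSt pr N s) X,
    fun _ hX => hRel.start (by simp) (by simpa using hX), fun hX => by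
      simpa [goedelSt] using hRel.encodes hX,
    fun hX => by rw [hRel.read_eq hX]; rfl,
    fun hX hh => hRel.stuck hX (by simp [goedelSt, goedelize, hh]), fun {W mv s s' X} hX hs => ?_⟩
  have h1 := goedelize_run (mv := mv) hp hinj hN (fun g hg => hg.1) hM hs
  obtain ⟨X', h3, h4⟩ := hRel.runs hX h1
  refine ⟨X', h3, Relation.TransGen.mono ?_ _ _ h4⟩
  rintro Y Z ⟨h5, h6, h7⟩
  exact ⟨h5, h6, h7⟩

/-- Every machine with finitely many registers is realized by four particles, its registers being
coded in a Gödel number. -/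
theorem exists_realizes_goedelNum [Finite Q] [Fintype R] (q₀ : Q) {pr : R → ℕ}
    (hp : ∀ r, (pr r).Prime) (hinj : Function.Injective pr) (hM : ∀ q, (M q).Basic) :
    ∃ (V : Simulator) (read : V.alg.State → Q), Realizes V read M q₀
      (fun g => (goedelNum pr g, 0)) (fun _ => True) (fun _ => True) := by
  obtain ⟨N, hN⟩ : ∃ N, ∀ r, pr r ≤ N :=
    ⟨∑ r, pr r, fun r => Finset.single_le_sum (fun _ _ => Nat.zero_le _) (Finset.mem_univ r)⟩
  have h1 := goedelize_avoids (M := M) (fun r => (hp r).pos) hN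
  exact ⟨_, _, .of_goedelize hp hinj hN hM (.of_expandLoops h1
    (realizes_regSim (expandLoops_basic (goedelize M pr N) 1 N)))⟩

/-- Machines with arithmetical commands are realized by four particles, too, if a register is
reserved for the computation of these commands. -/
theorem exists_realizes_avoids [Finite Q] [Fintype R] (q₀ : Q) {pr : R → ℕ}
    (hp : ∀ r, (pr r).Prime) (hinj : Function.Injective pr) {z : R} {N : ℕ}
    (hM : ∀ q, (M q).Avoids z N) :
    ∃ (V : Simulator) (read : V.alg.State → Q), Realizes V read M q₀
      (fun g => (goedelNum pr g, 0)) (fun g => True ∧ g z = 0) (fun _ => True) := by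
  obtain ⟨V, read, h⟩ := exists_realizes_goedelNum (M := expandLoops M z N) (q₀, .home, 0) hp hinj
    (expandLoops_basic M z N)
  exact ⟨V, _, .of_expandLoops hM h⟩

end Lift

end Amoebot

namespace Amoebot

/-! ### Simulation of controllers -/

theorem Encodes.layout {A : Algorithm} {o : Grid} {d : ZMod 6} {r₁ r₂ : ℕ} {X : Config A Role}
    (h : Encodes o d r₁ r₂ X) : Layout o d X := by
  obtain ⟨h0, hP, h2, ⟨j, hj, hL⟩, h1⟩ := h
  refine ⟨quad 0 (r₂ + 1 : ℕ) (r₂ + 1 + (j + 1) : ℕ) (r₂ + 1 + (r₁ + 2) : ℕ),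
    quad 0 (r₂ + 1 : ℕ) (r₂ + 1 + (j + 1) : ℕ) (r₂ + 1 + (r₁ + 2) : ℕ), fun i => ?_, rfl, rfl,
    ?_, ?_, ?_⟩
  · rw [← h0 i, and_self]
    cases i
    · simpa using hP
    · rw [h2, quad_marker2, natCast_zsmul]
    · rw [hL, quad_leader, natCast_zsmul]
    · rw [h1, quad_marker1, natCast_zsmul]
  · simp
  · simp
  · simp; omega

theorem exists_between {τ : ℕ → ℕ} (hτ : StrictMono τ) {t : ℕ} (ht : τ 0 ≤ t) :
    ∃ k, τ k ≤ t ∧ t < τ (k + 1) := by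
  induction t, ht using Nat.le_induction with
  | base => exact ⟨0, le_rfl, hτ (by omega)⟩
  | succ t _ ih =>
    obtain ⟨k, h1, h2⟩ := ih
    by_cases h : t + 1 < τ (k + 1)
    · exact ⟨k, by omega, h⟩
    · exact ⟨k + 1, by omega, lt_of_le_of_lt h2 (hτ (by omega))⟩

namespace Controller

variable {S : Type} {m : ℕ} {K : Controller S m}

theorem disp_empty (d s : ZMod 6) : K.disp d s ∅ = 0 := by simp [disp]

theorem disp_eq_zero {d s : ZMod 6} {G : Finset (Fin m)}
    (h : ∀ f ∈ G, ∀ j, K.op f ≠ .move j) : K.disp d s G = 0 := by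
  refine Finset.sum_eq_zero fun f hf => ?_
  have := h f hf
  cases hop : K.op f with
  | move k => exact absurd hop (this k)
  | terminate => rfl
  | signal => rfl

/-- If the particles, represented by `Inv`, simulate every single step of the controller, they
simulate its run. -/
theorem exists_simulatedBy {code : S → ℕ → ℕ → Prop} {ρ : Type} {view : S → ρ} {V : Simulator}
    {read : V.alg.State → ρ} {hand : Role → Handedness} {d s : ZMod 6}
    (Inv : S → Grid → V.Cfg → Prop)
    (hcode : ∀ x p X, Inv x p X → ∃ r₁ r₂, code x r₁ r₂ ∧ Encodes p d r₁ r₂ X)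
    (hview : ∀ x p X, Inv x p X → read (X .leader).state = view x)
    (hstuck : ∀ x p X, Inv x p X → K.Halted x → Stuck hand X)
    (hstep : ∀ x x' p X, Inv x p X → ¬ K.Halted x → K.next x = some x' →
      ∃ X', Inv x' (p + K.disp d s (K.flags x')) X' ∧
        GoodSteps hand read d
          (fun r p' => r = view x ∧ ∃ G ⊆ K.flags x', p' = p + K.disp d s G)
          (∃ f ∈ K.flags x', ∃ j, K.op f = .move j) X X')
    {active : ℕ → Set Role} {C : ℕ → V.Cfg} (hC : FairExecution hand active C)
    {x₀ : S} {o : Grid} {T : ℕ} (hT : Inv x₀ o (C T)) :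
    ∃ τ : ℕ → ℕ, τ 0 = T ∧ K.SimulatedBy code view read d s x₀ o τ C := by
  -- the part of the claim that concerns a single step
  have key : ∀ k t, Inv (K.run d s x₀ o k).1 (K.run d s x₀ o k).2 (C t) → ∃ t' > t,
      Inv (K.run d s x₀ o (k + 1)).1 (K.run d s x₀ o (k + 1)).2 (C t') ∧
      (∀ u, t ≤ u → u < t' → read (C u .leader).state = view (K.run d s x₀ o k).1) ∧
      (¬ K.Halted (K.run d s x₀ o k).1 → ∀ u, t ≤ u → u ≤ t' →
        (∃ G ⊆ K.flags (K.run d s x₀ o (k + 1)).1,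
          (C u .pivot).head = (K.run d s x₀ o k).2 + K.disp d s G) ∧
        ((∀ f ∈ K.flags (K.run d s x₀ o (k + 1)).1, ∀ j, K.op f ≠ .move j) →
          Layout (K.run d s x₀ o k).2 d (C u))) := by
    intro k t hk
    by_cases hh : K.Halted (K.run d s x₀ o k).1
    · have h1 : K.run d s x₀ o (k + 1) = K.run d s x₀ o k := by
        rw [run]; simp only [hh, if_true]
      have h2 := hC.of_stuck (hstuck _ _ _ hk hh)
      refine ⟨t + 1, by omega, ?_, fun u hu hu' => ?_, fun h => absurd hh h⟩
      · rw [h1, h2 _ (by omega)]; exact hk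
      · rw [h2 u hu]; exact hview _ _ _ hk
    · obtain ⟨x', hx'⟩ : ∃ x', K.next (K.run d s x₀ o k).1 = some x' :=
        Option.ne_none_iff_exists'.1 fun h => hh (.inl h)
      have h1 : K.run d s x₀ o (k + 1) =
          (x', (K.run d s x₀ o k).2 + K.disp d s (K.flags x')) := by
        rw [run]; simp only [hh, if_false, hx']
      obtain ⟨X', hX', hrun⟩ := hstep _ _ _ _ hk hh hx'
      obtain ⟨t', ht, rfl, hP⟩ := hC.of_transGen hrun
      rw [h1]
      refine ⟨t', ht, hX', fun u hu hu' => (hP u hu hu').rel.1, fun _ u hu hu' => ?_⟩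
      rcases hu'.lt_or_eq with hu' | rfl
      · obtain ⟨⟨-, G, hG, hp⟩, hl⟩ := hP u hu hu'
        refine ⟨⟨G, hG, hp⟩, fun hno => ?_⟩
        have := hl (by rintro ⟨f, hf, j, hj⟩; exact hno f hf j hj)
        rwa [hp, disp_eq_zero fun f hf => hno f (hG hf), add_zero] at this
      · obtain ⟨r₁, r₂, -, he⟩ := hcode _ _ _ hX'
        refine ⟨⟨_, subset_rfl, he.2.1⟩, fun hno => ?_⟩
        have := he.layout
        rwa [disp_eq_zero hno, add_zero] at this
  choose next hgt hInv hread hpos using key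
  -- the times are found one by one, each with a proof of the invariant at this time
  let σ : (k : ℕ) → {t // Inv (K.run d s x₀ o k).1 (K.run d s x₀ o k).2 (C t)} :=
    fun k => k.rec ⟨T, hT⟩ fun k t => ⟨next k t.1 t.2, hInv k t.1 t.2⟩
  have hσ : ∀ k, (σ (k + 1)).1 = next k (σ k).1 (σ k).2 := fun k => rfl
  refine ⟨fun k => (σ k).1, rfl, strictMono_nat_of_lt_succ fun k => ?_, fun k =>
    ⟨hcode _ _ _ (σ k).2, fun t h1 h2 => hread k _ (σ k).2 t h1 h2,
      fun hh t h1 h2 => (hpos k _ (σ k).2 hh t h1 h2).1,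
      fun hh hno t h1 h2 => (hpos k _ (σ k).2 hh t h1 h2).2 hno, fun hh => ?_⟩⟩
  · rw [hσ]; exact hgt _ _ _
  · have h2 := hC.of_stuck (hstuck _ _ _ (σ k).2 hh)
    refine ⟨fun t ht => ?_, (σ k).1, fun t ht i => by rw [h2 t ht]; exact ⟨rfl, rfl⟩⟩
    rw [h2 t ht]
    exact ⟨hcode _ _ _ (σ k).2, hview _ _ _ (σ k).2⟩

end Controller

/-! ### Random-access machines with flags -/

/-- The direction number of a move; `none` for the other operations. -/
def Operation.dir : Operation → Option (ZMod 6)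
  | move k => some k
  | _ => none

theorem Operation.elim_dir (hand : Role → Handedness) (d : ZMod 6) (op : Operation) :
    op.dir.elim 0 (moveVec hand d) = op.disp d (hand .leader).sign := by
  cases op <;> rfl

/-- A random-access machine in which the registers `fl` are flags. -/
def flagRAM {R : Type} [DecidableEq R] {m : ℕ} (U : RAM.Program R) (fl : Fin m → R)
    (op : Fin m → Operation) : Controller (RAM.Cfg R) m where
  next := RAM.step U
  flags := fun x => Finset.univ.filter fun f => x.regs (fl f) ≠ 0
  op := op

/-- The phases of the simulation of a step: at `home`, the instruction is executed; then the flags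
are tested one by one, a flag that is set being decremented and restored (`test`, `back`), and the
set of flags found is collected; finally the moves are made (`mov`). The fields are the index of
the next instruction, the number of the flag, and the set of flags. -/
inductive FlagPhase (N m : ℕ)
  | home
  | test (pc : Fin (N + 1)) (j : Fin (m + 1)) (F : Finset (Fin m))
  | back (pc : Fin (N + 1)) (j : Fin (m + 1)) (F : Finset (Fin m))
  | mov (pc : Fin (N + 1)) (j : Fin (m + 1)) (F : Finset (Fin m))

instance (N m : ℕ) : Finite (FlagPhase N m) :=
  Finite.of_surjective (α := Fin 4 × Fin (N + 1) × Fin (m + 1) × Finset (Fin m))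
    (fun x => ![.home, .test x.2.1 x.2.2.1 x.2.2.2, .back x.2.1 x.2.2.1 x.2.2.2,
      .mov x.2.1 x.2.2.1 x.2.2.2] x.1) (by
    intro x
    cases x with
    | home => exact ⟨⟨0, 0, 0, ∅⟩, rfl⟩
    | test pc j F => exact ⟨⟨1, pc, j, F⟩, rfl⟩
    | back pc j F => exact ⟨⟨2, pc, j, F⟩, rfl⟩
    | mov pc j F => exact ⟨⟨3, pc, j, F⟩, rfl⟩)

section FlagRAM

variable {R : Type} {m : ℕ}

/-- The control states: the index of the current instruction, the set of flags, and the phase. -/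
abbrev FlagState (N m : ℕ) : Type := (Fin (N + 1) × Finset (Fin m)) × FlagPhase N m

open Classical in
/-- The counter machine for a random-access machine with flags. -/
noncomputable def flagCmd (U : RAM.Program R) (fl : Fin m → R) (op : Fin m → Operation) (N : ℕ) :
    FlagState N m → Cmd R (FlagState N m)
  | (x, .home) =>
    if ∃ f ∈ x.2, op f = .terminate then .halt
    else match U[(x.1 : ℕ)]? with
      | none => .halt
      | some (.inc r) => .inc r (x, .test (Fin.ofNat (N + 1) (x.1 + 1)) 0 ∅)
      | some (.testDec r i) => .dec r (x, .test (Fin.ofNat (N + 1) i) 0 ∅)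
          (x, .test (Fin.ofNat (N + 1) (x.1 + 1)) 0 ∅)
  | (x, .test pc j F) =>
    if h : (j : ℕ) < m then
      .dec (fl ⟨j, h⟩) (x, .test pc (Fin.ofNat (m + 1) (j + 1)) F) (x, .back pc j F)
    else .op none (x, .mov pc 0 F)
  | (x, .back pc j F) =>
    if h : (j : ℕ) < m then
      .inc (fl ⟨j, h⟩) (x, .test pc (Fin.ofNat (m + 1) (j + 1)) (insert ⟨j, h⟩ F))
    else .halt
  | (x, .mov pc j F) =>
    if h : (j : ℕ) < m then
      .op (if ⟨j, h⟩ ∈ F then (op ⟨j, h⟩).dir else none)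
        (x, .mov pc (Fin.ofNat (m + 1) (j + 1)) F)
    else .op none ((pc, F), .home)

variable {U : RAM.Program R} {fl : Fin m → R} {op : Fin m → Operation} {N : ℕ}

theorem flagCmd_basic (q) : (flagCmd U fl op N q).Basic := by
  obtain ⟨x, _ | _ | _ | _⟩ := q <;> simp only [flagCmd] <;> split_ifs <;> (try split) <;> trivial

theorem exists_move_of_flagCmd {q} (h : (flagCmd U fl op N q).IsMove) :
    ∃ f k, op f = .move k := by
  obtain ⟨x, _ | _ | _ | ⟨pc, j, F⟩⟩ := q <;> simp only [flagCmd] at h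
  · split_ifs at h
    · exact h.elim
    · split at h <;> exact h.elim
  · split_ifs at h <;> exact h.elim
  · split_ifs at h <;> exact h.elim
  · split_ifs at h with h1 h2
    · cases hop : op ⟨j, h1⟩ with
      | move k => exact ⟨_, _, hop⟩
      | terminate => rw [hop] at h; exact h.elim
      | signal => rw [hop] at h; exact h.elim
    · exact h.elim
    · exact h.elim

variable [DecidableEq R] {hand : Role → Handedness} {d : ZMod 6}
  {W : FlagState N m → Grid → Prop} {K : (R → ℕ) → Prop} {x : Fin (N + 1) × Finset (Fin m)}
  {p : Grid} {pc : Fin (N + 1)}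

/-- The flags are tested one by one and left as they were; after `j` of them the set of those found
non-zero is stored in the control state. -/
theorem flagCmd_test_run (hW : ∀ ph, W (x, ph) p) (g : R → ℕ) : ∀ j (hj : j ≤ m),
    Relation.ReflTransGen (Run (flagCmd U fl op N) (moveVec hand d) W K)
      ⟨(x, .test pc 0 ∅), g, p⟩
      ⟨(x, .test pc ⟨j, Nat.lt_succ_of_le hj⟩
        (Finset.univ.filter fun f : Fin m => g (fl f) ≠ 0 ∧ (f : ℕ) < j)), g, p⟩ := by
  intro j
  induction j with
  | zero =>
    intro hj
    simp only [Nat.not_lt_zero, and_false, Finset.filter_false]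
    exact .refl
  | succ j ih =>
    intro hj
    refine (ih (by omega)).trans ?_
    have hlt : j < m := hj
    have hof : Fin.ofNat (m + 1) (j + 1) = ⟨j + 1, Nat.lt_succ_of_le hj⟩ := by
      ext; simp [Fin.ofNat]; omega
    by_cases h0 : g (fl ⟨j, hlt⟩) = 0
    · have h1 := Run.of_dec_zero (M := flagCmd U fl op N) (v := moveVec hand d) (W := W) (K := K)
        (q := (x, .test pc ⟨j, by omega⟩
          (Finset.univ.filter fun f : Fin m => g (fl f) ≠ 0 ∧ (f : ℕ) < j))) (o := p)
        (by simp only [flagCmd, hlt, dif_pos]; rfl) h0 (hW _)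
      have hset : (Finset.univ.filter fun f : Fin m => g (fl f) ≠ 0 ∧ (f : ℕ) < j + 1) =
          Finset.univ.filter fun f : Fin m => g (fl f) ≠ 0 ∧ (f : ℕ) < j := by
        ext f
        simp only [Finset.mem_filter, Finset.mem_univ, true_and]
        refine and_congr_right fun hf => ?_
        have : (f : ℕ) ≠ j := fun h => hf (by rw [← h0]; congr; exact Fin.ext h)
        omega
      rw [hset]
      rw [hof] at h1
      exact .single h1
    · have h1 := Run.of_dec_pos (M := flagCmd U fl op N) (v := moveVec hand d) (W := W) (K := K)
        (q := (x, .test pc ⟨j, by omega⟩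
          (Finset.univ.filter fun f : Fin m => g (fl f) ≠ 0 ∧ (f : ℕ) < j))) (o := p)
        (by simp only [flagCmd, hlt, dif_pos]; rfl) h0 (hW _)
      have h2 := Run.of_inc (M := flagCmd U fl op N) (v := moveVec hand d) (W := W) (K := K)
        (q := (x, .back pc ⟨j, by omega⟩
          (Finset.univ.filter fun f : Fin m => g (fl f) ≠ 0 ∧ (f : ℕ) < j))) (o := p)
        (g := Function.update g (fl ⟨j, hlt⟩) (g (fl ⟨j, hlt⟩) - 1))
        (by simp only [flagCmd, hlt, dif_pos]; rfl) (hW _)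
      have hset : (Finset.univ.filter fun f : Fin m => g (fl f) ≠ 0 ∧ (f : ℕ) < j + 1) =
          insert ⟨j, hlt⟩
            (Finset.univ.filter fun f : Fin m => g (fl f) ≠ 0 ∧ (f : ℕ) < j) := by
        ext f
        simp only [Finset.mem_filter, Finset.mem_univ, true_and, Finset.mem_insert]
        constructor
        · rintro ⟨hf, hf'⟩
          by_cases hfj : (f : ℕ) = j
          · exact .inl (Fin.ext hfj)
          · exact .inr ⟨hf, by omega⟩
        · rintro (rfl | ⟨hf, hf'⟩)
          · exact ⟨h0, by simp⟩
          · exact ⟨hf, by omega⟩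
      rw [hset]
      have hg : Function.update (Function.update g (fl ⟨j, hlt⟩) (g (fl ⟨j, hlt⟩) - 1))
          (fl ⟨j, hlt⟩) (g (fl ⟨j, hlt⟩) - 1 + 1) = g := by
        rw [Function.update_idem, Nat.sub_add_cancel (Nat.pos_of_ne_zero h0),
          Function.update_eq_self]
      rw [Function.update_self, hg, hof] at h2
      exact .head h1 (.single h2)

/-- The moves of the flags in `F` are made one by one. -/
theorem flagCmd_mov_run {F : Finset (Fin m)}
    (hW : ∀ ph, ∀ G ⊆ F, W (x, ph) (p + ∑ f ∈ G, (op f).disp d (hand .leader).sign))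
    (hK : (∃ f ∈ F, ∃ k, op f = .move k) → ∀ g, K g) (g : R → ℕ) : ∀ j (hj : j ≤ m),
    Relation.ReflTransGen (Run (flagCmd U fl op N) (moveVec hand d) W K)
      ⟨(x, .mov pc 0 F), g, p⟩
      ⟨(x, .mov pc ⟨j, Nat.lt_succ_of_le hj⟩ F), g,
        p + ∑ f ∈ F.filter (fun f : Fin m => (f : ℕ) < j), (op f).disp d (hand .leader).sign⟩ := by
  intro j
  induction j with
  | zero =>
    intro hj
    simp only [Nat.not_lt_zero, Finset.filter_false, Finset.sum_empty, add_zero]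
    exact .refl
  | succ j ih =>
    intro hj
    refine (ih (by omega)).trans (.single ?_)
    have hlt : j < m := hj
    have hof : Fin.ofNat (m + 1) (j + 1) = ⟨j + 1, Nat.lt_succ_of_le hj⟩ := by
      ext; simp [Fin.ofNat]; omega
    have hsum : ∑ f ∈ F.filter (fun f : Fin m => (f : ℕ) < j + 1), (op f).disp d (hand .leader).sign =
        ∑ f ∈ F.filter (fun f : Fin m => (f : ℕ) < j), (op f).disp d (hand .leader).sign +
          (if (⟨j, hlt⟩ : Fin m) ∈ F then (op ⟨j, hlt⟩).dir else none).elim 0 (moveVec hand d) := by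
      by_cases hF : (⟨j, hlt⟩ : Fin m) ∈ F
      · have : F.filter (fun f : Fin m => (f : ℕ) < j + 1) =
            insert ⟨j, hlt⟩ (F.filter fun f : Fin m => (f : ℕ) < j) := by
          ext f
          simp only [Finset.mem_filter, Finset.mem_insert]
          constructor
          · rintro ⟨hf, hf'⟩
            by_cases hfj : (f : ℕ) = j
            · exact .inl (Fin.ext hfj)
            · exact .inr ⟨hf, by omega⟩
          · rintro (rfl | ⟨hf, hf'⟩)
            · exact ⟨hF, by simp⟩
            · exact ⟨hf, by omega⟩
        rw [this, Finset.sum_insert (by simp), if_pos hF, Operation.elim_dir, add_comm]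
      · have : F.filter (fun f : Fin m => (f : ℕ) < j + 1) = F.filter (fun f : Fin m => (f : ℕ) < j) := by
          ext f
          simp only [Finset.mem_filter]
          refine and_congr_right fun hf => ?_
          have : (f : ℕ) ≠ j := fun h => hF (by
            have : f = ⟨j, hlt⟩ := Fin.ext h
            rwa [this] at hf)
          omega
        rw [this, if_neg hF]
        simp
    have h1 := Run.of_op (M := flagCmd U fl op N) (v := moveVec hand d) (W := W) (K := K)
      (q := (x, .mov pc ⟨j, by omega⟩ F)) (g := g)
      (o := p + ∑ f ∈ F.filter (fun f : Fin m => (f : ℕ) < j), (op f).disp d (hand .leader).sign)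
      (by simp only [flagCmd, hlt, dif_pos]; rfl) (hW _ _ (Finset.filter_subset _ _))
      (by rw [add_assoc, ← hsum]; exact hW _ _ (Finset.filter_subset _ _))
      (by
        split_ifs with hF
        · intro hne
          refine hK ⟨_, hF, ?_⟩ g
          cases hop : op ⟨j, hlt⟩ with
          | move k => exact ⟨k, rfl⟩
          | terminate => rw [hop] at hne; exact absurd rfl hne
          | signal => rw [hop] at hne; exact absurd rfl hne
        · intro hne
          exact absurd rfl hne)
    rw [add_assoc, ← hsum, hof] at h1
    exact h1

/-- The configuration of the counter machine that represents a configuration of the random-access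
machine. -/
def flagSt (U : RAM.Program R) (fl : Fin m → R) (op : Fin m → Operation) (N : ℕ) (x : RAM.Cfg R)
    (p : Grid) : St R (FlagState N m) :=
  ⟨((Fin.ofNat (N + 1) x.pc, (flagRAM U fl op).flags x), .home), x.regs, p⟩

/-- Where the random-access machine has halted, so has the counter machine. -/
theorem flagCmd_halt {y : RAM.Cfg R} {p : Grid} (hN : y.pc ≤ N) (h : (flagRAM U fl op).Halted y) :
    flagCmd U fl op N (flagSt U fl op N y p).q = .halt := by
  simp only [flagSt, flagCmd]
  split_ifs with ht
  · rfl
  · rcases h with h | h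
    · have hpc : ((Fin.ofNat (N + 1) y.pc : Fin (N + 1)) : ℕ) = y.pc := by
        simp [Fin.ofNat]; omega
      have hU : U[y.pc]? = none := by
        simp only [flagRAM, RAM.step] at h
        split at h
        · assumption
        · simp at h
        · split_ifs at h
      rw [hpc, hU]
    · exact absurd h ht

/-- A step of the random-access machine, including its operations. -/
theorem flagCmd_step {y y' : RAM.Cfg R} {p : Grid} (hy : y.pc ≤ N) (hy' : y'.pc ≤ N)
    (hh : ¬ (flagRAM U fl op).Halted y) (hs : (flagRAM U fl op).next y = some y')
    (hW : ∀ ph, ∀ G ⊆ (flagRAM U fl op).flags y',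
      W ((flagSt U fl op N y p).q.1, ph) (p + (flagRAM U fl op).disp d (hand .leader).sign G))
    (hK : (∃ f ∈ (flagRAM U fl op).flags y', ∃ k, op f = .move k) → ∀ g, K g) :
    Relation.TransGen (Run (flagCmd U fl op N) (moveVec hand d) W K) (flagSt U fl op N y p)
      (flagSt U fl op N y' (p +
        (flagRAM U fl op).disp d (hand .leader).sign ((flagRAM U fl op).flags y'))) := by
  have hW₀ : ∀ ph, W ((flagSt U fl op N y p).q.1, ph) p := fun ph => by
    simpa [Controller.disp] using hW ph ∅ (Finset.empty_subset _)
  have hpc : ((Fin.ofNat (N + 1) y.pc : Fin (N + 1)) : ℕ) = y.pc := by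
    simp [Fin.ofNat]; omega
  have hterm : ¬ ∃ f ∈ (flagRAM U fl op).flags y, op f = .terminate := fun h => hh (.inr h)
  -- the instruction
  have h1 : Run (flagCmd U fl op N) (moveVec hand d) W K (flagSt U fl op N y p)
      ⟨((flagSt U fl op N y p).q.1, .test (Fin.ofNat (N + 1) y'.pc) 0 ∅), y'.regs, p⟩ := by
    simp only [flagRAM, RAM.step] at hs
    split at hs
    · simp at hs
    · rename_i r hU
      simp only [Option.some.injEq] at hs
      subst hs
      refine Run.of_inc ?_ (hW₀ _)
      simp only [flagCmd]
      rw [if_neg hterm, hpc, hU]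
      rfl
    · rename_i r i hU
      have hcmd : flagCmd U fl op N (flagSt U fl op N y p).q =
          .dec r ((flagSt U fl op N y p).q.1, .test (Fin.ofNat (N + 1) i) 0 ∅)
          ((flagSt U fl op N y p).q.1, .test (Fin.ofNat (N + 1) (y.pc + 1)) 0 ∅) := by
        simp only [flagCmd, flagSt]
        rw [if_neg hterm, hpc, hU]
      split_ifs at hs with h0
      · simp only [Option.some.injEq] at hs
        subst hs
        exact Run.of_dec_zero hcmd h0 (hW₀ _)
      · simp only [Option.some.injEq] at hs
        subst hs
        exact Run.of_dec_pos hcmd h0 (hW₀ _)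
  -- the tests of the flags
  have h2 := flagCmd_test_run (U := U) (op := op) (hand := hand) (d := d) (W := W) (K := K)
    (fl := fl) (N := N) (pc := Fin.ofNat (N + 1) y'.pc) hW₀ y'.regs m le_rfl
  have hset : (Finset.univ.filter fun f : Fin m => y'.regs (fl f) ≠ 0 ∧ (f : ℕ) < m) =
      (flagRAM U fl op).flags y' := by
    simp [flagRAM]
  rw [hset] at h2
  have h3 := Run.of_skip (M := flagCmd U fl op N) (v := moveVec hand d) (W := W) (K := K)
    (q := ((flagSt U fl op N y p).q.1, .test (Fin.ofNat (N + 1) y'.pc) ⟨m, by omega⟩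
      ((flagRAM U fl op).flags y'))) (g := y'.regs) (o := p)
    (by simp only [flagCmd, lt_irrefl, dif_neg, not_false_eq_true]; rfl) (hW₀ _)
  -- the moves
  have h4 := flagCmd_mov_run (U := U) (op := op) (hand := hand) (d := d) (W := W) (K := K)
    (fl := fl) (N := N) (pc := Fin.ofNat (N + 1) y'.pc) (F := (flagRAM U fl op).flags y') hW hK
    y'.regs m le_rfl
  have hfil : ((flagRAM U fl op).flags y').filter (fun f : Fin m => (f : ℕ) < m) =
      (flagRAM U fl op).flags y' := by simp
  rw [hfil] at h4
  have h5 := Run.of_skip (M := flagCmd U fl op N) (v := moveVec hand d) (W := W) (K := K)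
    (q := ((flagSt U fl op N y p).q.1, .mov (Fin.ofNat (N + 1) y'.pc) ⟨m, by omega⟩
      ((flagRAM U fl op).flags y'))) (g := y'.regs)
    (o := p + (flagRAM U fl op).disp d (hand .leader).sign ((flagRAM U fl op).flags y'))
    (by simp only [flagCmd, lt_irrefl, dif_neg, not_false_eq_true]; rfl)
    (hW _ _ subset_rfl)
  exact .head' h1 (h2.trans (.head h3 (h4.trans (.single h5))))

end FlagRAM

end Amoebot

namespace Amoebot

/-! ### Simulation of random-access machines -/

section FlagRAM

variable {R : Type} {m : ℕ}

/-- The instruction to which a jump leads. -/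
def RAM.Instr.target : RAM.Instr R → ℕ
  | .inc _ => 0
  | .testDec _ i => i

/-- A bound for the instruction indices that occur. -/
def RAM.bound (U : RAM.Program R) : ℕ := U.length + (U.map RAM.Instr.target).sum

variable [DecidableEq R]

theorem RAM.pc_le_bound {U : RAM.Program R} {y y' : RAM.Cfg R} (h : RAM.step U y = some y') :
    y'.pc ≤ RAM.bound U := by
  have hlen : ∀ {I}, U[y.pc]? = some I → y.pc + 1 ≤ RAM.bound U := fun hI => by
    obtain ⟨hlt, -⟩ := List.getElem?_eq_some_iff.1 hI
    unfold RAM.bound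
    omega
  simp only [RAM.step] at h
  split at h
  · simp at h
  · rename_i r hU
    simp only [Option.some.injEq] at h
    subst h
    exact hlen hU
  · rename_i r i hU
    split_ifs at h with h0 <;> simp only [Option.some.injEq] at h <;> subst h
    · have hmem : i ∈ U.map RAM.Instr.target :=
        List.mem_map.2 ⟨_, List.mem_of_getElem? hU, rfl⟩
      have := List.le_sum_of_mem hmem
      unfold RAM.bound
      dsimp only
      omega
    · exact hlen hU

/-- The view of the controller may be reduced to a part of it. -/
theorem Controller.SimulatedBy.comp {S : Type} {K : Controller S m} {code : S → ℕ → ℕ → Prop}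
    {ρ ρ' : Type} {view : S → ρ} {A : Algorithm} {read : A.State → ρ} {d s : ZMod 6} {x₀ : S}
    {o : Grid} {τ : ℕ → ℕ} {C : ℕ → Config A Role}
    (h : K.SimulatedBy code view read d s x₀ o τ C) (φ : ρ → ρ') :
    K.SimulatedBy code (fun x => φ (view x)) (fun q => φ (read q)) d s x₀ o τ C := by
  refine ⟨h.1, fun k => ?_⟩
  obtain ⟨h1, h2, h3, h4, h5⟩ := h.2 k
  refine ⟨h1, fun t ht ht' => congrArg φ (h2 t ht ht'), h3, h4, fun hh => ?_⟩
  obtain ⟨h6, h7⟩ := h5 hh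
  exact ⟨fun t ht => ⟨(h6 t ht).1, congrArg φ (h6 t ht).2⟩, h7⟩

/-- Particles that realize the counter machine for a random-access machine with flags simulate the
latter. -/
theorem exists_simulatedBy_flagRAM {U : RAM.Program R} {fl : Fin m → R} {op : Fin m → Operation}
    {V : Simulator} {rd : V.alg.State → FlagState (RAM.bound U) m}
    {enc : (R → ℕ) → ℕ × ℕ} {ok : (R → ℕ) → Prop}
    (hV : Realizes V rd (flagCmd U fl op (RAM.bound U)) ((0, ∅), .home) enc (fun _ => True) ok)
    (hok : (∃ f k, op f = .move k) → ∀ g, ok g)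
    {hand : Role → Handedness} {o : Grid} {d : ZMod 6} {a : R → ℕ} {active : ℕ → Set Role}
    {C : ℕ → V.Cfg} (ha : ∀ f, a (fl f) = 0)
    (hrot : (∃ f k, op f = .move k) → CommonRotation hand)
    (hC₀ : V.Starts hand o d (enc a).1 (enc a).2 (C 0)) (hC : FairExecution hand active C) :
    ∃ τ : ℕ → ℕ, τ 0 = 0 ∧ (flagRAM U fl op).SimulatedBy
      (fun x r₁ r₂ => r₁ = (enc x.regs).1 ∧ r₂ = (enc x.regs).2)
      (fun x => (x.pc, (flagRAM U fl op).flags x)) (fun q => (((rd q).1.1 : ℕ), (rd q).1.2))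
      d (hand .leader).sign ⟨0, a⟩ o τ C := by
  obtain ⟨Rel, hRel⟩ := hV hand d fun ⟨q, hq⟩ => hrot (exists_move_of_flagCmd hq)
  have hval : ∀ {x : ℕ}, x ≤ RAM.bound U →
      ((Fin.ofNat (RAM.bound U + 1) x : Fin (RAM.bound U + 1)) : ℕ) = x := fun hx => by
    simp [Fin.ofNat]; omega
  refine Controller.exists_simulatedBy
    (fun x p X => x.pc ≤ RAM.bound U ∧ Rel (flagSt U fl op (RAM.bound U) x p) X)
    (fun x p X hX => ⟨_, _, ⟨rfl, rfl⟩, hRel.encodes hX.2⟩)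
    (fun x p X hX => by rw [hRel.read_eq hX.2]; exact Prod.ext (hval hX.1) rfl)
    (fun x p X hX hh => hRel.stuck hX.2 (flagCmd_halt hX.1 hh)) ?_ hC ⟨Nat.zero_le _, ?_⟩
  · intro x x' p X hX hh hx
    have hpc : x'.pc ≤ RAM.bound U := RAM.pc_le_bound hx
    obtain ⟨X', h1, h2⟩ := hRel.runs (mv := ∃ f ∈ (flagRAM U fl op).flags x', ∃ j, op f = .move j)
      (W := fun q p' => (((q.1.1 : ℕ), q.1.2) = (x.pc, (flagRAM U fl op).flags x)) ∧
        ∃ G ⊆ (flagRAM U fl op).flags x',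
          p' = p + (flagRAM U fl op).disp d (hand .leader).sign G) hX.2
      (flagCmd_step hX.1 hpc hh hx (fun ph G hG => ⟨Prod.ext (hval hX.1) rfl, G, hG, rfl⟩)
        fun hmv g => ⟨hmv, hok (by obtain ⟨f, -, k, hk⟩ := hmv; exact ⟨f, k, hk⟩) g⟩)
    refine ⟨X', ⟨hpc, h1⟩, Relation.TransGen.mono ?_ _ _ h2⟩
    rintro Y Z ⟨h3, h4, h5⟩
    exact ⟨h3, h4, h5⟩
  · have := hRel.start trivial hC₀
    have hflags : (flagRAM U fl op).flags ⟨0, a⟩ = ∅ := by simp [flagRAM, ha]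
    unfold flagSt
    rw [hflags]
    exact this

end FlagRAM

/-- Four particles simulate every random-access machine with two registers. -/
theorem ram_simulation (Q : RAM.Program (Fin 2)) :
    ∃ (V : Simulator) (read : V.alg.State → ℕ),
      ∀ (hand : Role → Handedness) (o : Grid) (d : ZMod 6) (a : Fin 2 → ℕ)
        (active : ℕ → Set Role) (C : ℕ → V.Cfg),
        V.Starts hand o d (a 0) (a 1) (C 0) → FairExecution hand active C →
        (∀ t, Layout o d (C t)) ∧
        ∃ τ : ℕ → ℕ, τ 0 = 0 ∧
          (ramController Q).SimulatedBy
            (fun x r₁ r₂ => r₁ = x.regs 0 ∧ r₂ = x.regs 1) (fun x => x.pc) read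
            d (hand Role.leader).sign ⟨0, a⟩ o τ C := by
  have hV := realizes_regSim (q₀ := ((0, ∅), .home))
    (flagCmd_basic (U := Q) (fl := Fin.elim0) (op := Fin.elim0) (N := RAM.bound Q))
  obtain ⟨V, rd, hV⟩ : ∃ (V : Simulator) (rd : V.alg.State → FlagState (RAM.bound Q) 0),
      Realizes V rd _ _ _ _ _ := ⟨_, _, hV⟩
  refine ⟨V, fun q => ((rd q).1.1 : ℕ), fun hand o d a active C hC₀ hC => ?_⟩
  obtain ⟨τ, h0, hτ⟩ := exists_simulatedBy_flagRAM hV (fun ⟨f, _⟩ => f.elim0) (fun f => f.elim0)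
    (fun ⟨f, _⟩ => f.elim0) hC₀ hC
  have hK : flagRAM Q Fin.elim0 Fin.elim0 = ramController Q := by
    unfold flagRAM ramController
    congr 1
  have hS := hτ.comp Prod.fst
  rw [hK] at hS
  refine ⟨fun t => ?_, τ, h0, hS⟩
  -- without moves the position of the system does not change
  have hpos : ∀ k, ((ramController Q).run d (hand .leader).sign ⟨0, a⟩ o k).2 = o := by
    intro k
    induction k with
    | zero => rfl
    | succ k ih =>
      rw [Controller.run]
      split_ifs
      · exact ih
      · split
        · exact ih
        · simp [ih, Controller.disp_eq_zero fun f _ => f.elim0]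
  obtain ⟨k, h1, h2⟩ := exists_between hS.1 (t := t) (by omega)
  obtain ⟨-, -, -, h3, h4⟩ := hS.2 k
  rw [hpos] at h3 h4
  by_cases hh : (ramController Q).Halted
      ((ramController Q).run d (hand .leader).sign ⟨0, a⟩ o k).1
  · obtain ⟨⟨r₁, r₂, -, he⟩, -⟩ := (h4 hh).1 t h1
    exact he.layout
  · exact h3 hh (fun f => f.elim0) t h1 h2.le

/-- Four particles simulate every mobile random-access machine. -/
theorem mobile_ram_simulation (c m : ℕ) (U : RAM.Program (Fin c ⊕ Fin m)) (op : Fin m → Operation) :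
    ∃ (V : Simulator) (read : V.alg.State → ℕ × Finset (Fin m)),
      ∀ (hand : Role → Handedness) (o : Grid) (d : ZMod 6)
        (a : Fin c ⊕ Fin m → ℕ) (active : ℕ → Set Role) (C : ℕ → V.Cfg),
        (∀ f, a (Sum.inr f) = 0) →
        ((∃ f k, op f = Operation.move k) → CommonRotation hand) →
        V.Starts hand o d (goedel a) 0 (C 0) → FairExecution hand active C →
        ∃ τ : ℕ → ℕ, τ 0 = 0 ∧
          (mobileRAM U op).SimulatedBy
            (fun x r₁ r₂ => r₁ = goedel x.regs ∧ r₂ = 0)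
            (fun x => (x.pc, (mobileRAM U op).flags x)) read
            d (hand Role.leader).sign ⟨0, a⟩ o τ C := by
  -- the registers are numbered with the flags last
  let index : Fin c ⊕ Fin m → ℕ := Sum.elim (fun i => i) (fun j => c + j)
  have hindex : Function.Injective index := by
    rintro (i | i) (j | j) h <;> simp only [index, Sum.elim_inl, Sum.elim_inr] at h
    · rw [Fin.ext h]
    · omega
    · omega
    · rw [Fin.ext (by omega : (i : ℕ) = j)]
  let pr : Fin c ⊕ Fin m → ℕ := fun r => Nat.nth Nat.Prime (index r)
  have hgoedel : ∀ g, goedel g = goedelNum pr g := fun g => by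
    simp [goedel, goedelNum, pr, index, Fintype.prod_sum_type]
  obtain ⟨V, rd, hV⟩ := exists_realizes_goedelNum (q₀ := ((0, ∅), .home)) (pr := pr)
    (fun r => Nat.prime_nth_prime _)
    (fun i j h => hindex (Nat.nth_injective Nat.infinite_setOfPred_prime h))
    (flagCmd_basic (U := U) (fl := Sum.inr) (op := op) (N := RAM.bound U))
  refine ⟨V, fun q => (((rd q).1.1 : ℕ), (rd q).1.2),
    fun hand o d a active C ha hrot hC₀ hC => ?_⟩
  rw [hgoedel] at hC₀
  simp only [hgoedel]
  exact exists_simulatedBy_flagRAM hV (fun _ _ => trivial) ha hrot hC₀ hC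

end Amoebot

namespace Amoebot

open Turing

/-! ### Tapes as numbers -/

/-- An assignment of digits to the symbols of a tape alphabet, with the left inverse `sym`. The digit
of the blank is `0`, so that the blanks at the end of a tape do not affect its code. -/
structure Digits (Γ : Type) [Inhabited Γ] where
  base : ℕ
  dig : Γ → ℕ
  sym : ℕ → Γ
  dig_lt : ∀ a, dig a < base
  sym_dig : ∀ a, sym (dig a) = a
  dig_default : dig default = 0

section Digits

variable {Γ : Type} [Inhabited Γ]

theorem nonempty_digits [Finite Γ] : Nonempty (Digits Γ) := by
  classical
  obtain ⟨n, ⟨e⟩⟩ := Finite.exists_equiv_fin Γ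
  have : NeZero n := ⟨fun h => by subst h; exact (e default).elim0⟩
  -- an enumeration of the symbols that begins with the blank
  let e' : Γ ≃ Fin n := e.trans (Equiv.swap (e default) 0)
  exact ⟨n, fun a => e' a, fun i => e'.symm (Fin.ofNat n i), fun a => (e' a).2,
    fun a => by simp, by simp [e']⟩

namespace Digits

variable (D : Digits Γ)

theorem base_pos : 0 < D.base := (Nat.zero_le _).trans_lt (D.dig_lt default)

/-- The digits of `x` are those of the symbols of `L`, the least significant digit belonging to the
head. -/
def Codes (x : ℕ) (L : ListBlank Γ) : Prop :=
  ∃ l : List Γ, ListBlank.mk l = L ∧ Nat.ofDigits D.base (l.map D.dig) = x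

theorem codes_zero : D.Codes 0 (ListBlank.mk []) := ⟨[], rfl, rfl⟩

variable {D} {x : ℕ} {L : ListBlank Γ}

theorem Codes.cons (h : D.Codes x L) (a : Γ) : D.Codes (x * D.base + D.dig a) (L.cons a) := by
  obtain ⟨l, rfl, rfl⟩ := h
  exact ⟨a :: l, by simp, by simp [Nat.ofDigits_cons]; ring⟩

theorem Codes.sym_mod (h : D.Codes x L) : D.sym (x % D.base) = L.head := by
  obtain ⟨l, rfl, rfl⟩ := h
  cases l with
  | nil =>
    have := D.sym_dig default
    rw [D.dig_default] at this
    simpa using this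
  | cons a l => simp [Nat.ofDigits_cons, Nat.mod_eq_of_lt (D.dig_lt a), D.sym_dig]

theorem Codes.div (h : D.Codes x L) : D.Codes (x / D.base) L.tail := by
  obtain ⟨l, rfl, rfl⟩ := h
  cases l with
  | nil => exact ⟨[], by simp, by simp⟩
  | cons a l =>
    refine ⟨l, by simp, ?_⟩
    simp [Nat.ofDigits_cons, Nat.add_mul_div_left _ _ D.base_pos,
      Nat.div_eq_of_lt (D.dig_lt a)]

theorem Codes.eq_zero (h : D.Codes x (ListBlank.mk [])) : x = 0 := by
  obtain ⟨l, hl, rfl⟩ := h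
  induction l with
  | nil => rfl
  | cons a l ih =>
    have h1 := congrArg ListBlank.head hl
    have h2 := congrArg ListBlank.tail hl
    simp only [ListBlank.head_mk, ListBlank.tail_mk, List.headI_cons, List.tail_cons,
      List.tail_nil, List.headI_nil] at h1 h2
    have h3 := ih h2
    simp only [List.map_cons, Nat.ofDigits_cons, h3]
    rw [h1, D.dig_default]
    simp

end Digits

end Digits

/-! ### Turing machines as counter machines -/

/-- The control states of the counter machine for a Turing machine: `count`, `push` and `load`
convert the input, `work` simulates the steps, the fields being the output of the last step, the
state and the scanned symbol, and a phase that tells whether the latter has already been stored and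
which symbol has been read; `clear`, `test` and `add` convert the output. -/
inductive TMState (m : ℕ) (Γ Λ : Type)
  | count
  | push
  | load
  | work (out : Option (Fin m)) (q : Λ) (a : Γ) (ph : Option (Option Γ))
  | clear
  | test
  | add
  | finish

instance (m : ℕ) (Γ Λ : Type) [Finite Γ] [Finite Λ] : Finite (TMState m Γ Λ) :=
  Finite.of_injective (β := Fin 7 ⊕ (Option (Fin m) × Λ × Γ × Option (Option Γ)))
    (fun
      | .count => .inl 0
      | .push => .inl 1
      | .load => .inl 2
      | .work out q a ph => .inr (out, q, a, ph)
      | .clear => .inl 3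
      | .test => .inl 4
      | .add => .inl 5
      | .finish => .inl 6) (by
    intro x y
    cases x <;> cases y <;> simp)

section TM

variable {m : ℕ} {Γ Λ : Type} [Inhabited Γ] [Inhabited Λ]

/-- The direction number of the move that is output, if any. -/
def outDir (op : Fin m → Operation) (out : Option (Fin m)) : Option (ZMod 6) :=
  out.bind fun f => (op f).dir

open Classical in
/-- The counter machine for a Turing machine. The registers `0` and `1` hold the codes of the parts
of the tape to the left and to the right of the scanned cell; the register `2` is reserved for
arithmetic. If `post` is set, the contents of the tape are converted to a number when the Turing
machine has stopped. -/
noncomputable def tmCmd (D : Digits Γ) (M : TM0.Machine Γ Λ) (σ : Γ)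
    (plot : Λ → Γ → Option (Fin m)) (op : Fin m → Operation) (post : Prop) :
    TMState m Γ Λ → Cmd (Fin 3) (TMState m Γ Λ)
  | .count => .dec 0 .load .push
  | .push => .mulAdd 1 D.base (D.dig σ) .count
  | .load => .divMod 1 D.base fun r => .work none default (D.sym r) none
  | .work out q a ph =>
    if ∃ f ∈ out, op f = .terminate then .halt
    else match M q a with
    | none => if post then .mulAdd 1 D.base (D.dig a) .clear else .halt
    | some (q', .write b) => .op (outDir op (plot q a)) (.work (plot q a) q' b none)
    | some (q', .move dir) =>
      match ph with
      | none => .mulAdd (if dir = .left then 1 else 0) D.base (D.dig a) (.work out q a (some none))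
      | some none => .divMod (if dir = .left then 0 else 1) D.base
          fun r => .work out q a (some (some (D.sym r)))
      | some (some b) => .op (outDir op (plot q a)) (.work (plot q a) q' b none)
  | .clear => .dec 0 .test .clear
  | .test => .divMod 1 D.base fun r => if D.sym r = σ then .add else .finish
  | .add => .inc 0 .test
  | .finish => .halt

variable {D : Digits Γ} {M : TM0.Machine Γ Λ} {σ : Γ} {plot : Λ → Γ → Option (Fin m)}
  {op : Fin m → Operation} {post : Prop}

theorem tmCmd_avoids (x) : (tmCmd D M σ plot op post x).Avoids 2 D.base := by
  have h1 := D.base_pos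
  have h2 := fun a => (D.dig_lt a).le
  cases x <;> simp only [tmCmd]
  case work out q a ph =>
    by_cases ht : ∃ f ∈ out, op f = .terminate
    · rw [if_pos ht]
      trivial
    · rw [if_neg ht]
      split
      · split_ifs
        · exact ⟨by decide, h1, le_rfl, h2 _⟩
        · trivial
      · trivial
      · split
        · exact ⟨by split_ifs <;> decide, h1, le_rfl, h2 _⟩
        · exact ⟨by split_ifs <;> decide, h1, le_rfl⟩
        · trivial
  all_goals simp [Cmd.Avoids, h1, h2]

theorem exists_of_outDir {out : Option (Fin m)} (h : outDir op out ≠ none) :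
    ∃ f ∈ out, ∃ k, op f = .move k := by
  cases out with
  | none => exact absurd rfl h
  | some f =>
    refine ⟨f, rfl, ?_⟩
    cases hop : op f with
    | move k => exact ⟨k, rfl⟩
    | terminate => simp [outDir, hop, Operation.dir] at h
    | signal => simp [outDir, hop, Operation.dir] at h

theorem exists_move_of_tmCmd {x} (h : (tmCmd D M σ plot op post x).IsMove) :
    ∃ f k, op f = .move k := by
  have key : ∀ {out : Option (Fin m)} {q : TMState m Γ Λ},
      (Cmd.op (R := Fin 3) (outDir op out) q).IsMove → ∃ f k, op f = .move k := by
    intro out q hq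
    obtain ⟨f, -, hf⟩ := exists_of_outDir (op := op) (out := out) fun h0 => by
      rw [h0] at hq
      exact hq.elim
    exact ⟨f, hf⟩
  cases x <;> simp only [tmCmd] at h
  case work out q a ph =>
    by_cases ht : ∃ f ∈ out, op f = .terminate
    · rw [if_pos ht] at h
      exact h.elim
    · rw [if_neg ht] at h
      split at h
      · split_ifs at h <;> exact h.elim
      · exact key h
      · split at h
        · exact h.elim
        · exact h.elim
        · exact key h
  all_goals exact h.elim

/-- The configuration `s` of the counter machine represents the configuration `c` of the Turing
machine, the output of its last step being `out`. -/
def TMRep (D : Digits Γ) (out : Option (Fin m)) (c : TM0.Cfg Γ Λ) (p : Grid)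
    (s : St (Fin 3) (TMState m Γ Λ)) : Prop :=
  ∃ x y, D.Codes x c.Tape.left ∧ D.Codes y c.Tape.right ∧
    s = ⟨.work out c.q c.Tape.head none, ![x, y, 0], p⟩

theorem update_regs_zero (x y x' : ℕ) : Function.update ![x, y, 0] (0 : Fin 3) x' = ![x', y, 0] := by
  ext i; fin_cases i <;> simp

theorem update_regs_one (x y y' : ℕ) : Function.update ![x, y, 0] (1 : Fin 3) y' = ![x, y', 0] := by
  ext i; fin_cases i <;> simp

variable {v : ZMod 6 → Grid} {W : TMState m Γ Λ → Grid → Prop} {K : (Fin 3 → ℕ) → Prop}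
  {p : Grid}

/-- A step of the Turing machine. When the head moves, the scanned symbol is pushed on the stack on one
side and the next symbol is popped from the stack on the other side, that is, appended as the least
significant digit of one code and split off from the other one. -/
theorem tmCmd_step {out : Option (Fin m)} {c c' : TM0.Cfg Γ Λ} {s : St (Fin 3) (TMState m Γ Λ)}
    (hterm : ¬ ∃ f ∈ out, op f = .terminate) (hc : TM0.step M c = some c')
    (hs : TMRep D out c p s) (hW : ∀ ph, W (.work out c.q c.Tape.head ph) p)
    (hW' : ∀ ph, W (.work out c.q c.Tape.head ph)
      (p + (outDir op (plot c.q c.Tape.head)).elim 0 v))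
    (hK : (∃ f ∈ plot c.q c.Tape.head, ∃ k, op f = .move k) → ∀ g, K g) :
    ∃ s', TMRep D (plot c.q c.Tape.head) c'
        (p + (outDir op (plot c.q c.Tape.head)).elim 0 v) s' ∧
      Relation.TransGen (Run (tmCmd D M σ plot op post) v W K) s s' := by
  obtain ⟨q, ⟨a, L, R⟩⟩ := c
  obtain ⟨x, y, hx, hy, rfl⟩ := hs
  dsimp only at *
  simp only [TM0.step] at hc
  cases hM : M q a with
  | none => simp [hM] at hc
  | some r =>
    obtain ⟨q', st⟩ := r
    simp only [hM, Option.map_some, Option.some.injEq] at hc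
    subst hc
    cases st with
    | write b =>
      have h1 := Run.of_op (M := tmCmd D M σ plot op post) (v := v) (W := W) (K := K)
        (q := .work out q a none) (q' := .work (plot q a) q' b none) (g := ![x, y, 0]) (o := p)
        (k := outDir op (plot q a)) (by simp only [tmCmd, hM]; exact if_neg hterm) (hW _) (hW' _)
        (fun h => hK (exists_of_outDir h) _)
      exact ⟨_, ⟨x, y, hx, hy, rfl⟩, .single h1⟩
    | move dir =>
      cases dir with
      | left =>
        have h1 := Run.of_mulAdd (M := tmCmd D M σ plot op post) (v := v) (W := W) (K := K)
          (q := .work out q a none) (q' := .work out q a (some none)) (g := ![x, y, 0]) (o := p)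
          (r := 1) (x := y) (b := D.base) (a := D.dig a) (by simp only [tmCmd, hM]; exact if_neg hterm) (by simp)
          (hW _)
        rw [update_regs_one] at h1
        have h2 := Run.of_divMod (M := tmCmd D M σ plot op post) (v := v) (W := W) (K := K)
          (q := .work out q a (some none)) (g := ![x, y * D.base + D.dig a, 0]) (o := p)
          (r := 0) (x := x) (b := D.base) (f := fun r => .work out q a (some (some (D.sym r))))
          (by simp only [tmCmd, hM]; exact if_neg hterm) (by simp) (hW _)
        rw [update_regs_zero, hx.sym_mod] at h2
        have h3 := Run.of_op (M := tmCmd D M σ plot op post) (v := v) (W := W) (K := K)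
          (q := .work out q a (some (some L.head))) (q' := .work (plot q a) q' L.head none)
          (g := ![x / D.base, y * D.base + D.dig a, 0]) (o := p)
          (k := outDir op (plot q a)) (by simp only [tmCmd, hM]; exact if_neg hterm) (hW _) (hW' _)
          (fun h => hK (exists_of_outDir h) _)
        exact ⟨_, ⟨_, _, hx.div, hy.cons a, rfl⟩, .head h1 (.head h2 (.single h3))⟩
      | right =>
        have h1 := Run.of_mulAdd (M := tmCmd D M σ plot op post) (v := v) (W := W) (K := K)
          (q := .work out q a none) (q' := .work out q a (some none)) (g := ![x, y, 0]) (o := p)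
          (r := 0) (x := x) (b := D.base) (a := D.dig a) (by simp only [tmCmd, hM]; exact if_neg hterm) (by simp)
          (hW _)
        rw [update_regs_zero] at h1
        have h2 := Run.of_divMod (M := tmCmd D M σ plot op post) (v := v) (W := W) (K := K)
          (q := .work out q a (some none)) (g := ![x * D.base + D.dig a, y, 0]) (o := p)
          (r := 1) (x := y) (b := D.base) (f := fun r => .work out q a (some (some (D.sym r))))
          (by simp only [tmCmd, hM]; exact if_neg hterm) (by simp) (hW _)
        rw [update_regs_one, hy.sym_mod] at h2
        have h3 := Run.of_op (M := tmCmd D M σ plot op post) (v := v) (W := W) (K := K)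
          (q := .work out q a (some (some R.head))) (q' := .work (plot q a) q' R.head none)
          (g := ![x * D.base + D.dig a, y / D.base, 0]) (o := p)
          (k := outDir op (plot q a)) (by simp only [tmCmd, hM]; exact if_neg hterm) (hW _) (hW' _)
          (fun h => hK (exists_of_outDir h) _)
        exact ⟨_, ⟨_, _, hx.cons a, hy.div, rfl⟩, .head h1 (.head h2 (.single h3))⟩

/-- The input is converted to a tape. -/
theorem tmCmd_load (hW : ∀ x ∈ ({.count, .push, .load} : Set (TMState m Γ Λ)), W x p) (n : ℕ) :
    ∃ s, TMRep D none (TM0.init (List.replicate n σ)) p s ∧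
      Relation.TransGen (Run (tmCmd D M σ plot op post) v W K) ⟨.count, ![n, 0, 0], p⟩ s := by
  -- the symbols are pushed one by one on the stack on the right
  have hloop : ∀ n k y, D.Codes y (ListBlank.mk (List.replicate k σ)) →
      ∃ y', D.Codes y' (ListBlank.mk (List.replicate (n + k) σ)) ∧
        Relation.ReflTransGen (Run (tmCmd D M σ plot op post) v W K) ⟨.count, ![n, y, 0], p⟩
          ⟨.count, ![0, y', 0], p⟩ := by
    intro n
    induction n with
    | zero => exact fun k y hy => ⟨y, by rwa [zero_add], .refl⟩
    | succ n ih =>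
      intro k y hy
      have h1 := Run.of_dec_pos (M := tmCmd D M σ plot op post) (v := v) (W := W) (K := K)
        (q := .count) (q₀ := .load) (q₁ := .push) (r := 0) (g := ![n + 1, y, 0]) (o := p)
        rfl (by simp) (hW _ (by simp))
      rw [update_regs_zero] at h1
      have h2 := Run.of_mulAdd (M := tmCmd D M σ plot op post) (v := v) (W := W) (K := K)
        (q := .push) (q' := .count) (r := 1) (b := D.base) (a := D.dig σ) (x := y)
        (g := ![n, y, 0]) (o := p) rfl (by simp) (hW _ (by simp))
      rw [update_regs_one] at h2
      obtain ⟨y', hy', h3⟩ := ih (k + 1) _ (by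
        have := hy.cons σ
        rwa [ListBlank.cons_mk, ← List.replicate_succ] at this)
      exact ⟨y', by rwa [show n + 1 + k = n + (k + 1) by omega], .head h1 (.head h2 h3)⟩
  obtain ⟨y, hy, h1⟩ := hloop n 0 0 D.codes_zero
  rw [add_zero] at hy
  have h2 := Run.of_dec_zero (M := tmCmd D M σ plot op post) (v := v) (W := W) (K := K)
    (q := .count) (q₀ := .load) (q₁ := .push) (r := 0) (g := ![0, y, 0]) (o := p)
    rfl (by simp) (hW _ (by simp))
  have h3 := Run.of_divMod (M := tmCmd D M σ plot op post) (v := v) (W := W) (K := K)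
    (q := .load) (r := 1) (b := D.base) (x := y)
    (f := fun r => .work none default (D.sym r) none)
    (g := ![0, y, 0]) (o := p) rfl (by simp) (hW _ (by simp))
  rw [update_regs_one, hy.sym_mod] at h3
  exact ⟨_, ⟨_, _, D.codes_zero, hy.div, rfl⟩, .trans_right h1 (.head h2 (.single h3))⟩

/-- The result is converted to a number. -/
theorem tmCmd_unload (hσ : σ ≠ default) (hpost : post) {out : Option (Fin m)} {c : TM0.Cfg Γ Λ}
    {s : St (Fin 3) (TMState m Γ Λ)} (hterm : ¬ ∃ f ∈ out, op f = .terminate)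
    (hc : TM0.step M c = none) (hs : TMRep D out c p s) {k : ℕ}
    (hk : c.Tape.right₀ = ListBlank.mk (List.replicate k σ)) (hW : ∀ x, x ≠ .finish → W x p) :
    Relation.TransGen (Run (tmCmd D M σ plot op post) v W K) s ⟨.finish, ![k, 0, 0], p⟩ := by
  classical
  obtain ⟨q, ⟨a, L, R⟩⟩ := c
  obtain ⟨x, y, hx, hy, rfl⟩ := hs
  dsimp only [Tape.right₀] at *
  have hM : M q a = none := by simpa [TM0.step] using hc
  -- the scanned symbol is pushed, so that the stack on the right holds the result
  have h1 := Run.of_mulAdd (M := tmCmd D M σ plot op post) (v := v) (W := W) (K := K)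
    (q := .work out q a none) (q' := .clear) (r := 1) (b := D.base) (a := D.dig a) (x := y)
    (g := ![x, y, 0]) (o := p) (by simp only [tmCmd, hM, if_pos hpost]; exact if_neg hterm) (by simp) (hW _ (by simp))
  rw [update_regs_one] at h1
  have hy' := hy.cons a
  rw [hk] at hy'
  generalize y * D.base + D.dig a = y' at h1 hy'
  -- the stack on the left is cleared
  have hclear : ∀ x, Relation.ReflTransGen (Run (tmCmd D M σ plot op post) v W K)
      ⟨.clear, ![x, y', 0], p⟩ ⟨.test, ![0, y', 0], p⟩ := by
    intro x
    induction x with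
    | zero => exact .single (Run.of_dec_zero rfl (by simp) (hW _ (by simp)))
    | succ x ih =>
      have h1 := Run.of_dec_pos (M := tmCmd D M σ plot op post) (v := v) (W := W) (K := K)
        (q := .clear) (q₀ := .test) (q₁ := .clear) (r := 0) (g := ![x + 1, y', 0]) (o := p)
        rfl (by simp) (hW _ (by simp))
      rw [update_regs_zero] at h1
      exact .head h1 ih
  -- the symbols are popped and counted up to the first blank
  have htest : ∀ k x y', D.Codes y' (ListBlank.mk (List.replicate k σ)) →
      Relation.ReflTransGen (Run (tmCmd D M σ plot op post) v W K)
        ⟨.test, ![x, y', 0], p⟩ ⟨.finish, ![x + k, 0, 0], p⟩ := by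
    intro k
    induction k with
    | zero =>
      intro x y' hy'
      have h1 := Run.of_divMod (M := tmCmd D M σ plot op post) (v := v) (W := W) (K := K)
        (q := .test) (r := 1) (b := D.base) (x := y')
        (f := fun r => if D.sym r = σ then .add else .finish)
        (g := ![x, y', 0]) (o := p) rfl (by simp) (hW _ (by simp))
      rw [update_regs_one, hy'.sym_mod, if_neg (by simpa using hσ.symm),
        Digits.Codes.eq_zero hy', Nat.zero_div] at h1
      rw [Digits.Codes.eq_zero hy']
      exact .single h1
    | succ k ih =>
      intro x y' hy'
      have h1 := Run.of_divMod (M := tmCmd D M σ plot op post) (v := v) (W := W) (K := K)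
        (q := .test) (r := 1) (b := D.base) (x := y')
        (f := fun r => if D.sym r = σ then .add else .finish)
        (g := ![x, y', 0]) (o := p) rfl (by simp) (hW _ (by simp))
      rw [update_regs_one, hy'.sym_mod, if_pos (by simp [List.replicate_succ])] at h1
      have h2 := Run.of_inc (M := tmCmd D M σ plot op post) (v := v) (W := W) (K := K)
        (q := .add) (q' := .test) (r := 0) (g := ![x, y' / D.base, 0]) (o := p) rfl
        (hW _ (by simp))
      rw [update_regs_zero] at h2
      have h3 := ih (x + 1) (y' / D.base) (by
        have := hy'.div
        rwa [List.replicate_succ, ListBlank.tail_mk, List.tail_cons] at this)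
      rw [show x + (k + 1) = x + 1 + k by omega]
      exact .head h1 (.head h2 h3)
  have h2 := htest k 0 y' hy'
  rw [zero_add] at h2
  exact .head' h1 ((hclear x).trans h2)

end TM

end Amoebot

namespace Amoebot

open Turing

/-! ### Simulation of Turing machines -/

section TM

variable {m : ℕ} {Γ Λ : Type} [Inhabited Γ] [Inhabited Λ]

/-- The primes that code the contents of three registers. -/
def threePrimes : Fin 3 → ℕ := ![2, 3, 5]

theorem goedelNum_threePrimes (n : ℕ) : goedelNum threePrimes ![n, 0, 0] = 2 ^ n := by
  simp [goedelNum, threePrimes, Fin.prod_univ_three]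

/-- Four particles realize the counter machine for a Turing machine. -/
theorem exists_realizes_tmCmd [Finite Γ] [Finite Λ] (D : Digits Γ) (M : TM0.Machine Γ Λ) (σ : Γ)
    (plot : Λ → Γ → Option (Fin m)) (op : Fin m → Operation) (post : Prop) :
    ∃ (V : Simulator) (rd : V.alg.State → TMState m Γ Λ),
      Realizes V rd (tmCmd D M σ plot op post) .count (fun g => (goedelNum threePrimes g, 0))
        (fun g => True ∧ g 2 = 0) (fun _ => True) :=
  exists_realizes_avoids _
    (by intro r; fin_cases r <;> simp [threePrimes] <;> norm_num)
    (by decide) tmCmd_avoids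

/-- The output of a state. -/
def TMState.out : TMState m Γ Λ → Option (Fin m)
  | .work out _ _ _ => out
  | _ => none

/-- Four particles perform the operations that are output by a Turing machine. -/
theorem programmed_movement [Finite Γ] [Finite Λ] (M : TM0.Machine Γ Λ) (σ : Γ) (m : ℕ)
    (plot : Λ → Γ → Option (Fin m)) (op : Fin m → Operation) :
    ∃ (V : Simulator) (read : V.alg.State → Option (Fin m)),
      ∀ (hand : Role → Handedness) (o : Grid) (d : ZMod 6) (n : ℕ)
        (active : ℕ → Set Role) (C : ℕ → V.Cfg),
        ((∃ f k, op f = Operation.move k) → CommonRotation hand) →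
        V.Starts hand o d (2 ^ n) 0 (C 0) → FairExecution hand active C →
        ∃ τ : ℕ → ℕ, (∀ t ≤ τ 0, Layout o d (C t)) ∧
          (plottingTM M plot op).SimulatedBy
            (fun _ _ r₂ => r₂ = 0) (fun x => x.2) read
            d (hand Role.leader).sign
            (TM0.init (List.replicate n σ), none) o τ C := by
  obtain ⟨D⟩ := nonempty_digits (Γ := Γ)
  obtain ⟨V, rd, hV⟩ := exists_realizes_tmCmd D M σ plot op False
  refine ⟨V, fun s => (rd s).out, fun hand o d n active C hrot hC₀ hC => ?_⟩
  obtain ⟨Rel, hRel⟩ := hV hand d fun ⟨q, hq⟩ => hrot (exists_move_of_tmCmd hq)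
  obtain ⟨s₀, hs₀, hload⟩ := tmCmd_load (D := D) (M := M) (σ := σ) (plot := plot) (op := op)
    (post := False) (v := moveVec hand d) (W := fun _ p => p = o) (K := fun g => False ∧ True)
    (p := o) (fun _ _ => rfl) n
  have hstart : Rel ⟨.count, ![n, 0, 0], o⟩ (C 0) :=
    hRel.start ⟨trivial, rfl⟩ (by rw [goedelNum_threePrimes]; exact hC₀)
  obtain ⟨X₀, hX₀, hrun⟩ := hRel.runs hstart hload
  obtain ⟨T, -, rfl, hT⟩ := hC.of_transGen hrun
  have hdisp : ∀ out : Option (Fin m), (outDir op out).elim 0 (moveVec hand d) =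
      (plottingTM M plot op).disp d (hand .leader).sign out.toFinset := by
    intro out
    cases out with
    | none => simp [outDir, Controller.disp]
    | some f => simp [outDir, Controller.disp, plottingTM, Operation.elim_dir]
  obtain ⟨τ, h0, hτ⟩ := Controller.exists_simulatedBy (K := plottingTM M plot op) (V := V)
    (code := fun _ _ r₂ => r₂ = 0) (view := fun x => x.2) (read := fun s => (rd s).out)
    (hand := hand) (d := d) (s := (hand .leader).sign) (T := T)
    (x₀ := (TM0.init (List.replicate n σ), none)) (o := o)
    (fun x p X => ∃ s, TMRep D x.2 x.1 p s ∧ Rel s X)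
    (by
      rintro ⟨c, out⟩ p X ⟨s, ⟨x, y, hx, hy, rfl⟩, hX⟩
      exact ⟨_, _, rfl, hRel.encodes hX⟩)
    (by
      rintro ⟨c, out⟩ p X ⟨s, ⟨x, y, hx, hy, rfl⟩, hX⟩
      rw [hRel.read_eq hX]
      rfl)
    (by
      rintro ⟨c, out⟩ p X ⟨s, ⟨x, y, hx, hy, rfl⟩, hX⟩ hh
      refine hRel.stuck hX ?_
      simp only [tmCmd]
      by_cases ht : ∃ f ∈ out, op f = .terminate
      · exact if_pos ht
      · rw [if_neg ht]
        rcases hh with hh | ⟨f, hf, hop⟩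
        · have : M c.q c.Tape.head = none := by simpa [plottingTM, TM0.step] using hh
          rw [this]
          exact if_neg not_false
        · exact absurd ⟨f, by simpa [plottingTM] using hf, hop⟩ ht)
    (by
      rintro ⟨c, out⟩ ⟨c', out'⟩ p X ⟨s, hs, hX⟩ hh hx
      obtain ⟨c'', hc, he⟩ := Option.map_eq_some_iff.1 hx
      obtain ⟨rfl, rfl⟩ := Prod.mk.inj he
      dsimp only at hs hc
      have hterm : ¬ ∃ f ∈ out, op f = .terminate := by
        rintro ⟨f, hf, hop⟩
        exact hh (.inr ⟨f, by simpa [plottingTM] using hf, hop⟩)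
      obtain ⟨s', hs', hrun⟩ := tmCmd_step (D := D) (σ := σ) (post := False) (p := p)
        (v := moveVec hand d) (plot := plot) (op := op)
        (W := fun q p' => q.out = out ∧
          ∃ G ⊆ (plot c.q c.Tape.head).toFinset,
            p' = p + (plottingTM M plot op).disp d (hand .leader).sign G)
        (K := fun g => (∃ f ∈ (plot c.q c.Tape.head).toFinset, ∃ k, op f = .move k) ∧ True)
        hterm hc hs
        (fun ph => ⟨rfl, ∅, Finset.empty_subset _, by simp [Controller.disp_empty]⟩)
        (fun ph => ⟨rfl, _, subset_rfl, by rw [hdisp]⟩)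
        (by
          rintro ⟨f, hf, hop⟩ g
          exact ⟨⟨f, by simpa using hf, hop⟩, trivial⟩)
      obtain ⟨X', hX', hgood⟩ := hRel.runs hX hrun
      rw [hdisp] at hs'
      refine ⟨X', ⟨s', hs', hX'⟩, Relation.TransGen.mono ?_ _ _ hgood⟩
      rintro Y Z ⟨h3, h4, h5⟩
      exact ⟨h3, h4, h5⟩)
    hC ⟨s₀, hs₀, hX₀⟩
  refine ⟨τ, fun t ht => ?_, hτ⟩
  rw [h0] at ht
  rcases ht.lt_or_eq with ht | rfl
  · obtain ⟨hp, hl⟩ := hT t (Nat.zero_le _) ht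
    rw [← hp]
    exact hl not_false
  · obtain ⟨x, y, hx, hy, rfl⟩ := hs₀
    exact (hRel.encodes hX₀).layout

/-- A property that holds on the way from every configuration of a set to another configuration
of this set holds forever. -/
theorem FairExecution.forall_of_progress {A : Algorithm} {ι : Type} {hand : ι → Handedness}
    {active : ℕ → Set ι} {C : ℕ → Config A ι} (hC : FairExecution hand active C)
    {J P : Config A ι → Prop}
    (h : ∀ X, J X → ∃ X', J X' ∧ Relation.TransGen (fun Y Z => Next hand Y Z ∧ P Y) X X')
    {T : ℕ} (hT : J (C T)) : ∀ t ≥ T, P (C t) := by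
  have key : ∀ n, ∃ t ≥ T + n, J (C t) ∧ ∀ s, T ≤ s → s < t → P (C s) := by
    intro n
    induction n with
    | zero => exact ⟨T, le_rfl, hT, fun s h1 h2 => by omega⟩
    | succ n ih =>
      obtain ⟨t, ht, hJ, hP⟩ := ih
      obtain ⟨X', hJ', hrun⟩ := h _ hJ
      obtain ⟨t', ht', rfl, hP'⟩ := hC.of_transGen hrun
      refine ⟨t', by omega, hJ', fun s h1 h2 => ?_⟩
      by_cases hs : s < t
      · exact hP s h1 hs
      · exact hP' s (by omega) h2
  intro t ht
  obtain ⟨t', ht', -, hP⟩ := key (t - T + 1)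
  exact hP t ht (by omega)

/-- Four particles compute every function that a Turing machine computes. -/
theorem turing_completeness [Finite Γ] [Finite Λ] (M : TM0.Machine Γ Λ) (σ : Γ) (f : ℕ →. ℕ)
    (hσ : σ ≠ default) (hf : TMComputes M σ f) :
    ∃ (V : Simulator) (halted : V.alg.State → Prop),
      ∀ (hand : Role → Handedness) (o : Grid) (d : ZMod 6) (n : ℕ)
        (active : ℕ → Set Role) (C : ℕ → V.Cfg),
        V.Starts hand o d (2 ^ n) 0 (C 0) → FairExecution hand active C →
        (∀ t, Layout o d (C t)) ∧
        (∀ t, halted (C t Role.leader).state → ∃ k ∈ f n, Encodes o d (2 ^ k) 0 (C t)) ∧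
        ((f n).Dom → ∃ T, StillFrom T C ∧ ∀ t ≥ T, halted (C t Role.leader).state) := by
  obtain ⟨D⟩ := nonempty_digits (Γ := Γ)
  obtain ⟨V, rd, hV⟩ := exists_realizes_tmCmd (m := 0) D M σ (fun _ _ => none) Fin.elim0 True
  refine ⟨V, fun s => rd s = .finish, fun hand o d n active C hC₀ hC => ?_⟩
  obtain ⟨Rel, hRel⟩ := hV hand d fun ⟨q, hq⟩ => by
    obtain ⟨f, -⟩ := exists_move_of_tmCmd hq
    exact f.elim0
  let W : TMState 0 Γ Λ → Grid → Prop := fun q p => q ≠ .finish ∧ p = o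
  -- what holds until the result has been reached
  let P : V.Cfg → Prop := Good rd d W False
  have hlayout : ∀ X, P X → Layout o d X := fun X hX => by
    rw [← hX.rel.2]
    exact hX.layout not_false
  let J : TM0.Cfg Γ Λ → V.Cfg → Prop := fun c X => ∃ s, TMRep D none c o s ∧ Rel s X
  obtain ⟨s₀, hs₀, hload⟩ := tmCmd_load (D := D) (M := M) (σ := σ) (plot := fun _ _ => none)
    (op := Fin.elim0) (post := True) (v := moveVec hand d) (W := W)
    (K := fun g => False ∧ True) (p := o) (by rintro x (rfl | rfl | rfl) <;> simp [W]) n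
  have hstart : Rel ⟨.count, ![n, 0, 0], o⟩ (C 0) :=
    hRel.start ⟨trivial, rfl⟩ (by rw [goedelNum_threePrimes]; exact hC₀)
  obtain ⟨X₀, hX₀, hrun⟩ := hRel.runs hstart hload
  have hstep : ∀ c c' X, J c X → TM0.step M c = some c' →
      ∃ X', J c' X' ∧ GoodSteps hand rd d W False X X' := by
    rintro c c' X ⟨s, hs, hX⟩ hc
    obtain ⟨s', hs', hrun⟩ := tmCmd_step (D := D) (σ := σ) (post := True) (p := o)
      (v := moveVec hand d) (plot := fun _ _ => none) (op := Fin.elim0) (W := W)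
      (K := fun g => False ∧ True) (by simp) hc hs (fun ph => by simp [W])
      (fun ph => by simp [W, outDir]) (by simp)
    obtain ⟨X', hX', hgood⟩ := hRel.runs hX hrun
    simp only [outDir, Option.bind_none, Option.elim_none, add_zero] at hs'
    exact ⟨X', ⟨s', hs', hX'⟩, hgood⟩
  -- if `f n` is defined, the machine halts and the result is converted; otherwise it runs forever
  -- and `halted` never holds
  by_cases hdom : (f n).Dom
  · obtain ⟨k, hk⟩ : ∃ k, k ∈ f n := ⟨_, Part.get_mem hdom⟩
    have hev : ListBlank.mk (List.replicate k σ) ∈ TM0.eval M (List.replicate n σ) := by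
      rw [hf n]
      exact Part.mem_map _ hk
    obtain ⟨c, hc, hck⟩ := (Part.mem_map_iff _).1 hev
    obtain ⟨hreach, hhalt⟩ := StateTransition.mem_eval.1 hc
    have hto : ∃ X, J c X ∧ GoodSteps hand rd d W False (C 0) X := by
      clear hc hck hhalt
      induction hreach with
      | refl => exact ⟨X₀, ⟨s₀, hs₀, hX₀⟩, hrun⟩
      | tail _ hbc ih =>
        obtain ⟨X, hX, hrun⟩ := ih
        obtain ⟨X', hX', hrun'⟩ := hstep _ _ _ hX hbc
        exact ⟨X', hX', hrun.trans hrun'⟩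
    obtain ⟨X₁, ⟨s₁, hs₁, hX₁⟩, hrun₁⟩ := hto
    obtain ⟨X₂, hX₂, hrun₂⟩ := hRel.runs (mv := False) hX₁ (tmCmd_unload (v := moveVec hand d)
      (plot := fun _ _ => none) (op := Fin.elim0) (W := W) hσ trivial (by simp) hhalt hs₁ hck
      fun x hx => ⟨hx, rfl⟩)
    obtain ⟨T, -, hT, hP⟩ := hC.of_transGen (hrun₁.trans hrun₂)
    subst hT
    have hlater := hC.of_stuck (hRel.stuck hX₂ rfl)
    have henc : Encodes o d (2 ^ k) 0 (C T) := by
      have := hRel.encodes hX₂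
      rwa [goedelNum_threePrimes] at this
    refine ⟨fun t => ?_, fun t ht => ?_, fun _ => ⟨T, fun t ht i => ?_, fun t ht => ?_⟩⟩
    · by_cases h : t < T
      · exact hlayout _ (hP t (Nat.zero_le _) h)
      · rw [hlater t (by omega)]
        exact henc.layout
    · by_cases h : t < T
      · exact absurd ht (hP t (Nat.zero_le _) h).rel.1
      · rw [hlater t (by omega)]
        exact ⟨k, hk, henc⟩
    · rw [hlater t ht]
      exact ⟨rfl, rfl⟩
    · rw [hlater t ht]
      exact hRel.read_eq hX₂
  · have hne : ∀ c, TM0.Reaches M (TM0.init (List.replicate n σ)) c → TM0.step M c ≠ none := by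
      intro c hc hn
      have h1 : c ∈ StateTransition.eval (TM0.step M) (TM0.init (List.replicate n σ)) :=
        StateTransition.mem_eval.2 ⟨hc, hn⟩
      have h2 : c.Tape.right₀ ∈ TM0.eval M (List.replicate n σ) := Part.mem_map _ h1
      rw [hf n] at h2
      obtain ⟨k, hk, -⟩ := (Part.mem_map_iff _).1 h2
      exact hdom (Part.dom_iff_mem.2 ⟨k, hk⟩)
    obtain ⟨T, -, rfl, hP⟩ := hC.of_transGen hrun
    have hforever := hC.forall_of_progress (P := P) (T := T)
      (J := fun X => ∃ c, TM0.Reaches M (TM0.init (List.replicate n σ)) c ∧ J c X)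
      (by
        rintro X ⟨c, hc, hX⟩
        obtain ⟨c', hc'⟩ := Option.ne_none_iff_exists'.1 (hne c hc)
        obtain ⟨X', hX', hgood⟩ := hstep _ _ _ hX hc'
        exact ⟨X', ⟨c', hc.tail hc', hX'⟩, hgood⟩)
      ⟨_, .refl, s₀, hs₀, hX₀⟩
    have hall : ∀ t, P (C t) := fun t => by
      by_cases h : t < T
      · exact hP t (Nat.zero_le _) h
      · exact hforever t (by omega)
    exact ⟨fun t => hlayout _ (hall t), fun t ht => absurd ht (hall t).rel.1,
      fun h => absurd h hdom⟩

end TM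

end Amoebot

theorem mainTheorem3 :
    -- four particles simulate any RAM with two registers
    (∀ Q : Amoebot.RAM.Program (Fin 2),
      ∃ (V : Amoebot.Simulator) (read : V.alg.State → ℕ),
        ∀ (hand : Amoebot.Role → Amoebot.Handedness) (o : Amoebot.Grid) (d : ZMod 6) (a : Fin 2 → ℕ)
          (active : ℕ → Set Amoebot.Role) (C : ℕ → V.Cfg),
          V.Starts hand o d (a 0) (a 1) (C 0) → Amoebot.FairExecution hand active C →
          (∀ t, Amoebot.Layout o d (C t)) ∧
          ∃ τ : ℕ → ℕ, τ 0 = 0 ∧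
            (Amoebot.ramController Q).SimulatedBy
              (fun x r₁ r₂ => r₁ = x.regs 0 ∧ r₂ = x.regs 1) (fun x => x.pc) read
              d (hand Amoebot.Role.leader).sign ⟨0, a⟩ o τ C) ∧
    -- four particles compute every function that a Turing machine computes
    (∀ (Γ Λ : Type) [Inhabited Γ] [Inhabited Λ] [Finite Γ] [Finite Λ]
        (M : Turing.TM0.Machine Γ Λ) (σ : Γ) (f : ℕ →. ℕ),
      σ ≠ default → Amoebot.TMComputes M σ f →
      ∃ (V : Amoebot.Simulator) (halted : V.alg.State → Prop),
        ∀ (hand : Amoebot.Role → Amoebot.Handedness) (o : Amoebot.Grid) (d : ZMod 6) (n : ℕ)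
          (active : ℕ → Set Amoebot.Role) (C : ℕ → V.Cfg),
          V.Starts hand o d (2 ^ n) 0 (C 0) → Amoebot.FairExecution hand active C →
          (∀ t, Amoebot.Layout o d (C t)) ∧
          (∀ t, halted (C t Amoebot.Role.leader).state →
            ∃ k ∈ f n, Amoebot.Encodes o d (2 ^ k) 0 (C t)) ∧
          ((f n).Dom →
            ∃ T, Amoebot.StillFrom T C ∧ ∀ t ≥ T, halted (C t Amoebot.Role.leader).state)) ∧
    -- four particles simulate any mobile RAM
    (∀ (c m : ℕ) (U : Amoebot.RAM.Program (Fin c ⊕ Fin m)) (op : Fin m → Amoebot.Operation),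
      ∃ (V : Amoebot.Simulator) (read : V.alg.State → ℕ × Finset (Fin m)),
        ∀ (hand : Amoebot.Role → Amoebot.Handedness) (o : Amoebot.Grid) (d : ZMod 6)
          (a : Fin c ⊕ Fin m → ℕ) (active : ℕ → Set Amoebot.Role) (C : ℕ → V.Cfg),
          (∀ f, a (Sum.inr f) = 0) →
          ((∃ f k, op f = Amoebot.Operation.move k) → Amoebot.CommonRotation hand) →
          V.Starts hand o d (Amoebot.goedel a) 0 (C 0) → Amoebot.FairExecution hand active C →
          ∃ τ : ℕ → ℕ, τ 0 = 0 ∧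
            (Amoebot.mobileRAM U op).SimulatedBy
              (fun x r₁ r₂ => r₁ = Amoebot.goedel x.regs ∧ r₂ = 0)
              (fun x => (x.pc, (Amoebot.mobileRAM U op).flags x)) read
              d (hand Amoebot.Role.leader).sign ⟨0, a⟩ o τ C) ∧
    -- four particles perform any sequence of operations that is output by a Turing machine
    (∀ (Γ Λ : Type) [Inhabited Γ] [Inhabited Λ] [Finite Γ] [Finite Λ]
        (M : Turing.TM0.Machine Γ Λ) (σ : Γ) (m : ℕ) (plot : Λ → Γ → Option (Fin m))
        (op : Fin m → Amoebot.Operation),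
      σ ≠ default →
      ∃ (V : Amoebot.Simulator) (read : V.alg.State → Option (Fin m)),
        ∀ (hand : Amoebot.Role → Amoebot.Handedness) (o : Amoebot.Grid) (d : ZMod 6) (n : ℕ)
          (active : ℕ → Set Amoebot.Role) (C : ℕ → V.Cfg),
          ((∃ f k, op f = Amoebot.Operation.move k) → Amoebot.CommonRotation hand) →
          V.Starts hand o d (2 ^ n) 0 (C 0) → Amoebot.FairExecution hand active C →
          ∃ τ : ℕ → ℕ, (∀ t ≤ τ 0, Amoebot.Layout o d (C t)) ∧
            (Amoebot.plottingTM M plot op).SimulatedBy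
              (fun _ _ r₂ => r₂ = 0) (fun x => x.2) read
              d (hand Amoebot.Role.leader).sign
              (Turing.TM0.init (List.replicate n σ), none) o τ C) := by
  refine ⟨Amoebot.ram_simulation, ?_, Amoebot.mobile_ram_simulation, ?_⟩
  · intro Γ Λ _ _ _ _ M σ f hσ hf
    exact Amoebot.turing_completeness M σ f hσ hf
  · intro Γ Λ _ _ _ _ M σ m plot op _
    exact Amoebot.programmed_movement M σ m plot op
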